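/- Throughout, a closed hyperbolic manifold is a compact connected manifold without boundary, of some dimension $n\ge 2$, with its path metric, locally isometric to hyperbolic $n$-space $\mathbb{H}^n$. A reflection of such an $M$ is an isometric involution $\tau : M\to M$ whose fixed point set $\mathrm{Fix}(\tau)$ is a nonempty, possibly disconnected, two-sided hypersurface of $M$. Let $\mathrm{sys}(M)$ be the infimum of the lengths of the closed geodesics of $M$, and let $$h(M)=\inf_\Omega \frac{\mathrm{area}(\partial\Omega)}{\mathrm{vol}(\Omega)},$$ where $\Omega$ ranges over the domains in $M$ with rectifiable boundary and $\mathrm{vol}(\Omega)\le\frac12\mathrm{vol}(M)$. For $\epsilon>0$ write $\mathrm{arcsch}(\epsilon)=\mathrm{arsinh}(1/\epsilon)$. (1) Let $(M_i)_{i\in\mathbb{N}}$ be a sequence of closed hyperbolic manifolds, with reflections $\tau_i: M_i\to M_i$, such that $\mathrm{vol}(M_i)\to\infty$, there is some $\epsilon>0$ with $h(M_i)>\epsilon$ for all $i$, and $\mathrm{sys}(M_i)\to\infty$. Then for all sufficiently large $i$ the hypersurface $\mathrm{Fix}(\tau_i)$ does not separate $M_i$, that is, $M_i\setminus\mathrm{Fix}(\tau_i)$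 is connected. (2) Let $M$ be a closed hyperbolic manifold with a reflection $\tau$, and let $\epsilon>0$. If $h(M)>\epsilon$ and $\mathrm{sys}(M)\ge 4\,\mathrm{arcsch}(\epsilon)$, then $\mathrm{Fix}(\tau)$ does not separate $M$. -/

import Mathlib

open Set Filter Topology MeasureTheory
open scoped ENNReal NNReal

noncomputable section

/-- Hyperbolic `n`-space, as the upper sheet of the hyperboloid
`t ^ 2 - |x| ^ 2 = 1` in Minkowski space `ℝ × ℝⁿ`. -/
structure HyperbolicSpace (n : ℕ) where
  /-- the timelike coordinate -/
  time : ℝ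
  /-- the spacelike coordinates -/
  space : EuclideanSpace ℝ (Fin n)
  time_pos : 0 < time
  time_sq_sub : time ^ 2 - ‖space‖ ^ 2 = 1

/-- The hyperbolic distance: `cosh d(p, q)` is minus the Lorentzian product of `p` and `q`. -/
def hyperbolicDist {n : ℕ} (p q : HyperbolicSpace n) : ℝ :=
  Real.arcosh (p.time * q.time - inner ℝ p.space q.space)

/-- The distance is the path metric: it is the infimum of the lengths of the paths joining the
two points, where the length of a path is its total variation. -/
def IsPathMetric (M : Type*) [MetricSpace M] : Prop :=
  ∀ x y : M, edist x y = ⨅ γ : Path x y, eVariationOn γ univ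

/-- Every point is the center of a ball isometric to a ball of the same radius in hyperbolic
`n`-space. -/
def IsLocallyHyperbolic (n : ℕ) (M : Type*) [MetricSpace M] : Prop :=
  ∀ x : M, ∃ r > 0, ∃ φ : M → HyperbolicSpace n,
    (∀ y ∈ Metric.ball x r, ∀ z ∈ Metric.ball x r, hyperbolicDist (φ y) (φ z) = dist y z) ∧
    φ '' Metric.ball x r = {p | hyperbolicDist (φ x) p < r}

/-- A closed hyperbolic `n`-manifold: a compact connected space with a path metric that is locally
isometric to hyperbolic `n`-space. The distance is the Riemannian distance of the hyperbolic
metric. Orientability is not required. -/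
structure IsClosedHyperbolicManifold (n : ℕ) (M : Type*) [MetricSpace M] : Prop where
  compact : CompactSpace M
  connected : ConnectedSpace M
  pathMetric : IsPathMetric M
  locallyHyperbolic : IsLocallyHyperbolic n M

/-- `S` is an embedded hypersurface of the `n`-manifold `M`: around each of its points there is a
chart of `M` in `ℝⁿ` that straightens `S` to a coordinate hyperplane. -/
def IsHypersurface (n : ℕ) {M : Type*} [TopologicalSpace M] (S : Set M) : Prop :=
  ∀ x ∈ S, ∃ (e : OpenPartialHomeomorph M (EuclideanSpace ℝ (Fin n))) (j : Fin n),
    x ∈ e.source ∧ ∀ y ∈ e.source, y ∈ S ↔ e y j = 0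

/-- `S` is two-sided: it has a bicollar, that is, an open neighbourhood homeomorphic to
`S × (-1, 1)` in which `S` is the zero level. -/
def IsTwoSided {M : Type*} [TopologicalSpace M] (S : Set M) : Prop :=
  ∃ c : S × Ioo (-1 : ℝ) 1 → M, IsOpenEmbedding c ∧
    ∀ (s : S) (t : Ioo (-1 : ℝ) 1), (t : ℝ) = 0 → c (s, t) = s

/-- A reflection: an isometric involution whose fixed point set is a nonempty (possibly
disconnected) two-sided hypersurface. For the fixed point set of an isometry, being a topological
hypersurface and being a smooth one is the same. -/
structure IsReflection (n : ℕ) {M : Type*} [MetricSpace M] (τ : M → M) : Prop where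
  isometry : Isometry τ
  involutive : Function.Involutive τ
  nonempty : (Function.fixedPoints τ).Nonempty
  hypersurface : IsHypersurface n (Function.fixedPoints τ)
  twoSided : IsTwoSided (Function.fixedPoints τ)

/-- `γ : ℝ → M` is a closed geodesic of length `ℓ`: it is `ℓ`-periodic and parametrized by arc
length, and locally it realizes the distance. -/
def IsClosedGeodesic {M : Type*} [MetricSpace M] (γ : ℝ → M) (ℓ : ℝ) : Prop :=
  0 < ℓ ∧ Function.Periodic γ ℓ ∧
    ∀ t, ∃ δ > 0, ∀ s ∈ Ioo (t - δ) (t + δ), ∀ s' ∈ Ioo (t - δ) (t + δ),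
      dist (γ s) (γ s') = |s - s'|

/-- The systole: the infimum of the lengths of closed geodesics. -/
def systole (M : Type*) [MetricSpace M] : ℝ≥0∞ :=
  ⨅ (ℓ : ℝ) (_ : ∃ γ : ℝ → M, IsClosedGeodesic γ ℓ), ENNReal.ofReal ℓ

/-- `S` is `d`-rectifiable: up to a set of zero `d`-dimensional measure, it is covered by countably
many Lipschitz images of subsets of `ℝᵈ`. -/
def IsRectifiable (d : ℕ) {M : Type*} [MetricSpace M] [MeasurableSpace M] [BorelSpace M]
    (S : Set M) : Prop :=
  ∃ (A : ℕ → Set (EuclideanSpace ℝ (Fin d))) (f : ℕ → EuclideanSpace ℝ (Fin d) → M),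
    (∀ k, ∃ K : ℝ≥0, LipschitzOnWith K (f k) (A k)) ∧
    Measure.euclideanHausdorffMeasure d (S \ ⋃ k, f k '' A k) = 0

/-- The volume of a subset of an `n`-manifold: its `n`-dimensional Hausdorff measure, normalized
to agree with Lebesgue measure on `ℝⁿ`. -/
def vol (n : ℕ) {M : Type*} [MetricSpace M] [MeasurableSpace M] [BorelSpace M]
    (S : Set M) : ℝ≥0∞ :=
  Measure.euclideanHausdorffMeasure n S

/-- The area of a subset of an `n`-manifold (`1 ≤ n`): its `(n - 1)`-dimensional Hausdorff measure,
normalized to agree with Lebesgue measure on `ℝⁿ⁻¹`. -/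
def area (n : ℕ) {M : Type*} [MetricSpace M] [MeasurableSpace M] [BorelSpace M]
    (S : Set M) : ℝ≥0∞ :=
  Measure.euclideanHausdorffMeasure (n - 1) S

/-- The Cheeger constant of an `n`-manifold: the infimum of `area (∂Ω) / vol Ω` over the domains
(nonempty connected open sets) `Ω` with rectifiable boundary and at most half the total volume. -/
def cheegerConstant (n : ℕ) (M : Type*) [MetricSpace M] [MeasurableSpace M] [BorelSpace M] :
    ℝ≥0∞ :=
  ⨅ (Ω : Set M) (_ : IsOpen Ω ∧ IsConnected Ω ∧ IsRectifiable (n - 1) (frontier Ω) ∧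
    vol n Ω ≤ vol n (univ : Set M) / 2), area n (frontier Ω) / vol n Ω

/-- A sequence of closed manifolds `M i` of dimensions `n i` is expander if the volumes tend to
infinity and the Cheeger constants are bounded below by a positive constant. -/
def IsExpanderSequence (n : ℕ → ℕ) (M : ℕ → Type*) [∀ i, MetricSpace (M i)]
    [∀ i, MeasurableSpace (M i)] [∀ i, BorelSpace (M i)] : Prop :=
  Tendsto (fun i => vol (n i) (univ : Set (M i))) atTop (𝓝 ⊤) ∧
    ∃ ε : ℝ, 0 < ε ∧ ∀ i, ENNReal.ofReal ε < cheegerConstant (n i) (M i)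

/-- The inverse hyperbolic cosecant: `arcsch x` is the number whose hyperbolic sine is `1 / x`,
for `x > 0`. -/
def arcsch (x : ℝ) : ℝ :=
  Real.arsinh (1 / x)

end

/-!
# Reflections of expanders of large systole do not separate

Suppose that the fixed point set `S` of the reflection `τ` separates `M`. In a hyperbolic chart
centered at a fixed point, `τ` is the orthogonal reflection in a hyperplane
(`IsReflection.exists_normal`). Hence a component `U` of the complement of `S` and its mirror image
exhaust the complement, and `S` is the boundary of `U` (`IsReflection.exists_isSide`,
`IsSide.frontier_eq`). So `U` has at most half of the volume of `M` and takes part in the infimum that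
defines the Cheeger constant.

The volume of `U` is bounded below by that of a collar of `S`. The geodesics normal to `S` give Fermi
coordinates (`exists_isFermiFlow`). If they are not injective up to the height `r`, then at the first
collision two normal geodesics of equal length `t < r` meet head-on, and together with their mirror
images they form a closed geodesic of length `4 t`. So if all closed geodesics have length at least
`4 r`, the collar of height `r` is embedded in `U` (`IsFermiFlow.injective_of_le_length`). In dimension
`m + 1 ≥ 2` its volume is the area of `S` times the integral of `cosh t ^ m` over `[0, r]`, which is at
least `sinh r` (`IsFermiFlow.sinh_mul_area_le_volume_side`). For `r = arcsch ε` it follows that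
`area S / vol U ≤ ε` (`cheegerConstant_le_of_not_isConnected`), and the Cheeger constant does not
exceed `ε`.

Two encodings keep the argument elementary. The points of a chart are vectors of Minkowski space, so
that geodesics, midpoints and point reflections are linear expressions; and Fermi coordinates are
characterized by the law of cosines for nearby points (`IsFermi`), which allows extending them step by
step without covering spaces or differential equations. Volumes are compared through
Lipschitz bounds for the Hausdorff measures of small cells.
-/

/-! ### The hyperboloid model -/

section Minkowski

variable {E : Type*} [NormedAddCommGroup E] [InnerProductSpace ℝ E]

/-- The Lorentz form on `ℝ × E`, with the sign that is positive on timelike vectors. -/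
def lorentz (p q : ℝ × E) : ℝ := p.1 * q.1 - inner ℝ p.2 q.2

/-- The upper sheet of the unit hyperboloid, a model of hyperbolic space. -/
def hyperboloid (E : Type*) [NormedAddCommGroup E] [InnerProductSpace ℝ E] : Set (ℝ × E) :=
  {p | 0 < p.1 ∧ lorentz p p = 1}

lemma lorentz_comm (p q : ℝ × E) : lorentz p q = lorentz q p := by
  simp only [lorentz, real_inner_comm]; ring

@[simp] lemma lorentz_add_left (p p' q : ℝ × E) :
    lorentz (p + p') q = lorentz p q + lorentz p' q := by
  simp only [lorentz, Prod.fst_add, Prod.snd_add, inner_add_left]; ring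

@[simp] lemma lorentz_sub_left (p p' q : ℝ × E) :
    lorentz (p - p') q = lorentz p q - lorentz p' q := by
  simp only [lorentz, Prod.fst_sub, Prod.snd_sub, inner_sub_left]; ring

@[simp] lemma lorentz_smul_left (c : ℝ) (p q : ℝ × E) :
    lorentz (c • p) q = c * lorentz p q := by
  simp only [lorentz, Prod.smul_fst, Prod.smul_snd, real_inner_smul_left, smul_eq_mul]; ring

@[simp] lemma lorentz_add_right (p q q' : ℝ × E) :
    lorentz p (q + q') = lorentz p q + lorentz p q' := by
  simp only [lorentz_comm p, lorentz_add_left]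

@[simp] lemma lorentz_sub_right (p q q' : ℝ × E) :
    lorentz p (q - q') = lorentz p q - lorentz p q' := by
  simp only [lorentz_comm p, lorentz_sub_left]

@[simp] lemma lorentz_smul_right (c : ℝ) (p q : ℝ × E) :
    lorentz p (c • q) = c * lorentz p q := by
  simp only [lorentz_comm p, lorentz_smul_left]

lemma lorentz_one_zero_right (p : ℝ × E) : lorentz p (1, 0) = p.1 := by
  simp [lorentz]

lemma one_zero_mem_hyperboloid : ((1, 0) : ℝ × E) ∈ hyperboloid E := by
  simp [hyperboloid, lorentz]

lemma lorentz_self (p : ℝ × E) : lorentz p p = p.1 ^ 2 - ‖p.2‖ ^ 2 := by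
  simp only [lorentz, real_inner_self_eq_norm_sq]; ring

lemma time_sq_of_mem {p : ℝ × E} (hp : p ∈ hyperboloid E) : p.1 ^ 2 = 1 + ‖p.2‖ ^ 2 := by
  have := hp.2
  rw [lorentz_self] at this; linarith

lemma one_le_time {p : ℝ × E} (hp : p ∈ hyperboloid E) : 1 ≤ p.1 := by
  have := time_sq_of_mem hp
  nlinarith [hp.1, sq_nonneg ‖p.2‖]

lemma one_le_lorentz {p q : ℝ × E} (hp : p ∈ hyperboloid E) (hq : q ∈ hyperboloid E) :
    1 ≤ lorentz p q := by
  have h1 := time_sq_of_mem hp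
  have h2 := time_sq_of_mem hq
  have h3 := real_inner_le_norm p.2 q.2
  have h4 : 1 + ‖p.2‖ * ‖q.2‖ ≤ p.1 * q.1 := by
    apply le_of_sq_le_sq _ (mul_pos hp.1 hq.1).le
    rw [mul_pow, h1, h2]
    nlinarith [sq_nonneg (‖p.2‖ - ‖q.2‖)]
  unfold lorentz; linarith

/-- A null vector orthogonal to a timelike vector vanishes. -/
lemma eq_zero_of_null_of_orthogonal {v q : ℝ × E} (hq : q ∈ hyperboloid E)
    (hv : lorentz v v = 0) (hvq : lorentz v q = 0) : v = 0 := by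
  have h1 := time_sq_of_mem hq
  rw [lorentz_self] at hv
  have h2 : v.1 * q.1 = inner ℝ v.2 q.2 := by unfold lorentz at hvq; linarith
  have h3 := abs_real_inner_le_norm v.2 q.2
  have h4 : (v.1 * q.1) ^ 2 ≤ (‖v.2‖ * ‖q.2‖) ^ 2 := by
    rw [h2, ← sq_abs]; gcongr
  have h5 : v.1 = 0 := by
    have : v.1 ^ 2 ≤ 0 := by
      rw [mul_pow, mul_pow, h1] at h4
      nlinarith
    exact pow_eq_zero_iff (two_ne_zero) |>.1 (le_antisymm this (sq_nonneg _))
  have h6 : v.2 = 0 := by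
    rw [h5] at hv
    have : ‖v.2‖ ^ 2 = 0 := by linarith
    simpa using this
  exact Prod.ext h5 h6

lemma eq_of_lorentz_eq_one {p q : ℝ × E} (hp : p ∈ hyperboloid E) (hq : q ∈ hyperboloid E)
    (h : lorentz p q = 1) : p = q := by
  rw [← sub_eq_zero]
  apply eq_zero_of_null_of_orthogonal hq
  · simp only [lorentz_sub_left, lorentz_sub_right, hp.2, hq.2, h, lorentz_comm q p]; ring
  · simp only [lorentz_sub_left, hq.2, h]; ring

/-- A unit timelike vector that makes a positive product with a point of the upper sheet lies on the
upper sheet. -/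
lemma mem_hyperboloid_of_pos {p q : ℝ × E} (hq : q ∈ hyperboloid E) (hp : lorentz p p = 1)
    (h : 0 < lorentz p q) : p ∈ hyperboloid E := by
  refine ⟨?_, hp⟩
  by_contra hneg
  push Not at hneg
  have h1 := time_sq_of_mem hq
  rw [lorentz_self] at hp
  have h3 := abs_real_inner_le_norm p.2 q.2
  have h4 : (‖p.2‖ * ‖q.2‖) ≤ -p.1 * q.1 := by
    apply le_of_sq_le_sq _ (mul_nonneg (by linarith) hq.1.le)
    have : ‖p.2‖ ^ 2 = p.1 ^ 2 - 1 := by linarith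
    rw [mul_pow, mul_pow, h1, this]
    nlinarith [sq_nonneg ‖q.2‖, sq_nonneg ‖p.2‖]
  have h5 := neg_abs_le (inner ℝ p.2 q.2)
  unfold lorentz at h
  linarith

/-- The point reflection in `q` preserves the upper sheet. -/
lemma reflect_mem_hyperboloid {p q : ℝ × E} (hp : p ∈ hyperboloid E) (hq : q ∈ hyperboloid E) :
    (2 * lorentz p q) • q - p ∈ hyperboloid E := by
  have h1 := one_le_lorentz hp hq
  apply mem_hyperboloid_of_pos hq
  · simp only [lorentz_sub_left, lorentz_sub_right, lorentz_smul_left, lorentz_smul_right, hp.2,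
      hq.2, lorentz_comm q p]; ring
  · simp only [lorentz_sub_left, lorentz_smul_left, hq.2]; linarith

/-- If `q` is the midpoint of `p` and `w`, then `w` is the point reflection of `p` in `q`. -/
lemma eq_reflect {p q w : ℝ × E} (hp : p ∈ hyperboloid E) (hq : q ∈ hyperboloid E)
    (hw : w ∈ hyperboloid E) {c : ℝ} (hpq : lorentz p q = c) (hwq : lorentz w q = c)
    (hpw : lorentz p w = 2 * c ^ 2 - 1) : w = (2 * c) • q - p := by
  rw [← sub_eq_zero]
  apply eq_zero_of_null_of_orthogonal hq
  · simp only [lorentz_sub_left, lorentz_sub_right, lorentz_smul_left, lorentz_smul_right, hp.2,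
      hq.2, hw.2, lorentz_comm q p, lorentz_comm q w, lorentz_comm w p, hpq, hwq, hpw]; ring
  · simp only [lorentz_sub_left, lorentz_smul_left, hq.2, hpq, hwq]; ring

lemma midpoint_mem_hyperboloid {p q : ℝ × E} (hp : p ∈ hyperboloid E) (hq : q ∈ hyperboloid E) :
    (√(2 + 2 * lorentz p q))⁻¹ • (p + q) ∈ hyperboloid E := by
  have h1 := one_le_lorentz hp hq
  have h2 : 0 < 2 + 2 * lorentz p q := by linarith
  have h3 := Real.sq_sqrt h2.le
  have h4 := Real.sqrt_pos.2 h2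
  refine ⟨?_, ?_⟩
  · simp only [Prod.smul_fst, Prod.fst_add, smul_eq_mul]
    have := hp.1
    have := hq.1
    positivity
  · simp only [lorentz_add_left, lorentz_add_right, lorentz_smul_left, lorentz_smul_right, hp.2,
      hq.2, lorentz_comm q p]
    have h5 : (√(2 + 2 * lorentz p q))⁻¹ ^ 2 * (2 + 2 * lorentz p q) = 1 := by
      rw [inv_pow, h3, inv_mul_cancel₀ h2.ne']
    linear_combination h5

/-- The geodesic through `q` with unit velocity `v`. -/
lemma cosh_smul_add_sinh_smul_mem {q v : ℝ × E} (hq : q ∈ hyperboloid E) (hv : lorentz v v = -1)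
    (hqv : lorentz q v = 0) (t : ℝ) : Real.cosh t • q + Real.sinh t • v ∈ hyperboloid E := by
  have := Real.cosh_sq t
  have := Real.cosh_pos t
  apply mem_hyperboloid_of_pos hq
  · simp only [lorentz_add_left, lorentz_add_right, lorentz_smul_left, lorentz_smul_right, hq.2,
      hv, lorentz_comm v q, hqv]; nlinarith
  · simp only [lorentz_add_left, lorentz_smul_left, hq.2, lorentz_comm v q, hqv]; linarith

/-- Fermi coordinates with respect to the hyperplane orthogonal to a unit vector `v` of `E`. -/
lemma exists_fermi_decomposition {p : ℝ × E} (hp : p ∈ hyperboloid E) {v : E} (hv : ‖v‖ = 1) :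
    ∃ q ∈ hyperboloid E, ∃ t : ℝ, inner ℝ q.2 v = 0 ∧
      p = Real.cosh t • q + Real.sinh t • ((0, v) : ℝ × E) := by
  have hvv : lorentz ((0, v) : ℝ × E) (0, v) = -1 := by
    simp [lorentz_self, hv]
  set t := Real.arsinh (-lorentz p (0, v)) with ht
  have hs : Real.sinh t = -lorentz p (0, v) := Real.sinh_arsinh _
  have hc := Real.cosh_pos t
  have hc2 := Real.cosh_sq t
  refine ⟨(Real.cosh t)⁻¹ • (p - Real.sinh t • ((0, v) : ℝ × E)), ⟨?_, ?_⟩, t, ?_, ?_⟩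
  · simp only [Prod.smul_fst, Prod.fst_sub, smul_eq_mul, mul_zero, sub_zero]
    have := hp.1
    positivity
  · simp only [lorentz_sub_left, lorentz_sub_right, lorentz_smul_left, lorentz_smul_right, hp.2,
      hvv, lorentz_comm (0, v) p, hs]
    rw [hs] at hc2
    field_simp
    rw [hc2]; ring
  · have : lorentz ((Real.cosh t)⁻¹ • (p - Real.sinh t • ((0, v) : ℝ × E))) (0, v) = 0 := by
      simp only [lorentz_sub_left, lorentz_smul_left, hvv, hs]; ring
    simp only [lorentz, mul_zero, zero_sub, neg_eq_zero] at this
    exact this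
  · rw [smul_smul, mul_inv_cancel₀ hc.ne', one_smul, sub_add_cancel]

/-- The Lorentz transformation that exchanges `(1, 0)` and `p`: the point reflection in their
midpoint. -/
noncomputable def swapBase (p v : ℝ × E) : ℝ × E :=
  (lorentz v ((1, 0) + p) / (1 + p.1)) • ((1, 0) + p) - v

lemma lorentz_swapBase {p : ℝ × E} (hp : p ∈ hyperboloid E) (v w : ℝ × E) :
    lorentz (swapBase p v) (swapBase p w) = lorentz v w := by
  have h : lorentz ((1, 0) + p) ((1, 0) + p) = 2 * (1 + p.1) := by
    simp only [lorentz_add_left, lorentz_add_right, hp.2, lorentz_one_zero_right,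
      lorentz_comm (1, 0) p, Prod.fst_add]; ring
  have := hp.1
  unfold swapBase
  simp only [lorentz_sub_left, lorentz_sub_right, lorentz_smul_left, lorentz_smul_right, h,
    lorentz_comm ((1, 0) + p) w]
  field_simp
  ring

lemma swapBase_base {p : ℝ × E} (hp : p ∈ hyperboloid E) : swapBase p (1, 0) = p := by
  have := hp.1
  have h : lorentz (1, 0) ((1, 0) + p) = 1 + p.1 := by
    rw [lorentz_comm, lorentz_one_zero_right]; rfl
  unfold swapBase
  rw [h, div_self (by linarith), one_smul, add_sub_cancel_left]

lemma swapBase_self {p : ℝ × E} (hp : p ∈ hyperboloid E) : swapBase p p = (1, 0) := by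
  have := hp.1
  have h : lorentz p ((1, 0) + p) = 1 + p.1 := by
    rw [lorentz_add_right, hp.2, lorentz_one_zero_right]; ring
  unfold swapBase
  rw [h, div_self (by linarith), one_smul, add_sub_cancel_right]

lemma swapBase_swapBase {p : ℝ × E} (hp : p ∈ hyperboloid E) (v : ℝ × E) :
    swapBase p (swapBase p v) = v := by
  have h : lorentz ((1, 0) + p) ((1, 0) + p) = 2 * (1 + p.1) := by
    simp only [lorentz_add_left, lorentz_add_right, hp.2, lorentz_one_zero_right,
      lorentz_comm (1, 0) p, Prod.fst_add]; ring
  have := hp.1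
  have h2 : lorentz (swapBase p v) ((1, 0) + p) = lorentz v ((1, 0) + p) := by
    unfold swapBase
    rw [lorentz_sub_left, lorentz_smul_left, h]
    field_simp
    ring
  rw [swapBase, h2, swapBase]
  abel

lemma swapBase_mem {p v : ℝ × E} (hp : p ∈ hyperboloid E) (hv : v ∈ hyperboloid E) :
    swapBase p v ∈ hyperboloid E := by
  apply mem_hyperboloid_of_pos hp
  · rw [lorentz_swapBase hp, hv.2]
  · nth_rewrite 2 [← swapBase_base hp]
    rw [lorentz_swapBase hp, lorentz_one_zero_right]
    exact hv.1

/-- The point of the hyperboloid above a vector. -/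
noncomputable def hyperboloidLift (u : E) : ℝ × E := (√(1 + ‖u‖ ^ 2), u)

lemma hyperboloidLift_mem (u : E) : hyperboloidLift u ∈ hyperboloid E := by
  have h : 0 < 1 + ‖u‖ ^ 2 := by positivity
  refine ⟨Real.sqrt_pos.2 h, ?_⟩
  rw [lorentz_self]; simp only [hyperboloidLift]; rw [Real.sq_sqrt h.le]; ring

lemma eq_hyperboloidLift {p : ℝ × E} (hp : p ∈ hyperboloid E) : p = hyperboloidLift p.2 := by
  refine Prod.ext ?_ rfl
  simp only [hyperboloidLift]
  rw [← time_sq_of_mem hp, Real.sqrt_sq hp.1.le]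

/-- The chordal form of the Lorentz product. -/
lemma two_mul_lorentz_sub_one {p q : ℝ × E} (hp : p ∈ hyperboloid E) (hq : q ∈ hyperboloid E) :
    2 * (lorentz p q - 1) = ‖p.2 - q.2‖ ^ 2 - (p.1 - q.1) ^ 2 := by
  have h1 := time_sq_of_mem hp
  have h2 := time_sq_of_mem hq
  have h3 := norm_sub_sq_real p.2 q.2
  unfold lorentz
  nlinarith

/-- At bounded height, the distance of the spacelike coordinates is at most `c` times the chordal
distance: the projection to the spacelike coordinates is nearly isometric near the base point. -/
lemma norm_sub_sq_le {p q : ℝ × E} (hp : p ∈ hyperboloid E) (hq : q ∈ hyperboloid E) {c : ℝ}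
    (hpc : p.1 ≤ c) (hqc : q.1 ≤ c) :
    ‖p.2 - q.2‖ ^ 2 ≤ c ^ 2 * (2 * (lorentz p q - 1)) := by
  have h1 := time_sq_of_mem hp
  have h2 := time_sq_of_mem hq
  have hp0 := hp.1
  have hq0 := hq.1
  have hab : |‖p.2‖ - ‖q.2‖| ≤ ‖p.2 - q.2‖ := abs_norm_sub_norm_le _ _
  have hab2 : (‖p.2‖ - ‖q.2‖) ^ 2 ≤ ‖p.2 - q.2‖ ^ 2 := by
    rw [← sq_abs]; gcongr
  rw [two_mul_lorentz_sub_one hp hq]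
  set a := ‖p.2‖
  set b := ‖q.2‖
  have ha : 0 ≤ a := norm_nonneg _
  have hb : 0 ≤ b := norm_nonneg _
  have hc : 0 < c := hp0.trans_le hpc
  -- with `m = √(c² - 1)`, one has `c (p₀ + q₀)⁻¹ (a + b) ≤ m`, which bounds the time difference
  have key : c ^ 2 * (p.1 - q.1) ^ 2 ≤ (c ^ 2 - 1) * (a - b) ^ 2 := by
    have e : (p.1 - q.1) * (p.1 + q.1) = (a - b) * (a + b) := by nlinarith
    have hs : 0 < (p.1 + q.1) ^ 2 := by positivity
    rw [← mul_le_mul_iff_left₀ hs]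
    have e2 : c ^ 2 * (p.1 - q.1) ^ 2 * (p.1 + q.1) ^ 2 = c ^ 2 * ((a - b) ^ 2 * (a + b) ^ 2) := by
      rw [mul_assoc, ← mul_pow, e, mul_pow]
    rw [e2]
    have hab0 : a * b ≤ p.1 * q.1 - 1 := by
      have : 1 + a * b ≤ p.1 * q.1 := by
        apply le_of_sq_le_sq _ (mul_pos hp0 hq0).le
        rw [mul_pow, h1, h2]
        nlinarith [sq_nonneg (a - b)]
      linarith
    have h5 : c ^ 2 * (a + b) ^ 2 ≤ (c ^ 2 - 1) * (p.1 + q.1) ^ 2 := by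
      have h6 : (a + b) ^ 2 ≤ (p.1 + q.1) ^ 2 - 4 := by nlinarith
      have h7 : (p.1 + q.1) ^ 2 ≤ 4 * c ^ 2 := by nlinarith
      nlinarith [sq_nonneg c]
    nlinarith [mul_le_mul_of_nonneg_left h5 (sq_nonneg (a - b))]
  have hc1 : 1 ≤ c := (one_le_time hp).trans hpc
  nlinarith [mul_le_mul_of_nonneg_left hab2 (by nlinarith : 0 ≤ c ^ 2 - 1)]

end Minkowski

/-! ### Maps that preserve inner products -/

section Rigidity

variable {E F : Type*} [NormedAddCommGroup E] [InnerProductSpace ℝ E] [NormedAddCommGroup F]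
  [InnerProductSpace ℝ F]

/-- A map that preserves inner products is linear. -/
def LinearIsometry.ofInner (f : E → F) (h : ∀ u v, inner ℝ (f u) (f v) = inner ℝ u v) :
    E →ₗᵢ[ℝ] F where
  toFun := f
  map_add' u v := by
    rw [← sub_eq_zero, ← inner_self_eq_zero (𝕜 := ℝ)]
    simp only [inner_sub_left, inner_sub_right, inner_add_left, inner_add_right, h]
    ring
  map_smul' c u := by
    rw [RingHom.id_apply, ← sub_eq_zero, ← inner_self_eq_zero (𝕜 := ℝ)]
    simp only [inner_sub_left, inner_sub_right, real_inner_smul_left, real_inner_smul_right, h]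
    ring
  norm_map' u := by
    have := h u u
    simp only [real_inner_self_eq_norm_sq] at this
    exact (sq_eq_sq₀ (norm_nonneg _) (norm_nonneg _)).1 this

/-- A map of a ball about the origin that preserves inner products is the restriction of a linear
isometry. -/
lemma exists_linearIsometry_of_inner {s : ℝ} (hs : 0 < s) (g : E → F)
    (h : ∀ u ∈ Metric.ball (0 : E) s, ∀ v ∈ Metric.ball (0 : E) s,
      inner ℝ (g u) (g v) = inner ℝ u v) :
    ∃ A : E →ₗᵢ[ℝ] F, ∀ u ∈ Metric.ball (0 : E) s, g u = A u := by
  -- the map is extended homogeneously, after scaling vectors into the ball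
  set c : E → ℝ := fun u => s / (1 + ‖u‖) with hc
  have hc0 : ∀ u, 0 < c u := fun u => by positivity
  have hcb : ∀ u, c u • u ∈ Metric.ball (0 : E) s := fun u => by
    rw [mem_ball_zero_iff, norm_smul, Real.norm_of_nonneg (hc0 u).le, hc]
    have : 0 < 1 + ‖u‖ := by positivity
    simp only
    rw [div_mul_eq_mul_div, div_lt_iff₀ this]
    nlinarith
  let A := LinearIsometry.ofInner (fun u => (c u)⁻¹ • g (c u • u)) (fun u v => by
    have := (hc0 u).ne'
    have := (hc0 v).ne'
    simp only [real_inner_smul_left, real_inner_smul_right, h _ (hcb u) _ (hcb v)]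
    field_simp)
  refine ⟨A, fun u hu => ?_⟩
  have h1 := (hc0 u).ne'
  rw [← sub_eq_zero, ← inner_self_eq_zero (𝕜 := ℝ)]
  have hA : A u = (c u)⁻¹ • g (c u • u) := rfl
  simp only [hA, inner_sub_left, inner_sub_right, real_inner_smul_left, real_inner_smul_right,
    h _ (hcb u) _ (hcb u), h _ (hcb u) _ hu, h _ hu _ (hcb u), h _ hu _ hu]
  field_simp
  ring

end Rigidity

/-! ### Hyperbolic charts -/

section Charts

lemma sq_le_two_mul_cosh_sub_one (d : ℝ) : d ^ 2 ≤ 2 * (Real.cosh d - 1) := by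
  have h : 2 * (Real.cosh d - 1) = (2 * Real.sinh (d / 2)) ^ 2 := by
    have h1 := Real.cosh_two_mul (d / 2)
    have h2 := Real.cosh_sq (d / 2)
    rw [mul_div_cancel₀ _ (two_ne_zero)] at h1
    rw [h1, h2]; ring
  rw [h]
  apply sq_le_sq.2
  rw [abs_mul, abs_two, Real.abs_sinh]
  have := Real.self_le_sinh_iff.2 (abs_nonneg (d / 2))
  rw [abs_div, abs_two] at this ⊢
  linarith

variable {n : ℕ}

/-- A point of `HyperbolicSpace n` as a vector of `ℝ × ℝⁿ`. -/
def HyperbolicSpace.toProd (p : HyperbolicSpace n) : ℝ × EuclideanSpace ℝ (Fin n) :=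
  (p.time, p.space)

lemma HyperbolicSpace.toProd_mem (p : HyperbolicSpace n) :
    p.toProd ∈ hyperboloid (EuclideanSpace ℝ (Fin n)) :=
  ⟨p.time_pos, by rw [lorentz_self]; exact p.time_sq_sub⟩

lemma cosh_hyperbolicDist (p q : HyperbolicSpace n) :
    Real.cosh (hyperbolicDist p q) = lorentz p.toProd q.toProd :=
  Real.cosh_arcosh (one_le_lorentz p.toProd_mem q.toProd_mem)

lemma hyperbolicDist_nonneg (p q : HyperbolicSpace n) : 0 ≤ hyperbolicDist p q :=
  Real.arcosh_nonneg (one_le_lorentz p.toProd_mem q.toProd_mem)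

/-- The triangle inequality of the hyperboloid, at the base point. -/
lemma lorentz_lt_cosh_add {E : Type*} [NormedAddCommGroup E] [InnerProductSpace ℝ E]
    {p q : ℝ × E} (hp : p ∈ hyperboloid E) (hq : q ∈ hyperboloid E) {a b : ℝ} (ha : 0 ≤ a)
    (hb : 0 ≤ b) (hpa : p.1 < Real.cosh a) (hqb : q.1 < Real.cosh b) :
    lorentz p q < Real.cosh (a + b) := by
  have h1 := time_sq_of_mem hp
  have h2 := time_sq_of_mem hq
  have hca := Real.cosh_sq a
  have hcb := Real.cosh_sq b
  have hp0 := hp.1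
  have hq0 := hq.1
  have h3 : ‖p.2‖ ≤ Real.sinh a := by
    apply le_of_sq_le_sq _ (Real.sinh_nonneg_iff.2 ha)
    nlinarith
  have h4 : ‖q.2‖ ≤ Real.sinh b := by
    apply le_of_sq_le_sq _ (Real.sinh_nonneg_iff.2 hb)
    nlinarith
  have h5 := abs_real_inner_le_norm p.2 q.2
  have h6 := neg_abs_le (inner ℝ p.2 q.2)
  rw [Real.cosh_add]
  unfold lorentz
  have h7 : ‖p.2‖ * ‖q.2‖ ≤ Real.sinh a * Real.sinh b := by gcongr
  have h8 : p.1 * q.1 < Real.cosh a * Real.cosh b := by gcongr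
  linarith

variable {M : Type*} [MetricSpace M]

/-- `φ` identifies the ball of radius `ρ` about `x` with a hyperbolic ball of radius `ρ`, the center
being mapped to the base point of the hyperboloid. -/
structure IsHypChart (φ : M → ℝ × EuclideanSpace ℝ (Fin n)) (x : M) (ρ : ℝ) : Prop where
  mem : ∀ y ∈ Metric.ball x ρ, φ y ∈ hyperboloid (EuclideanSpace ℝ (Fin n))
  cosh_dist : ∀ y ∈ Metric.ball x ρ, ∀ z ∈ Metric.ball x ρ,
    Real.cosh (dist y z) = lorentz (φ y) (φ z)
  map_center : φ x = (1, 0)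
  surj : ∀ p ∈ hyperboloid (EuclideanSpace ℝ (Fin n)), p.1 < Real.cosh ρ →
    ∃ y ∈ Metric.ball x ρ, φ y = p

/-- A local isometry to hyperbolic space can be recentered at all nearby points, with a radius that
does not depend on the point. -/
lemma exists_isHypChart_of_isLocallyHyperbolic (h : IsLocallyHyperbolic n M) (x : M) :
    ∃ r > 0, ∀ y ∈ Metric.ball x r, ∃ φ : M → ℝ × EuclideanSpace ℝ (Fin n), IsHypChart φ y r := by
  obtain ⟨r, hr, φ, h1, h2⟩ := h x
  refine ⟨r / 2, by positivity, fun y hy => ?_⟩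
  have hsub : Metric.ball y (r / 2) ⊆ Metric.ball x r :=
    Metric.ball_subset_ball' (by rw [Metric.mem_ball] at hy; linarith)
  have hyx : y ∈ Metric.ball x r := hsub (Metric.mem_ball_self (by positivity))
  have hxx : x ∈ Metric.ball x r := Metric.mem_ball_self hr
  have hdist : ∀ z ∈ Metric.ball x r, ∀ w ∈ Metric.ball x r,
      lorentz (φ z).toProd (φ w).toProd = Real.cosh (dist z w) := fun z hz w hw => by
    rw [← cosh_hyperbolicDist, h1 z hz w hw]
  set p := (φ y).toProd with hp
  have hpm := (φ y).toProd_mem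
  refine ⟨fun z => swapBase p (φ z).toProd, fun z hz => swapBase_mem hpm (φ z).toProd_mem,
    fun z hz w hw => ?_, swapBase_self hpm, fun q hq hqr => ?_⟩
  · rw [lorentz_swapBase hpm, hdist z (hsub hz) w (hsub hw)]
  · have hm := swapBase_mem hpm hq
    let Q : HyperbolicSpace n := ⟨(swapBase p q).1, (swapBase p q).2, hm.1, by
      have := hm.2; rwa [lorentz_self] at this⟩
    have hQ : Q.toProd = swapBase p q := rfl
    have hQp : ∀ z, lorentz (φ z).toProd Q.toProd = lorentz (swapBase p (φ z).toProd) q :=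
      fun z => by
        rw [hQ, ← lorentz_swapBase hpm, swapBase_swapBase hpm]
    have hlt : Real.cosh (hyperbolicDist (φ x) Q) < Real.cosh r := by
      rw [cosh_hyperbolicDist, hQp, show r = r / 2 + r / 2 by ring]
      refine lorentz_lt_cosh_add (swapBase_mem hpm (φ x).toProd_mem) hq (by positivity)
        (by positivity) ?_ hqr
      rw [← lorentz_one_zero_right, ← swapBase_self hpm, lorentz_swapBase hpm, hdist x hxx y hyx,
        Real.cosh_lt_cosh, abs_of_nonneg dist_nonneg, abs_of_pos (by positivity), dist_comm]
      exact hy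
    rw [Real.cosh_lt_cosh, abs_of_nonneg (hyperbolicDist_nonneg _ _), abs_of_pos hr] at hlt
    have : Q ∈ φ '' Metric.ball x r := by rw [h2]; exact hlt
    obtain ⟨z, hz, hzQ⟩ := this
    have hz2 : swapBase p (φ z).toProd = q := by
      rw [hzQ, hQ, swapBase_swapBase hpm]
    refine ⟨z, ?_, hz2⟩
    rw [← hz2, ← lorentz_one_zero_right, ← swapBase_self hpm, lorentz_swapBase hpm,
      hdist z hz y hyx, Real.cosh_lt_cosh, abs_of_nonneg dist_nonneg, abs_of_pos (by positivity)]
      at hqr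
    exact hqr

namespace IsHypChart

variable {φ : M → ℝ × EuclideanSpace ℝ (Fin n)} {x : M} {ρ : ℝ}

lemma time_eq (h : IsHypChart φ x ρ) {y : M} (hy : y ∈ Metric.ball x ρ) :
    (φ y).1 = Real.cosh (dist y x) := by
  rw [h.cosh_dist y hy x (Metric.mem_ball_self (Metric.pos_of_mem_ball hy)), h.map_center,
    lorentz_one_zero_right]

lemma mono (h : IsHypChart φ x ρ) {s : ℝ} (h0 : 0 < s) (hs : s ≤ ρ) : IsHypChart φ x s := by
  refine ⟨fun y hy => h.mem y (Metric.ball_subset_ball hs hy), fun y hy z hz =>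
    h.cosh_dist y (Metric.ball_subset_ball hs hy) z (Metric.ball_subset_ball hs hz),
    h.map_center, fun p hp hps => ?_⟩
  obtain ⟨y, hy, rfl⟩ := h.surj p hp (hps.trans_le (by
    rw [Real.cosh_le_cosh, abs_of_pos h0, abs_of_pos (h0.trans_le hs)]; exact hs))
  refine ⟨y, ?_, rfl⟩
  rw [h.time_eq hy, Real.cosh_lt_cosh, abs_of_nonneg dist_nonneg, abs_of_pos h0] at hps
  exact hps

lemma mem_ball_iff (h : IsHypChart φ x ρ) {y : M} (hy : y ∈ Metric.ball x ρ) {s : ℝ} (hs : 0 ≤ s) :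
    y ∈ Metric.ball x s ↔ (φ y).1 < Real.cosh s := by
  rw [h.time_eq hy, Real.cosh_lt_cosh, abs_of_nonneg dist_nonneg, abs_of_nonneg hs,
    Metric.mem_ball]

lemma dist_sq_le (h : IsHypChart φ x ρ) {y z : M} (hy : y ∈ Metric.ball x ρ)
    (hz : z ∈ Metric.ball x ρ) : 2 * (Real.cosh (dist y z) - 1) ≤ ‖(φ y).2 - (φ z).2‖ ^ 2 := by
  rw [h.cosh_dist y hy z hz, two_mul_lorentz_sub_one (h.mem y hy) (h.mem z hz)]
  nlinarith [sq_nonneg ((φ y).1 - (φ z).1)]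

lemma dist_le (h : IsHypChart φ x ρ) {y z : M} (hy : y ∈ Metric.ball x ρ)
    (hz : z ∈ Metric.ball x ρ) : dist y z ≤ ‖(φ y).2 - (φ z).2‖ :=
  le_of_sq_le_sq ((sq_le_two_mul_cosh_sub_one _).trans (h.dist_sq_le hy hz)) (norm_nonneg _)

lemma injOn (h : IsHypChart φ x ρ) : InjOn φ (Metric.ball x ρ) := fun y hy z hz hyz => by
  have := h.dist_le hy hz
  rw [hyz, sub_self, norm_zero] at this
  exact dist_le_zero.1 this

lemma norm_snd_lt_iff (h : IsHypChart φ x ρ) {y : M} (hy : y ∈ Metric.ball x ρ) {s : ℝ}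
    (hs : 0 ≤ s) : ‖(φ y).2‖ < Real.sinh s ↔ (φ y).1 < Real.cosh s := by
  have h1 := time_sq_of_mem (h.mem y hy)
  have h2 := Real.cosh_sq s
  rw [← sq_lt_sq₀ (norm_nonneg _) (Real.sinh_nonneg_iff.2 hs),
    ← sq_lt_sq₀ (h.mem y hy).1.le (Real.cosh_pos s).le]
  constructor <;> intro <;> linarith

lemma exists_of_norm_lt (h : IsHypChart φ x ρ) {u : EuclideanSpace ℝ (Fin n)}
    (hu : ‖u‖ < Real.sinh ρ) : ∃ y ∈ Metric.ball x ρ, φ y = hyperboloidLift u := by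
  refine h.surj _ (hyperboloidLift_mem u) ?_
  rw [← sq_lt_sq₀ (hyperboloidLift_mem u).1.le (Real.cosh_pos ρ).le,
    time_sq_of_mem (hyperboloidLift_mem u), Real.cosh_sq]
  have : ‖u‖ ^ 2 < Real.sinh ρ ^ 2 := by gcongr
  simp only [hyperboloidLift]
  linarith

/-- Connectedness can be checked in a chart: the inverse of a chart is a contraction for the
Euclidean distance of the spacelike coordinates, hence continuous. -/
lemma isPreconnected_preimage (h : IsHypChart φ x ρ)
    {S : Set (EuclideanSpace ℝ (Fin n))} (hS : IsPreconnected S)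
    (hsub : S ⊆ Metric.ball 0 (Real.sinh ρ)) :
    IsPreconnected {y ∈ Metric.ball x ρ | (φ y).2 ∈ S} := by
  have hex : ∀ u ∈ S, ∃ y ∈ Metric.ball x ρ, φ y = hyperboloidLift u := fun u hu =>
    h.exists_of_norm_lt (by simpa using hsub hu)
  have : Nonempty M := ⟨x⟩
  choose! χ hχ hφχ using hex
  have hcont : ContinuousOn χ S := by
    have : LipschitzOnWith 1 χ S := LipschitzOnWith.of_dist_le_mul fun u hu v hv => by
      have := h.dist_le (hχ u hu) (hχ v hv)
      rw [hφχ u hu, hφχ v hv] at this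
      simpa [hyperboloidLift, dist_eq_norm] using this
    exact this.continuousOn
  convert hS.image χ hcont using 1
  ext y
  constructor
  · rintro ⟨hy, hyS⟩
    refine ⟨(φ y).2, hyS, h.injOn (hχ _ hyS) hy ?_⟩
    rw [hφχ _ hyS, ← eq_hyperboloidLift (h.mem y hy)]
  · rintro ⟨u, hu, rfl⟩
    exact ⟨hχ u hu, by rw [hφχ u hu]; exact hu⟩

lemma isPreconnected_ball (h : IsHypChart φ x ρ) (hρ : 0 < ρ) :
    IsPreconnected (Metric.ball x ρ) := by
  convert h.isPreconnected_preimage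
    (convex_ball (0 : EuclideanSpace ℝ (Fin n)) (Real.sinh ρ)).isPreconnected subset_rfl using 1
  ext y
  refine ⟨fun hy => ⟨hy, ?_⟩, fun hy => hy.1⟩
  rw [mem_ball_zero_iff, h.norm_snd_lt_iff hy hρ.le]
  exact (h.mem_ball_iff hy hρ.le).1 hy

end IsHypChart

lemma exists_uniform_isHypChart [CompactSpace M] (h : IsLocallyHyperbolic n M) :
    ∃ ρ > 0, ∃ φ : M → M → ℝ × EuclideanSpace ℝ (Fin n), ∀ x, IsHypChart (φ x) x ρ := by
  suffices ∃ ρ > 0, ∀ x ∈ (univ : Set M), ∃ φ : M → ℝ × EuclideanSpace ℝ (Fin n),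
      IsHypChart φ x ρ by
    obtain ⟨ρ, hρ, H⟩ := this
    choose φ hφ using fun x => H x (mem_univ x)
    exact ⟨ρ, hρ, φ, hφ⟩
  refine isCompact_univ.induction_on (p := fun S : Set M => ∃ ρ > 0, ∀ x ∈ S,
    ∃ φ : M → ℝ × EuclideanSpace ℝ (Fin n), IsHypChart φ x ρ) ⟨1, one_pos, by simp⟩ ?_ ?_ ?_
  · rintro S T hST ⟨ρ, hρ, H⟩
    exact ⟨ρ, hρ, fun x hx => H x (hST hx)⟩
  · rintro S T ⟨ρ, hρ, H⟩ ⟨σ, hσ, K⟩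
    refine ⟨min ρ σ, lt_min hρ hσ, fun x hx => ?_⟩
    rcases hx with hx | hx
    · obtain ⟨φ, hφ⟩ := H x hx
      exact ⟨φ, hφ.mono (lt_min hρ hσ) (min_le_left _ _)⟩
    · obtain ⟨φ, hφ⟩ := K x hx
      exact ⟨φ, hφ.mono (lt_min hρ hσ) (min_le_right _ _)⟩
  · intro x _
    obtain ⟨r, hr, H⟩ := exists_isHypChart_of_isLocallyHyperbolic h x
    exact ⟨Metric.ball x r, mem_nhdsWithin_of_mem_nhds (Metric.ball_mem_nhds x hr), r, hr, H⟩

lemma locallyConnectedSpace_of_isHypChart {ρ : ℝ} (hρ : 0 < ρ)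
    {φ : M → M → ℝ × EuclideanSpace ℝ (Fin n)} (hφ : ∀ x, IsHypChart (φ x) x ρ) :
    LocallyConnectedSpace M := by
  refine locallyConnectedSpace_of_connected_bases (fun x s => Metric.ball x s)
    (fun _ s => 0 < s ∧ s ≤ ρ) (fun x => ?_) fun x s hs =>
      ((hφ x).mono hs.1 hs.2).isPreconnected_ball hs.1
  exact Metric.nhds_basis_ball.to_hasBasis (fun s hs => ⟨min s ρ, ⟨lt_min hs hρ, min_le_right _ _⟩,
    Metric.ball_subset_ball (min_le_left _ _)⟩) fun s hs => ⟨s, hs.1, subset_rfl⟩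

end Charts

/-! ### The local form of a reflection -/

section LocalReflection

variable {n : ℕ}

/-- A hypersurface separates its small neighbourhoods. -/
lemma IsHypersurface.exists_not_isPreconnected {M : Type*} [MetricSpace M] {S : Set M}
    (hS : IsHypersurface n S) {x : M} (hx : x ∈ S) {ρ : ℝ} (hρ : 0 < ρ) :
    ∃ s > 0, s ≤ ρ ∧ ¬ IsPreconnected (Metric.ball x s \ S) := by
  obtain ⟨e, j, hxe, he⟩ := hS x hx
  obtain ⟨s, hs, hsub⟩ := Metric.isOpen_iff.1 e.open_source x hxe
  refine ⟨min s ρ, lt_min hs hρ, min_le_right _ _, fun hpre => ?_⟩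
  set B := Metric.ball x (min s ρ) with hB
  have hBs : B ⊆ e.source := (Metric.ball_subset_ball (min_le_left _ _)).trans hsub
  have hxB : x ∈ B := Metric.mem_ball_self (lt_min hs hρ)
  have hopen : IsOpen (e '' B) := e.isOpen_image_of_subset_source Metric.isOpen_ball hBs
  have hcont : Continuous fun t : ℝ => e x + t • EuclideanSpace.single j (1 : ℝ) := by fun_prop
  have hnhds : ∀ᶠ t in 𝓝 (0 : ℝ), e x + t • EuclideanSpace.single j (1 : ℝ) ∈ e '' B := by
    apply hcont.continuousAt.eventually_mem
    apply hopen.mem_nhds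
    simpa using mem_image_of_mem e hxB
  obtain ⟨δ, hδ, hball⟩ := Metric.eventually_nhds_iff.1 hnhds
  have hex : e x j = 0 := (he x hxe).1 hx
  have hpt : ∀ t : ℝ, |t| < δ → t ≠ 0 → ∃ y ∈ B \ S, e y j = t := fun t ht ht0 => by
    obtain ⟨y, hy, hyt⟩ := hball (y := t) (by simpa using ht)
    have hyj : e y j = t := by rw [hyt]; simp [hex]
    exact ⟨y, ⟨hy, fun hyS => ht0 (by rw [← hyj]; exact (he y (hBs hy)).1 hyS)⟩, hyj⟩
  obtain ⟨y, hy, hyt⟩ := hpt (δ / 2) (by rw [abs_of_pos] <;> linarith) (by positivity)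
  obtain ⟨z, hz, hzt⟩ := hpt (-(δ / 2)) (by rw [abs_neg, abs_of_pos] <;> linarith)
    (by simp; linarith)
  have hcontB : ContinuousOn (fun w => e w j) (B \ S) := by
    have h1 : ContinuousOn e (B \ S) := e.continuousOn.mono (sdiff_subset.trans hBs)
    fun_prop
  obtain ⟨w, hw, hw0⟩ := hpre.intermediate_value hz hy hcontB
    (show (0 : ℝ) ∈ Icc (e z j) (e y j) by rw [hyt, hzt]; constructor <;> linarith)
  exact hw.2 ((he w (hBs hw.1)).2 hw0)

/-- Removing a subspace of codimension different from one does not disconnect a ball. -/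
lemma isPreconnected_ball_diff {E : Type*} [NormedAddCommGroup E] [InnerProductSpace ℝ E]
    [FiniteDimensional ℝ E] (V : Submodule ℝ E) (hV : Module.finrank ℝ Vᗮ ≠ 1) {s : ℝ}
    (hs : 0 < s) : IsPreconnected (Metric.ball (0 : E) s \ V) := by
  rcases Nat.lt_or_gt_of_ne hV with h0 | h2
  · have : Vᗮ = ⊥ := Submodule.finrank_eq_zero.1 (by omega)
    rw [Submodule.orthogonal_eq_bot_iff] at this
    subst this
    simpa using isPreconnected_empty
  · have hc : 1 < Module.rank ℝ (E ⧸ V) := by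
      rw [← Module.finrank_eq_rank]
      have h1 := V.finrank_quotient_add_finrank
      have h3 := V.finrank_add_finrank_orthogonal
      exact_mod_cast (by omega : 1 < Module.finrank ℝ (E ⧸ V))
    have hconn := (isConnected_compl_of_one_lt_codim hc).isPreconnected
    -- the radial homeomorphism of the space with the ball preserves the subspace
    have hpos : ∀ u : E, 0 < √(1 + ‖u‖ ^ 2) := fun u => Real.sqrt_pos.2 (by positivity)
    have hcont : Continuous fun u : E => (s / √(1 + ‖u‖ ^ 2)) • u := by
      refine Continuous.smul (Continuous.div continuous_const (by fun_prop) fun u => (hpos u).ne')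
        continuous_id
    convert hconn.image _ hcont.continuousOn using 1
    ext w
    simp only [Set.mem_sdiff, mem_ball_zero_iff, SetLike.mem_coe, mem_image, mem_compl_iff]
    constructor
    · rintro ⟨hw, hwV⟩
      have hd : 0 < s ^ 2 - ‖w‖ ^ 2 := by nlinarith [norm_nonneg w]
      have hd' := Real.sqrt_pos.2 hd
      have hsq := Real.sq_sqrt hd.le
      refine ⟨(√(s ^ 2 - ‖w‖ ^ 2))⁻¹ • w, fun h => hwV ?_, ?_⟩
      · have := V.smul_mem (√(s ^ 2 - ‖w‖ ^ 2)) h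
        rwa [smul_smul, mul_inv_cancel₀ hd'.ne', one_smul] at this
      · have e1 : 1 + ‖(√(s ^ 2 - ‖w‖ ^ 2))⁻¹ • w‖ ^ 2 = (s / √(s ^ 2 - ‖w‖ ^ 2)) ^ 2 := by
          rw [norm_smul, norm_inv, Real.norm_of_nonneg hd'.le, div_pow, mul_pow, inv_pow, hsq]
          field_simp
          ring
        rw [e1, Real.sqrt_sq (by positivity), smul_smul]
        have : s / (s / √(s ^ 2 - ‖w‖ ^ 2)) * (√(s ^ 2 - ‖w‖ ^ 2))⁻¹ = 1 := by
          field_simp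
        rw [this, one_smul]
    · rintro ⟨u, hu, rfl⟩
      have hc0 : 0 < s / √(1 + ‖u‖ ^ 2) := div_pos hs (hpos u)
      refine ⟨?_, fun h => hu ?_⟩
      · rw [norm_smul, Real.norm_of_nonneg hc0.le, div_mul_eq_mul_div, div_lt_iff₀ (hpos u)]
        have : ‖u‖ < √(1 + ‖u‖ ^ 2) := Real.lt_sqrt_of_sq_lt (by linarith)
        gcongr
      · have := V.smul_mem (s / √(1 + ‖u‖ ^ 2))⁻¹ h
        rwa [smul_smul, inv_mul_cancel₀ hc0.ne', one_smul] at this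

variable {M : Type*} [MetricSpace M] {τ : M → M} {x : M} {ρ : ℝ}
  {φ : M → ℝ × EuclideanSpace ℝ (Fin n)}

/-- An isometry that fixes the center of a chart is linear in the chart. -/
lemma IsHypChart.exists_linearIsometry (h : IsHypChart φ x ρ) (hρ : 0 < ρ) (hτ : Isometry τ)
    (hx : τ x = x) : ∃ A : EuclideanSpace ℝ (Fin n) →ₗᵢ[ℝ] EuclideanSpace ℝ (Fin n),
      ∀ y ∈ Metric.ball x ρ, (φ (τ y)).2 = A (φ y).2 := by
  have hdx : ∀ y, dist (τ y) x = dist y x := fun y => by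
    conv_lhs => rw [← hx]
    exact hτ.dist_eq y x
  have hτb : ∀ y ∈ Metric.ball x ρ, τ y ∈ Metric.ball x ρ := fun y hy => by
    rw [Metric.mem_ball, hdx]; exact hy
  have htime : ∀ y ∈ Metric.ball x ρ, (φ (τ y)).1 = (φ y).1 := fun y hy => by
    rw [h.time_eq hy, h.time_eq (hτb y hy), hdx]
  have : Nonempty M := ⟨x⟩
  have hex : ∀ u ∈ Metric.ball (0 : EuclideanSpace ℝ (Fin n)) (Real.sinh ρ),
      ∃ y ∈ Metric.ball x ρ, φ y = hyperboloidLift u := fun u hu =>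
    h.exists_of_norm_lt (by simpa using hu)
  choose! χ hχ hφχ using hex
  obtain ⟨A, hA⟩ := exists_linearIsometry_of_inner (Real.sinh_pos_iff.2 hρ)
    (fun u => (φ (τ (χ u))).2) (fun u hu v hv => by
      have h1 := h.cosh_dist _ (hτb _ (hχ u hu)) _ (hτb _ (hχ v hv))
      rw [hτ.dist_eq, h.cosh_dist _ (hχ u hu) _ (hχ v hv)] at h1
      unfold lorentz at h1
      rw [htime _ (hχ u hu), htime _ (hχ v hv), hφχ u hu, hφχ v hv] at h1
      simp only [hyperboloidLift] at h1
      linarith)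
  refine ⟨A, fun y hy => ?_⟩
  have hu : (φ y).2 ∈ Metric.ball (0 : EuclideanSpace ℝ (Fin n)) (Real.sinh ρ) := by
    rw [mem_ball_zero_iff, h.norm_snd_lt_iff hy hρ.le, ← h.mem_ball_iff hy hρ.le]
    exact hy
  rw [← hA _ hu]
  congr 3
  exact h.injOn hy (hχ _ hu) (by rw [hφχ _ hu, ← eq_hyperboloidLift (h.mem y hy)])

/-- In a chart centered at a fixed point, a reflection is the orthogonal reflection in a hyperplane.
It is a linear involution, and its fixed space has codimension one because the fixed point set
separates small balls. -/
lemma IsReflection.exists_normal (hτ : IsReflection n τ) (hx : τ x = x) (h : IsHypChart φ x ρ)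
    (hρ : 0 < ρ) : ∃ v : EuclideanSpace ℝ (Fin n), ‖v‖ = 1 ∧ ∀ y ∈ Metric.ball x ρ,
      φ (τ y) = φ y - (2 * inner ℝ (φ y).2 v) • ((0, v) : ℝ × EuclideanSpace ℝ (Fin n)) := by
  have hdx : ∀ y, dist (τ y) x = dist y x := fun y => by
    conv_lhs => rw [← hx]
    exact hτ.isometry.dist_eq y x
  have hτb : ∀ y ∈ Metric.ball x ρ, τ y ∈ Metric.ball x ρ := fun y hy => by
    rw [Metric.mem_ball, hdx]; exact hy
  obtain ⟨A, hA⟩ := h.exists_linearIsometry hρ hτ.isometry hx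
  have hAA : ∀ u, A (A u) = u := by
    intro u
    set c := Real.sinh ρ / (1 + ‖u‖) with hc
    have hs := Real.sinh_pos_iff.2 hρ
    have hc0 : 0 < c := by positivity
    have hcu : ‖c • u‖ < Real.sinh ρ := by
      have : 0 < 1 + ‖u‖ := by positivity
      rw [norm_smul, Real.norm_of_nonneg hc0.le, hc, div_mul_eq_mul_div, div_lt_iff₀ this]
      nlinarith
    obtain ⟨y, hy, hyu⟩ := h.exists_of_norm_lt hcu
    have h1 := hA _ (hτb y hy)
    rw [hτ.involutive, hA y hy, hyu] at h1
    simp only [hyperboloidLift, map_smul] at h1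
    exact (smul_right_injective _ hc0.ne' h1).symm
  let V : Submodule ℝ (EuclideanSpace ℝ (Fin n)) :=
    LinearMap.eqLocus A.toLinearMap LinearMap.id
  have hV : ∀ u, u ∈ V ↔ A u = u := fun u => Iff.rfl
  have hperp : ∀ u ∈ Vᗮ, A u = -u := by
    intro u hu
    have h1 : A u + u ∈ V := by
      rw [hV, map_add, hAA, add_comm]
    have h2 : inner ℝ (A u + u) (A u + u) = 0 := by
      rw [inner_add_right]
      have e1 : inner ℝ (A u + u) u = 0 := (Submodule.mem_orthogonal V u).1 hu _ h1
      have e2 : inner ℝ (A u + u) (A u) = inner ℝ (A u + u) u := by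
        rw [← A.inner_map_map (A u + u) u, (hV _).1 h1]
      rw [e2, e1, add_zero]
    exact eq_neg_of_add_eq_zero_left (inner_self_eq_zero.1 h2)
  have hfix : ∀ y ∈ Metric.ball x ρ, (y ∈ Function.fixedPoints τ ↔ (φ y).2 ∈ V) := by
    intro y hy
    rw [hV, ← hA y hy, Function.mem_fixedPoints, Function.IsFixedPt]
    refine ⟨fun h => by rw [h], fun h' => h.injOn (hτb y hy) hy ?_⟩
    rw [eq_hyperboloidLift (h.mem y hy), eq_hyperboloidLift (h.mem _ (hτb y hy)), h']
  have hrank : Module.finrank ℝ Vᗮ = 1 := by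
    by_contra hne
    obtain ⟨s, hs, hsρ, hnot⟩ := hτ.hypersurface.exists_not_isPreconnected hx hρ
    apply hnot
    have hs' := h.mono hs hsρ
    convert hs'.isPreconnected_preimage (isPreconnected_ball_diff V hne (Real.sinh_pos_iff.2 hs))
      sdiff_subset using 1
    ext y
    rw [Set.mem_sdiff, mem_ofPred_eq]
    refine and_congr_right fun hy => ?_
    rw [hfix y (Metric.ball_subset_ball hsρ hy), Set.mem_sdiff, mem_ball_zero_iff,
      hs'.norm_snd_lt_iff hy hs.le, ← hs'.mem_ball_iff hy hs.le]
    simp only [SetLike.mem_coe, hy, true_and]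
  obtain ⟨w, hw0, hw⟩ := finrank_eq_one_iff'.1 hrank
  have hw0' : ‖(w : EuclideanSpace ℝ (Fin n))‖ ≠ 0 := by simpa using hw0
  set v : EuclideanSpace ℝ (Fin n) := ‖(w : EuclideanSpace ℝ (Fin n))‖⁻¹ • w with hv
  have hv1 : ‖v‖ = 1 := by
    rw [hv, norm_smul, norm_inv, norm_norm, inv_mul_cancel₀ hw0']
  have hvV : v ∈ Vᗮ := Vᗮ.smul_mem _ w.2
  have hAv : ∀ u, A u = u - (2 * inner ℝ u v) • v := by
    intro u
    have hmem : u - inner ℝ u v • v ∈ V := by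
      rw [← Submodule.orthogonal_orthogonal V, Submodule.mem_orthogonal]
      intro z hz
      obtain ⟨c, hc⟩ := hw ⟨z, hz⟩
      have hc' : z = (c * ‖(w : EuclideanSpace ℝ (Fin n))‖) • v := by
        rw [hv, smul_smul, mul_assoc, mul_inv_cancel₀ hw0', mul_one]
        exact (congrArg Subtype.val hc).symm
      rw [hc', real_inner_smul_left, inner_sub_right, real_inner_smul_right,
        real_inner_self_eq_norm_sq, hv1, real_inner_comm]
      ring
    have h1 := (hV _).1 hmem
    rw [map_sub, map_smul, hperp v hvV] at h1
    have h2 : A u = u - inner ℝ u v • v + inner ℝ u v • (-v) := by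
      rw [← h1]; abel
    rw [h2, two_mul, add_smul, smul_neg]; abel
  refine ⟨v, hv1, fun y hy => Prod.ext ?_ ?_⟩
  · simp [h.time_eq hy, h.time_eq (hτb y hy), hdx]
  · simp [hA y hy, hAv]

end LocalReflection

/-! ### The sides of a separating fixed point set -/

section Sides

variable {n : ℕ} {M : Type*} [MetricSpace M] {τ : M → M}

/-- `U` is a side of the fixed point set of `τ`: the complement of the fixed point set is the
disjoint union of the connected open sets `U` and `τ U`. -/
structure IsSide (τ : M → M) (U : Set M) : Prop where
  isOpen : IsOpen U
  isConnected : IsConnected U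
  not_fixed : ∀ y ∈ U, τ y ≠ y
  not_mem : ∀ y ∈ U, τ y ∉ U
  mem_or_mem : ∀ y, τ y ≠ y → y ∈ U ∨ τ y ∈ U

/-- A connected set without fixed points that meets a side lies in it. -/
lemma IsSide.subset_of_isPreconnected {U : Set M} (hU : IsSide τ U) (hτ : Continuous τ)
    {S : Set M} (hS : IsPreconnected S) (hfix : ∀ y ∈ S, τ y ≠ y) (hne : (S ∩ U).Nonempty) :
    S ⊆ U :=
  hS.subset_left_of_subset_union hU.isOpen (hU.isOpen.preimage hτ)
    (disjoint_left.2 fun y hy hy' => hU.not_mem y hy hy')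
    (fun y hy => hU.mem_or_mem y (hfix y hy)) hne

variable {ρ : ℝ} {φ : M → M → ℝ × EuclideanSpace ℝ (Fin n)}

lemma IsReflection.mem_closure_compl (hτ : IsReflection n τ) (x : M) :
    x ∈ closure {y | τ y ≠ y} := by
  by_cases hx : τ x = x
  · rw [Metric.mem_closure_iff]
    intro ε hε
    obtain ⟨s, hs, hsε, hnot⟩ := hτ.hypersurface.exists_not_isPreconnected hx hε
    have : (Metric.ball x s \ Function.fixedPoints τ).Nonempty := by
      by_contra h
      rw [not_nonempty_iff_eq_empty] at h
      exact hnot (h ▸ isPreconnected_empty)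
    obtain ⟨y, hy, hyf⟩ := this
    exact ⟨y, hyf, by rw [dist_comm]; exact (Metric.mem_ball.1 hy).trans_le hsε⟩
  · exact subset_closure hx

/-- The half balls on either side of the fixed point set are connected. -/
lemma IsHypChart.isPreconnected_halfBall {φ : M → ℝ × EuclideanSpace ℝ (Fin n)} {x : M}
    (h : IsHypChart φ x ρ) (hρ : 0 < ρ) (v : EuclideanSpace ℝ (Fin n)) :
    IsPreconnected {y ∈ Metric.ball x ρ | 0 < inner ℝ (φ y).2 v} := by
  have hconv : Convex ℝ (Metric.ball (0 : EuclideanSpace ℝ (Fin n)) (Real.sinh ρ) ∩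
      {u | 0 < inner ℝ u v}) := by
    refine (convex_ball _ _).inter ?_
    refine convex_halfSpace_gt (f := fun u => inner ℝ u v) ⟨fun a b => inner_add_left _ _ _,
      fun c a => ?_⟩ 0
    simp [real_inner_smul_left]
  convert h.isPreconnected_preimage hconv.isPreconnected inter_subset_left using 1
  ext y
  refine and_congr_right fun hy => ?_
  simp only [mem_inter_iff, mem_ball_zero_iff, h.norm_snd_lt_iff hy hρ.le,
    ← h.mem_ball_iff hy hρ.le, hy, true_and, mem_ofPred_eq]

/-- If the complement of the fixed point set is disconnected, it has a side: near a fixed point the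
reflection exchanges the two half balls, so the closure of the union of a component and its mirror
image is open. -/
lemma IsReflection.exists_isSide [ConnectedSpace M] (hτ : IsReflection n τ) (hρ : 0 < ρ)
    (hφ : ∀ x, IsHypChart (φ x) x ρ) (hsep : ¬ IsConnected (Function.fixedPoints τ)ᶜ) :
    ∃ U, IsSide τ U := by
  have : LocallyConnectedSpace M := locallyConnectedSpace_of_isHypChart hρ hφ
  have hcont := hτ.isometry.continuous
  have hinv := hτ.involutive
  set S : Set M := (Function.fixedPoints τ)ᶜ with hS
  have hSmem : ∀ y, y ∈ S ↔ τ y ≠ y := fun y => Iff.rfl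
  have hSopen : IsOpen S := (isClosed_fixedPoints hcont).isOpen_compl
  have hτS : ∀ y, τ y ∈ S ↔ y ∈ S := fun y => by
    rw [hSmem, hSmem, hinv y]; exact ne_comm
  obtain ⟨x₀, hx₀⟩ := hτ.nonempty
  obtain ⟨y₀, hy₀⟩ : S.Nonempty := by
    have := hτ.mem_closure_compl x₀
    exact closure_nonempty_iff.1 ⟨x₀, this⟩
  set U := connectedComponentIn S y₀ with hU
  have hUpre : IsPreconnected U := isPreconnected_connectedComponentIn
  have hUS : U ⊆ S := connectedComponentIn_subset S y₀
  have habs : ∀ T : Set M, IsPreconnected T → T ⊆ S → (T ∩ U).Nonempty → T ⊆ U := by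
    rintro T hT hTS ⟨z, hzT, hzU⟩
    rw [hU, connectedComponentIn_eq hzU]
    exact hT.subset_connectedComponentIn hzT hTS
  have habs' : ∀ T : Set M, IsPreconnected T → T ⊆ S → (T ∩ (τ ⁻¹' U)).Nonempty →
      T ⊆ τ ⁻¹' U := by
    rintro T hT hTS ⟨z, hzT, hzU⟩
    rw [← image_subset_iff]
    refine habs _ (hT.image τ hcont.continuousOn) ?_ ⟨τ z, mem_image_of_mem _ hzT, hzU⟩
    rintro _ ⟨w, hw, rfl⟩
    exact (hτS w).2 (hTS hw)
  set D := U ∪ τ ⁻¹' U with hD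
  have hDS : D ⊆ S := union_subset hUS fun y hy => (hτS y).1 (hUS hy)
  have hDτ : ∀ y ∈ D, τ y ∈ D := by
    rintro y (hy | hy)
    · right; rw [mem_preimage, hinv y]; exact hy
    · left; exact hy
  have habsD : ∀ T : Set M, IsPreconnected T → T ⊆ S → (T ∩ D).Nonempty → T ⊆ D := by
    rintro T hT hTS ⟨z, hzT, hzU | hzU⟩
    · exact (habs T hT hTS ⟨z, hzT, hzU⟩).trans subset_union_left
    · exact (habs' T hT hTS ⟨z, hzT, hzU⟩).trans subset_union_right
  have hcomp : ∀ x ∈ S, x ∈ closure D → x ∈ D := fun x hxS hx => by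
    have hopen : IsOpen (connectedComponentIn S x) := hSopen.connectedComponentIn
    have hmem := mem_connectedComponentIn hxS
    obtain ⟨z, hz⟩ := mem_closure_iff.1 hx _ hopen hmem
    exact habsD _ isPreconnected_connectedComponentIn (connectedComponentIn_subset S x) ⟨z, hz⟩ hmem
  have hDopen : IsOpen D := by
    have : IsOpen U := hSopen.connectedComponentIn
    exact this.union (this.preimage hcont)
  have hclopen : IsOpen (closure D) := by
    rw [isOpen_iff_mem_nhds]
    intro x hx
    by_cases hxS : x ∈ S
    · exact mem_of_superset (hDopen.mem_nhds (hcomp x hxS hx)) subset_closure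
    · have hxf : τ x = x := by rwa [hSmem, not_not] at hxS
      obtain ⟨v, hv, hτv⟩ := hτ.exists_normal hxf (hφ x) hρ
      have hball : Metric.ball x ρ ∈ 𝓝 x := Metric.ball_mem_nhds x hρ
      have hτb : ∀ y ∈ Metric.ball x ρ, τ y ∈ Metric.ball x ρ := fun y hy => by
        rw [Metric.mem_ball, ← hxf, hτ.isometry.dist_eq]; exact hy
      have hin : ∀ y ∈ Metric.ball x ρ, inner ℝ (φ x (τ y)).2 v = -inner ℝ (φ x y).2 v := by
        intro y hy
        simp only [hτv y hy, Prod.snd_sub, Prod.smul_snd, inner_sub_left, real_inner_smul_left,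
          real_inner_self_eq_norm_sq, hv]
        ring
      have hfix : ∀ y ∈ Metric.ball x ρ, y ∈ S → inner ℝ (φ x y).2 v ≠ 0 := by
        intro y hy hyS h0
        apply hyS
        apply (hφ x).injOn (hτb y hy) hy
        rw [hτv y hy, h0]; simp
      set H := {y ∈ Metric.ball x ρ | 0 < inner ℝ (φ x y).2 v} with hH
      have hHS : H ⊆ S := fun y hy hyf => by
        have := hin y hy.1
        rw [hyf] at this
        have := hy.2
        linarith
      have hHD : H ⊆ D := by
        apply habsD H ((hφ x).isPreconnected_halfBall hρ v) hHS
        obtain ⟨y, hy, hyD⟩ := mem_closure_iff.1 hx _ Metric.isOpen_ball (Metric.mem_ball_self hρ)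
        rcases lt_or_gt_of_ne (hfix y hy (hDS hyD)) with h | h
        · exact ⟨τ y, ⟨hτb y hy, by rw [hin y hy]; linarith⟩, hDτ y hyD⟩
        · exact ⟨y, ⟨hy, h⟩, hyD⟩
      refine mem_of_superset hball fun y hy => ?_
      have hyc := Metric.isOpen_ball.inter_closure ⟨hy, hτ.mem_closure_compl y⟩
      refine closure_mono ?_ hyc
      rintro z ⟨hz, hzS⟩
      rcases lt_or_gt_of_ne (hfix z hz hzS) with h | h
      · rw [← hinv z]
        exact hDτ _ (hHD ⟨hτb z hz, by rw [hin z hz]; linarith⟩)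
      · exact hHD ⟨hz, h⟩
  have huniv : closure D = univ :=
    IsClopen.eq_univ ⟨isClosed_closure, hclopen⟩
      ⟨y₀, subset_closure (Or.inl (mem_connectedComponentIn hy₀))⟩
  have hSD : ∀ y ∈ S, y ∈ D := fun y hy => hcomp y hy (huniv ▸ mem_univ y)
  refine ⟨U, hSopen.connectedComponentIn, ⟨⟨y₀, mem_connectedComponentIn hy₀⟩, hUpre⟩,
    fun y hy => hUS hy, fun y hy hτy => hsep ?_, fun y hy => hSD y hy⟩
  have hUτ : U ⊆ τ ⁻¹' U := habs' U hUpre hUS ⟨y, hy, hτy⟩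
  have : S = U := by
    refine Subset.antisymm (fun z hz => ?_) hUS
    rcases hSD z hz with h | h
    · exact h
    · rw [← hinv z]; exact hUτ h
  rw [this]
  exact ⟨⟨y₀, mem_connectedComponentIn hy₀⟩, hUpre⟩

/-- In a chart centered at a fixed point, a side is a half ball. -/
lemma IsSide.exists_normal {U : Set M} (hU : IsSide τ U) (hτ : IsReflection n τ) {x : M}
    (hx : τ x = x) {φ : M → ℝ × EuclideanSpace ℝ (Fin n)} (h : IsHypChart φ x ρ) (hρ : 0 < ρ) :
    ∃ v : EuclideanSpace ℝ (Fin n), ‖v‖ = 1 ∧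
      (∀ y ∈ Metric.ball x ρ,
        φ (τ y) = φ y - (2 * inner ℝ (φ y).2 v) • ((0, v) : ℝ × EuclideanSpace ℝ (Fin n))) ∧
      (∀ y ∈ Metric.ball x ρ, τ y = y ↔ inner ℝ (φ y).2 v = 0) ∧
      (∀ y ∈ Metric.ball x ρ, y ∈ U ↔ 0 < inner ℝ (φ y).2 v) := by
  obtain ⟨v, hv, hτv⟩ := hτ.exists_normal hx h hρ
  have hτb : ∀ y ∈ Metric.ball x ρ, τ y ∈ Metric.ball x ρ := fun y hy => by
    rw [Metric.mem_ball, ← hx, hτ.isometry.dist_eq]; exact hy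
  have hin : ∀ y ∈ Metric.ball x ρ, inner ℝ (φ (τ y)).2 v = -inner ℝ (φ y).2 v := by
    intro y hy
    simp only [hτv y hy, Prod.snd_sub, Prod.smul_snd, inner_sub_left, real_inner_smul_left,
      real_inner_self_eq_norm_sq, hv]
    ring
  have hfix : ∀ y ∈ Metric.ball x ρ, τ y = y ↔ inner ℝ (φ y).2 v = 0 := by
    intro y hy
    refine ⟨fun hyf => ?_, fun h0 => h.injOn (hτb y hy) hy (by rw [hτv y hy, h0]; simp)⟩
    have := hin y hy
    rw [hyf] at this
    linarith
  have hdich : ∀ w : EuclideanSpace ℝ (Fin n),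
      (∀ y ∈ Metric.ball x ρ, inner ℝ (φ (τ y)).2 w = -inner ℝ (φ y).2 w) →
      (∀ y ∈ Metric.ball x ρ, τ y = y ↔ inner ℝ (φ y).2 w = 0) →
      (∃ y ∈ Metric.ball x ρ, 0 < inner ℝ (φ y).2 w ∧ y ∈ U) →
      (∀ y ∈ Metric.ball x ρ, y ∈ U ↔ 0 < inner ℝ (φ y).2 w) := by
    rintro w hw hfw ⟨z, hz, hzw, hzU⟩
    have hsub := hU.subset_of_isPreconnected hτ.isometry.continuous
      (h.isPreconnected_halfBall hρ w) (fun y hy hyf => hy.2.ne' ((hfw y hy.1).1 hyf))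
      ⟨z, ⟨hz, hzw⟩, hzU⟩
    intro y hy
    refine ⟨fun hyU => ?_, fun hyw => hsub ⟨hy, hyw⟩⟩
    by_contra hneg
    rcases (not_lt.1 hneg).eq_or_lt with h0 | h0
    · exact hU.not_fixed y hyU ((hfw y hy).2 h0)
    · exact hU.not_mem y hyU (hsub ⟨hτb y hy, by rw [hw y hy]; linarith⟩)
  obtain ⟨y, hy, hyU⟩ : ∃ y ∈ Metric.ball x ρ, y ∈ U := by
    obtain ⟨y, hy, hyf⟩ := mem_closure_iff.1 (hτ.mem_closure_compl x) _ Metric.isOpen_ball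
      (Metric.mem_ball_self hρ)
    rcases hU.mem_or_mem y hyf with h | h
    · exact ⟨y, hy, h⟩
    · exact ⟨τ y, hτb y hy, h⟩
  rcases lt_trichotomy (inner ℝ (φ y).2 v) 0 with h0 | h0 | h0
  · refine ⟨-v, by rwa [norm_neg], fun z hz => ?_, fun z hz => ?_, hdich (-v) ?_ ?_ ?_⟩
    · rw [hτv z hz]; ext <;> simp
    · rw [hfix z hz, inner_neg_right, neg_eq_zero]
    · intro z hz; rw [inner_neg_right, inner_neg_right, hin z hz]
    · intro z hz; rw [hfix z hz, inner_neg_right, neg_eq_zero]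
    · exact ⟨y, hy, by rw [inner_neg_right]; linarith, hyU⟩
  · exact absurd ((hfix y hy).2 h0) (hU.not_fixed y hyU)
  · exact ⟨v, hv, hτv, hfix, hdich v hin hfix ⟨y, hy, h0, hyU⟩⟩

/-- The boundary of a side is the whole fixed point set. -/
lemma IsSide.frontier_eq {U : Set M} (hU : IsSide τ U) (hτ : IsReflection n τ) :
    frontier U = Function.fixedPoints τ := by
  have hcont := hτ.isometry.continuous
  ext x
  rw [hU.isOpen.frontier_eq, Set.mem_sdiff]
  constructor
  · rintro ⟨hx, hxU⟩
    by_contra hxf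
    rcases hU.mem_or_mem x hxf with h | h
    · exact hxU h
    · obtain ⟨y, hy, hyU⟩ := mem_closure_iff.1 hx _ (hU.isOpen.preimage hcont) h
      exact hU.not_mem y hyU hy
  · intro hx
    refine ⟨?_, fun hxU => hU.not_fixed x hxU hx⟩
    rw [Metric.mem_closure_iff]
    intro ε hε
    obtain ⟨y, hyf, hy⟩ := Metric.mem_closure_iff.1 (hτ.mem_closure_compl x) ε hε
    rcases hU.mem_or_mem y hyf with h | h
    · exact ⟨y, h, hy⟩
    · refine ⟨τ y, h, ?_⟩
      rw [← show τ x = x from hx, hτ.isometry.dist_eq]; exact hy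

end Sides

/-! ### Fermi coordinates -/

section Fermi

/-- The hyperbolic law of cosines in Fermi coordinates: the hyperbolic cosine of the distance
between the points at heights `t` and `t'` above two points of a hyperplane, `c` being the hyperbolic
cosine of the distance between these two points. -/
noncomputable def fermi (c t t' : ℝ) : ℝ :=
  Real.cosh t * Real.cosh t' * c - Real.sinh t * Real.sinh t'

lemma fermi_comm (c t t' : ℝ) : fermi c t t' = fermi c t' t := by
  unfold fermi; ring

lemma fermi_eq (c t t' : ℝ) :
    fermi c t t' = Real.cosh (t - t') + Real.cosh t * Real.cosh t' * (c - 1) := by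
  unfold fermi; rw [Real.cosh_sub]; ring

@[simp] lemma fermi_one (t t' : ℝ) : fermi 1 t t' = Real.cosh (t - t') := by
  rw [fermi_eq]; ring

/-- Compatibility of Fermi coordinates with the point reflection at height `m`. -/
lemma fermi_reflect (c m t t' : ℝ) :
    2 * Real.cosh (t - m) * fermi c m t' - fermi c (2 * m - t) t' = fermi c t t' := by
  obtain ⟨d, rfl⟩ : ∃ d, t = d + m := ⟨t - m, by ring⟩
  rw [show 2 * m - (d + m) = m - d by ring, add_sub_cancel_right]
  unfold fermi
  rw [Real.cosh_add, Real.sinh_add, Real.cosh_sub, Real.sinh_sub]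
  ring

lemma cosh_le_fermi {c : ℝ} (hc : 1 ≤ c) (t t' : ℝ) : Real.cosh (t - t') ≤ fermi c t t' := by
  rw [fermi_eq]
  have := Real.cosh_pos t
  have := Real.cosh_pos t'
  have : 0 ≤ c - 1 := by linarith
  have : 0 ≤ Real.cosh t * Real.cosh t' * (c - 1) := by positivity
  linarith

lemma le_fermi {c : ℝ} (hc : 1 ≤ c) (t t' : ℝ) : c ≤ fermi c t t' := by
  rw [fermi_eq]
  have := Real.one_le_cosh t
  have := Real.one_le_cosh t'
  have := Real.one_le_cosh (t - t')
  have : 1 ≤ Real.cosh t * Real.cosh t' := by nlinarith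
  nlinarith

lemma fermi_le {c ω T t t' : ℝ} (hc : 1 ≤ c) (ht : |t| ≤ T) (ht' : |t'| ≤ T)
    (hω : |t - t'| ≤ ω) : fermi c t t' ≤ Real.cosh ω + Real.cosh T ^ 2 * (c - 1) := by
  rw [fermi_eq]
  have h1 : Real.cosh (t - t') ≤ Real.cosh ω := by
    rw [Real.cosh_le_cosh, abs_of_nonneg ((abs_nonneg _).trans hω)]; exact hω
  have hT : |T| = T := abs_of_nonneg ((abs_nonneg _).trans ht)
  have h2 : Real.cosh t ≤ Real.cosh T := by rw [Real.cosh_le_cosh, hT]; exact ht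
  have h3 : Real.cosh t' ≤ Real.cosh T := by rw [Real.cosh_le_cosh, hT]; exact ht'
  have := Real.cosh_pos t
  have := Real.cosh_pos t'
  have : 0 ≤ c - 1 := by linarith
  have : Real.cosh t * Real.cosh t' * (c - 1) ≤ Real.cosh T ^ 2 * (c - 1) := by
    rw [sq]; gcongr
  linarith

lemma lorentz_fermi {E : Type*} [NormedAddCommGroup E] [InnerProductSpace ℝ E] {q q' : ℝ × E}
    {v : E} (hv : ‖v‖ = 1) (hq : inner ℝ q.2 v = 0) (hq' : inner ℝ q'.2 v = 0) (t t' : ℝ) :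
    lorentz (Real.cosh t • q + Real.sinh t • ((0, v) : ℝ × E))
      (Real.cosh t' • q' + Real.sinh t' • ((0, v) : ℝ × E)) = fermi (lorentz q q') t t' := by
  have h1 : lorentz q (0, v) = 0 := by simp [lorentz, hq]
  have h2 : lorentz (0, v) q' = 0 := by rw [lorentz_comm]; simp [lorentz, hq']
  have h3 : lorentz ((0, v) : ℝ × E) (0, v) = -1 := by simp [lorentz_self, hv]
  simp only [lorentz_add_left, lorentz_add_right, lorentz_smul_left, lorentz_smul_right, h1, h2,
    h3, fermi]
  ring

variable {n : ℕ} {M : Type*} [MetricSpace M] {τ : M → M}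

/-- `E` gives Fermi coordinates about the totally geodesic hypersurface `S`: `E x t` is the point
at signed distance `t` from `x` on the geodesic that is normal to `S` at `x`. This is expressed by
the law of cosines, which is required only for nearby points and for heights that differ by at most
`ω`; nothing is asserted off `S`. -/
structure IsFermi (S : Set M) (E : M → ℝ → M) (κ ω : ℝ) (I : Set ℝ) : Prop where
  zero : ∀ x ∈ S, E x 0 = x
  cosh_dist : ∀ x ∈ S, ∀ x' ∈ S, dist x x' < κ → ∀ t ∈ I, ∀ t' ∈ I, |t - t'| ≤ ω →
    Real.cosh (dist (E x t) (E x' t')) = fermi (Real.cosh (dist x x')) t t'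

lemma dist_eq_abs_of_cosh_eq {y z : M} {t : ℝ} (h : Real.cosh (dist y z) = Real.cosh t) :
    dist y z = |t| := by
  have := Real.cosh_abs t ▸ h
  exact Real.cosh_injOn dist_nonneg (abs_nonneg t) this

/-- Along a normal geodesic, Fermi coordinates measure arc length. -/
lemma IsFermi.dist_eq {S : Set M} {E : M → ℝ → M} {κ ω : ℝ} {I : Set ℝ} (h : IsFermi S E κ ω I)
    (hκ : 0 < κ) {x : M} (hx : x ∈ S) {t t' : ℝ} (ht : t ∈ I) (ht' : t' ∈ I) (hω : |t - t'| ≤ ω) :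
    dist (E x t) (E x t') = |t - t'| := by
  apply dist_eq_abs_of_cosh_eq
  rw [h.cosh_dist x hx x hx (by simpa using hκ) t ht t' ht' hω]
  simp

variable {ρ : ℝ} {φ : M → M → ℝ × EuclideanSpace ℝ (Fin n)}

/-- Fermi coordinates near the fixed point set, pointing to the side `U` at positive heights. -/
lemma exists_isFermi_small (hτ : IsReflection n τ) {U : Set M} (hU : IsSide τ U) (hρ : 0 < ρ)
    (hφ : ∀ x, IsHypChart (φ x) x ρ) {a : ℝ} (ha₀ : 0 < a) (ha : a ≤ ρ / 4) (ω : ℝ) :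
    ∃ E : M → ℝ → M, IsFermi (Function.fixedPoints τ) E (ρ / 4) ω (Ioo (-a) a) ∧
      (∀ x ∈ Function.fixedPoints τ, ∀ t ∈ Ioo (-a) a, E x (-t) = τ (E x t)) ∧
      (∀ x ∈ Function.fixedPoints τ, ∀ t ∈ Ioo 0 a, E x t ∈ U) := by
  have hnormal := fun x (hx : x ∈ Function.fixedPoints τ) => hU.exists_normal hτ hx (hφ x) hρ
  choose! v hv hτv hfix hUv using hnormal
  have hexists : ∀ x ∈ Function.fixedPoints τ, ∀ t ∈ Ioo (-a) a, ∃ y ∈ Metric.ball x ρ,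
      φ x y = Real.cosh t • ((1, 0) : ℝ × EuclideanSpace ℝ (Fin n)) +
        Real.sinh t • ((0, v x) : ℝ × EuclideanSpace ℝ (Fin n)) := by
    intro x hx t ht
    apply (hφ x).surj
    · apply cosh_smul_add_sinh_smul_mem one_zero_mem_hyperboloid
      · simp [lorentz_self, hv x hx]
      · rw [lorentz_comm, lorentz_one_zero_right]
    · have h1 : |t| < a := abs_lt.2 ht
      have : Real.cosh t < Real.cosh ρ := by
        rw [Real.cosh_lt_cosh, abs_of_pos hρ]; linarith
      simpa using this
  choose! E hEb hEφ using hexists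
  have htime : ∀ x ∈ Function.fixedPoints τ, ∀ t ∈ Ioo (-a) a, dist (E x t) x = |t| := by
    intro x hx t ht
    apply dist_eq_abs_of_cosh_eq
    rw [← (hφ x).time_eq (hEb x hx t ht), hEφ x hx t ht]
    simp
  have hinner : ∀ x ∈ Function.fixedPoints τ, ∀ t ∈ Ioo (-a) a,
      inner ℝ (φ x (E x t)).2 (v x) = Real.sinh t := by
    intro x hx t ht
    rw [hEφ x hx t ht]
    simp [real_inner_smul_left, hv x hx]
  have hneg : ∀ t ∈ Ioo (-a) a, -t ∈ Ioo (-a) a := fun t ht => ⟨by linarith [ht.2], by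
    linarith [ht.1]⟩
  have hrefl : ∀ x ∈ Function.fixedPoints τ, ∀ t ∈ Ioo (-a) a, E x (-t) = τ (E x t) := by
    intro x hx t ht
    have hb : τ (E x t) ∈ Metric.ball x ρ := by
      have h1 := hτ.isometry.dist_eq (E x t) x
      rw [show τ x = x from hx] at h1
      rw [Metric.mem_ball, h1]
      exact hEb x hx t ht
    apply (hφ x).injOn (hEb x hx _ (hneg t ht)) hb
    rw [hτv x hx _ (hEb x hx t ht), hinner x hx t ht, hEφ x hx _ (hneg t ht), hEφ x hx t ht,
      Real.cosh_neg, Real.sinh_neg]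
    module
  have hside : ∀ x ∈ Function.fixedPoints τ, ∀ t ∈ Ioo (-a) a, E x t ∈ U ↔ 0 < t := by
    intro x hx t ht
    rw [hUv x hx _ (hEb x hx t ht), hinner x hx t ht, Real.sinh_pos_iff]
  refine ⟨E, ⟨fun x hx => ?_, ?_⟩, hrefl, fun x hx t ht =>
    (hside x hx t ⟨by linarith [ht.1, ht.2], ht.2⟩).2 ht.1⟩
  · simpa using htime x hx 0 ⟨by linarith, ha₀⟩
  intro x hx x' hx' hxx' t ht t' ht' _
  set u := φ x x' with hu
  have hx'b : x' ∈ Metric.ball x ρ := by rw [Metric.mem_ball, dist_comm]; linarith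
  have huH := (hφ x).mem x' hx'b
  have huv : inner ℝ u.2 (v x) = 0 := (hfix x hx x' hx'b).1 hx'
  have hWb : ∀ s ∈ Ioo (-a) a, E x' s ∈ Metric.ball x ρ := fun s hs => by
    rw [Metric.mem_ball]
    have h1 := dist_triangle (E x' s) x' x
    have h2 := htime x' hx' s hs
    have h3 : |s| < a := abs_lt.2 hs
    rw [dist_comm x' x] at h1
    linarith
  set W := φ x (E x' t') with hW
  have hWH := (hφ x).mem _ (hWb t' ht')
  have h0v : lorentz ((0, v x) : ℝ × EuclideanSpace ℝ (Fin n)) (0, v x) = -1 := by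
    simp [lorentz_self, hv x hx]
  have hWu : lorentz W u = Real.cosh t' := by
    rw [← (hφ x).cosh_dist _ (hWb t' ht') _ hx'b, htime x' hx' t' ht', Real.cosh_abs]
  set s := inner ℝ W.2 (v x) with hs
  have hWv : lorentz W (0, v x) = -s := by simp [lorentz, hs]
  -- the distance from the point to its mirror image determines `s` up to sign
  have hs2 : s ^ 2 = Real.sinh t' ^ 2 := by
    have h1 : lorentz W (φ x (τ (E x' t'))) = 1 + 2 * s ^ 2 := by
      rw [hτv x hx _ (hWb t' ht'), lorentz_sub_right, lorentz_smul_right, ← hW, hWH.2, hWv]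
      ring
    have h2 : lorentz W (φ x (τ (E x' t'))) = 1 + 2 * Real.sinh t' ^ 2 := by
      rw [← hrefl x' hx' t' ht', ← (hφ x).cosh_dist _ (hWb t' ht') _ (hWb _ (hneg t' ht')),
        (hφ x').cosh_dist _ (hEb x' hx' t' ht') _ (hEb x' hx' _ (hneg t' ht')), hEφ x' hx' _ ht',
        hEφ x' hx' _ (hneg t' ht'), lorentz_fermi (hv x' hx') (by simp) (by simp)]
      have h3 : lorentz ((1, 0) : ℝ × EuclideanSpace ℝ (Fin n)) (1, 0) = 1 :=
        one_zero_mem_hyperboloid.2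
      have h4 := Real.cosh_sq t'
      rw [h3, fermi, Real.cosh_neg, Real.sinh_neg]
      linarith
    linarith
  have hss : s = Real.sinh t' := by
    rcases sq_eq_sq_iff_eq_or_eq_neg.1 hs2 with h | h
    · exact h
    · have h1 : 0 < s ↔ 0 < t' := by
        rw [← hside x' hx' t' ht', hUv x hx _ (hWb t' ht')]
      rw [← Real.sinh_pos_iff (x := t')] at h1
      rcases lt_trichotomy 0 s with h2 | h2 | h2
      · have := h1.1 h2; linarith
      · linarith
      · have := h1.2 (by linarith); linarith
  have hWP : W = Real.cosh t' • u + Real.sinh t' • ((0, v x) : ℝ × EuclideanSpace ℝ (Fin n)) := by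
    apply eq_of_lorentz_eq_one hWH
    · apply cosh_smul_add_sinh_smul_mem huH h0v
      simpa [lorentz] using huv
    · rw [lorentz_add_right, lorentz_smul_right, lorentz_smul_right, hWu, hWv, hss]
      have := Real.cosh_sq t'
      linarith
  rw [(hφ x).cosh_dist _ (hEb x hx t ht) _ (hWb t' ht'), ← hW, hWP, hEφ x hx t ht,
    lorentz_fermi (hv x hx) (by simp) huv, lorentz_comm, lorentz_one_zero_right,
    (hφ x).time_eq hx'b, dist_comm]

lemma exists_pos_mul_cosh_sub_one_lt (A : ℝ) {B κ : ℝ} (hB : 0 < B) (hκ : 0 < κ) :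
    ∃ κ' > 0, κ' ≤ κ ∧ A * (Real.cosh κ' - 1) < B := by
  have h : Tendsto (fun t => A * (Real.cosh t - 1)) (𝓝[>] 0) (𝓝 0) := by
    have : Continuous fun t => A * (Real.cosh t - 1) := by fun_prop
    have := this.tendsto 0
    simp only [Real.cosh_zero, sub_self, mul_zero] at this
    exact this.mono_left nhdsWithin_le_nhds
  have h1 := h.eventually_lt_const hB
  obtain ⟨κ', h2, h3, h4⟩ := (h1.and (Ioc_mem_nhdsGT hκ)).exists
  exact ⟨κ', h3, h4, h2⟩

/-- Fermi coordinates extend by a fixed amount: the point at height `t` is the point reflection of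
the point at height `2 m - t` in the point at height `m`. -/
lemma IsFermi.extend {S : Set M} {E : M → ℝ → M} {κ ω T : ℝ}
    (hE : IsFermi S E κ ω (Ioo (-(2 * ω)) T)) (hκ : 0 < κ) (hω : 0 < ω) (hT : 2 * ω ≤ T)
    (hρ : 4 * ω < ρ) (hφ : ∀ x, IsHypChart (φ x) x ρ) :
    ∃ κ' > 0, ∃ E' : M → ℝ → M, IsFermi S E' κ' ω (Ioo (-(2 * ω)) (T + ω / 4)) ∧
      ∀ x, ∀ t ≤ ω, E' x t = E x t := by
  set m := T - ω / 4 with hm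
  set I := Ioo (-(2 * ω)) T with hI
  have hmI : m ∈ I := ⟨by linarith, by linarith⟩
  have hrI : ∀ t ∈ Ioo m (T + ω / 4), 2 * m - t ∈ I := fun t ht =>
    ⟨by linarith [ht.1, ht.2], by linarith [ht.1, ht.2]⟩
  have hwin : ∀ t ∈ Ioo m (T + ω / 4), |2 * m - t - m| ≤ ω := fun t ht => by
    rw [abs_le]; constructor <;> linarith [ht.1, ht.2]
  have hself : ∀ x ∈ S, ∀ t ∈ I, ∀ t' ∈ I, |t - t'| ≤ ω →
      Real.cosh (dist (E x t) (E x t')) = Real.cosh (t - t') := fun x hx t ht t' ht' h => by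
    rw [hE.dist_eq hκ hx ht ht' h, Real.cosh_abs]
  have hpb : ∀ x ∈ S, ∀ t ∈ Ioo m (T + ω / 4), E x (2 * m - t) ∈ Metric.ball (E x m) ρ := by
    intro x hx t ht
    rw [Metric.mem_ball, hE.dist_eq hκ hx (hrI t ht) hmI (hwin t ht)]
    linarith [hwin t ht]
  have hptime : ∀ x ∈ S, ∀ t ∈ Ioo m (T + ω / 4),
      (φ (E x m) (E x (2 * m - t))).1 = Real.cosh (t - m) := by
    intro x hx t ht
    rw [(hφ _).time_eq (hpb x hx t ht), hself x hx _ (hrI t ht) m hmI (hwin t ht),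
      ← Real.cosh_neg]
    ring_nf
  have hexists : ∀ x ∈ S, ∀ t ∈ Ioo m (T + ω / 4), ∃ y ∈ Metric.ball (E x m) ρ,
      φ (E x m) y = (2 * Real.cosh (t - m)) • ((1, 0) : ℝ × EuclideanSpace ℝ (Fin n)) -
        φ (E x m) (E x (2 * m - t)) := by
    intro x hx t ht
    have h1 := hptime x hx t ht
    have h2 := reflect_mem_hyperboloid ((hφ _).mem _ (hpb x hx t ht))
      (one_zero_mem_hyperboloid (E := EuclideanSpace ℝ (Fin n)))
    rw [lorentz_one_zero_right, h1] at h2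
    apply (hφ _).surj _ h2
    simp only [Prod.fst_sub, Prod.smul_fst, smul_eq_mul, mul_one, h1]
    have : Real.cosh (t - m) < Real.cosh ρ := by
      rw [Real.cosh_lt_cosh, abs_of_pos (by linarith : 0 < ρ), abs_lt]
      constructor <;> linarith [ht.1, ht.2]
    linarith
  have hext : ∃ F : M → ℝ → M, ∀ x ∈ S, ∀ t ∈ Ioo m (T + ω / 4), F x t ∈ Metric.ball (E x m) ρ ∧
      φ (E x m) (F x t) = (2 * Real.cosh (t - m)) • ((1, 0) : ℝ × EuclideanSpace ℝ (Fin n)) -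
        φ (E x m) (E x (2 * m - t)) := by
    choose! F h1 h2 using hexists
    exact ⟨F, fun x hx t ht => ⟨h1 x hx t ht, h2 x hx t ht⟩⟩
  obtain ⟨F, hF⟩ := hext
  have hFdist : ∀ x ∈ S, ∀ t ∈ Ioo m (T + ω / 4), Real.cosh (dist (F x t) (E x m)) =
      Real.cosh (t - m) := by
    intro x hx t ht
    obtain ⟨h1, h2⟩ := hF x hx t ht
    rw [← (hφ _).time_eq h1, h2]
    simp only [Prod.fst_sub, Prod.smul_fst, smul_eq_mul, mul_one, hptime x hx t ht]
    ring
  have hFdist' : ∀ x ∈ S, ∀ t ∈ Ioo m (T + ω / 4),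
      Real.cosh (dist (E x (2 * m - t)) (F x t)) = 2 * Real.cosh (t - m) ^ 2 - 1 := by
    intro x hx t ht
    obtain ⟨h1, h2⟩ := hF x hx t ht
    rw [(hφ _).cosh_dist _ (hpb x hx t ht) _ h1, h2, lorentz_sub_right, lorentz_smul_right,
      lorentz_one_zero_right, ((hφ _).mem _ (hpb x hx t ht)).2, hptime x hx t ht]
    ring
  have hTpos : 0 < T := by linarith
  have hgap : 0 < Real.cosh (ρ / 2) - Real.cosh ω := by
    rw [sub_pos, Real.cosh_lt_cosh, abs_of_pos hω, abs_of_pos (by linarith)]; linarith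
  obtain ⟨κ', hκ', hκκ', hsmall⟩ := exists_pos_mul_cosh_sub_one_lt (Real.cosh T ^ 2) hgap hκ
  -- near `x`, everything takes place in the chart centered at `E x m`
  have hnear : ∀ x ∈ S, ∀ x' ∈ S, dist x x' < κ' → ∀ s ∈ I, |s - m| ≤ ω →
      dist (E x' s) (E x m) < ρ / 2 := by
    intro x hx x' hx' hxx' s hs hsm
    have h1 := hE.cosh_dist x' hx' x hx (by rw [dist_comm]; linarith) s hs m hmI hsm
    have h2 : fermi (Real.cosh (dist x' x)) s m ≤
        Real.cosh ω + Real.cosh T ^ 2 * (Real.cosh (dist x' x) - 1) :=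
      fermi_le (Real.one_le_cosh _) (abs_le.2 ⟨by linarith [hs.1], hs.2.le⟩)
        (abs_le.2 ⟨by linarith, by linarith⟩) hsm
    have h3 : Real.cosh (dist x' x) ≤ Real.cosh κ' := by
      rw [Real.cosh_le_cosh, abs_of_nonneg dist_nonneg, abs_of_pos hκ', dist_comm]
      exact hxx'.le
    have h4 : Real.cosh (dist (E x' s) (E x m)) < Real.cosh (ρ / 2) := by
      have : Real.cosh T ^ 2 * (Real.cosh (dist x' x) - 1) ≤
          Real.cosh T ^ 2 * (Real.cosh κ' - 1) := by gcongr
      linarith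
    rwa [Real.cosh_lt_cosh, abs_of_nonneg dist_nonneg, abs_of_pos (by linarith)] at h4
  have hFnear : ∀ x ∈ S, ∀ x' ∈ S, dist x x' < κ' → ∀ t ∈ Ioo m (T + ω / 4),
      F x' t ∈ Metric.ball (E x m) ρ ∧ φ (E x m) (F x' t) =
        (2 * Real.cosh (t - m)) • φ (E x m) (E x' m) - φ (E x m) (E x' (2 * m - t)) := by
    intro x hx x' hx' hxx' t ht
    have hb : ∀ s ∈ I, |s - m| ≤ ω → E x' s ∈ Metric.ball (E x m) ρ := fun s hs hsm => by
      have := hnear x hx x' hx' hxx' s hs hsm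
      rw [Metric.mem_ball]; linarith
    have hbm := hb m hmI (by simpa using hω.le)
    have hbr := hb _ (hrI t ht) (hwin t ht)
    have hd := dist_eq_abs_of_cosh_eq (hFdist x' hx' t ht)
    have hFb : F x' t ∈ Metric.ball (E x m) ρ := by
      have h1 := dist_triangle (F x' t) (E x' m) (E x m)
      have h2 := hnear x hx x' hx' hxx' m hmI (by simpa using hω.le)
      rw [hd, abs_of_pos (by linarith [ht.1])] at h1
      rw [Metric.mem_ball]
      linarith [ht.2]
    refine ⟨hFb, eq_reflect ((hφ _).mem _ hbr) ((hφ _).mem _ hbm) ((hφ _).mem _ hFb) ?_ ?_ ?_⟩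
    · rw [← (hφ _).cosh_dist _ hbr _ hbm, hself x' hx' _ (hrI t ht) m hmI (hwin t ht),
        ← Real.cosh_neg]
      ring_nf
    · rw [← (hφ _).cosh_dist _ hFb _ hbm, hFdist x' hx' t ht]
    · rw [← (hφ _).cosh_dist _ hbr _ hFb, hFdist' x' hx' t ht]
  -- the new law of cosines follows from the old one by linearity
  have hlor : ∀ x ∈ S, ∀ x' ∈ S, dist x x' < κ' → ∀ s ∈ I, ∀ s' ∈ I, |s - m| ≤ ω → |s' - m| ≤ ω →
      |s - s'| ≤ ω → lorentz (φ (E x m) (E x s)) (φ (E x m) (E x' s')) =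
        fermi (Real.cosh (dist x x')) s s' := by
    intro x hx x' hx' hxx' s hs s' hs' hsm hsm' hss'
    have hb := hnear x hx x hx (by simpa using hκ') s hs hsm
    have hb' := hnear x hx x' hx' hxx' s' hs' hsm'
    rw [← (hφ _).cosh_dist _ (by rw [Metric.mem_ball]; linarith) _
      (by rw [Metric.mem_ball]; linarith),
      hE.cosh_dist x hx x' hx' (by linarith) s hs s' hs' hss']
  have hmm : |m - m| ≤ ω := by simpa using hω.le
  have hmix : ∀ x ∈ S, ∀ x' ∈ S, dist x x' < κ' → ∀ t ∈ Ioo m (T + ω / 4), ∀ t' ∈ I, t' ≤ m →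
      |t - t'| ≤ ω → lorentz (φ (E x m) (F x t)) (φ (E x m) (E x' t')) =
        fermi (Real.cosh (dist x x')) t t' := by
    intro x hx x' hx' hxx' t ht t' ht' htm htt'
    rw [abs_le] at htt'
    have e1 : |m - t'| ≤ ω := abs_le.2 ⟨by linarith, by linarith [ht.1]⟩
    have e2 : |t' - m| ≤ ω := by rwa [abs_sub_comm]
    have e3 : |2 * m - t - t'| ≤ ω := abs_le.2 ⟨by linarith [ht.2], by linarith [ht.1]⟩
    rw [(hFnear x hx x hx (by simpa using hκ') t ht).2, lorentz_sub_left, lorentz_smul_left,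
      hlor x hx x' hx' hxx' m hmI t' ht' hmm e2 e1,
      hlor x hx x' hx' hxx' _ (hrI t ht) t' ht' (hwin t ht) e2 e3, fermi_reflect]
  have hmem : ∀ x ∈ S, ∀ x' ∈ S, dist x x' < κ' → ∀ s ∈ I, |s - m| ≤ ω →
      E x' s ∈ Metric.ball (E x m) ρ := fun x hx x' hx' hxx' s hs hsm => by
    have := hnear x hx x' hx' hxx' s hs hsm
    rw [Metric.mem_ball]; linarith
  have hmixdist : ∀ x ∈ S, ∀ x' ∈ S, dist x x' < κ' → ∀ t ∈ Ioo m (T + ω / 4), ∀ t' ∈ I, t' ≤ m →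
      |t - t'| ≤ ω → Real.cosh (dist (F x t) (E x' t')) = fermi (Real.cosh (dist x x')) t t' := by
    intro x hx x' hx' hxx' t ht t' ht' htm htt'
    rw [← hmix x hx x' hx' hxx' t ht t' ht' htm htt']
    rw [abs_le] at htt'
    exact (hφ _).cosh_dist _ (hFnear x hx x hx (by simpa using hκ') t ht).1 _
      (hmem x hx x' hx' hxx' t' ht' (abs_le.2 ⟨by linarith [ht.1], by linarith⟩))
  refine ⟨κ', hκ', fun x t => if t ≤ m then E x t else F x t, ⟨fun x hx => ?_, ?_⟩, fun x t ht => ?_⟩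
  · rw [if_pos (by linarith)]; exact hE.zero x hx
  · intro x hx x' hx' hxx' t ht t' ht' htt'
    rcases le_or_gt t m with h | h <;> rcases le_or_gt t' m with h' | h'
    · simp only [h, h', if_true]
      exact hE.cosh_dist x hx x' hx' (by linarith) t ⟨ht.1, by linarith⟩ t' ⟨ht'.1, by linarith⟩ htt'
    · simp only [h, if_true, not_le.2 h', if_false]
      rw [dist_comm, dist_comm x x', fermi_comm]
      exact hmixdist x' hx' x hx (by rwa [dist_comm]) t' ⟨h', ht'.2⟩ t ⟨ht.1, by linarith⟩ h
        (by rwa [abs_sub_comm])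
    · simp only [h', if_true, not_le.2 h, if_false]
      exact hmixdist x hx x' hx' hxx' t ⟨h, ht.2⟩ t' ⟨ht'.1, by linarith⟩ h' htt'
    · simp only [not_le.2 h, not_le.2 h', if_false]
      have hJ : t ∈ Ioo m (T + ω / 4) := ⟨h, ht.2⟩
      have hJ' : t' ∈ Ioo m (T + ω / 4) := ⟨h', ht'.2⟩
      have hF' := hFnear x hx x' hx' hxx' t' hJ'
      rw [(hφ _).cosh_dist _ (hFnear x hx x hx (by simpa using hκ') t hJ).1 _ hF'.1, hF'.2,
        lorentz_sub_right, lorentz_smul_right,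
        hmix x hx x' hx' hxx' t hJ m hmI le_rfl (abs_le.2 ⟨by linarith, by linarith [ht.2]⟩),
        hmix x hx x' hx' hxx' t hJ _ (hrI t' hJ') (by linarith)
          (abs_le.2 ⟨by linarith, by linarith [ht.2, ht'.2]⟩), fermi_comm _ t m,
        fermi_comm _ t (2 * m - t'), fermi_reflect, fermi_comm]
  · exact if_pos (by linarith)

/-- Fermi coordinates about the fixed point set of a reflection, equivariant under the reflection
and pointing to the side `U` at small positive heights. -/
structure IsFermiFlow (τ : M → M) (U : Set M) (E : M → ℝ → M) (κ ω T : ℝ) : Prop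
    extends IsFermi (Function.fixedPoints τ) E κ ω (Ioo (-T) T) where
  refl : ∀ x ∈ Function.fixedPoints τ, ∀ t ∈ Ioo (-T) T, E x (-t) = τ (E x t)
  side : ∀ x ∈ Function.fixedPoints τ, ∀ t ∈ Ioc 0 ω, E x t ∈ U

/-- Fermi coordinates about the fixed point set exist up to every height: those at small heights are
extended step by step on the side `U`, and then by symmetry. -/
lemma exists_isFermiFlow (hτ : IsReflection n τ) {U : Set M} (hU : IsSide τ U) (hρ : 0 < ρ)
    (hφ : ∀ x, IsHypChart (φ x) x ρ) (T : ℝ) :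
    ∃ E : M → ℝ → M, ∃ κ > 0, ∃ ω > 0, IsFermiFlow τ U E κ ω T := by
  set ω := ρ / 8 with hω
  have hω0 : 0 < ω := by positivity
  obtain ⟨E₀, hE₀, hrefl₀, hside₀⟩ := exists_isFermi_small hτ hU hρ hφ (a := 2 * ω)
    (by positivity) (by rw [hω]; linarith) ω
  have hiter : ∀ k : ℕ, ∃ κ > 0, ∃ E : M → ℝ → M, IsFermi (Function.fixedPoints τ) E κ ω
      (Ioo (-(2 * ω)) (2 * ω + k * (ω / 4))) ∧ ∀ x, ∀ t ≤ ω, E x t = E₀ x t := by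
    intro k
    induction k with
    | zero => exact ⟨ρ / 4, by positivity, E₀, by simpa using hE₀, fun _ _ _ => rfl⟩
    | succ k ih =>
      obtain ⟨κ, hκ, E, hE, hEE⟩ := ih
      have h0 : 0 ≤ (k : ℝ) * (ω / 4) := by positivity
      obtain ⟨κ', hκ', E', hE', hEE'⟩ := hE.extend hκ hω0 (by linarith) (by rw [hω]; linarith) hφ
      refine ⟨κ', hκ', E', ?_, fun x t ht => (hEE' x t ht).trans (hEE x t ht)⟩
      convert hE' using 2
      push_cast; ring
  obtain ⟨k, hk⟩ := exists_nat_gt (T / (ω / 4))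
  obtain ⟨κ, hκ, E, hE, hEE⟩ := hiter k
  have hTk : T < 2 * ω + k * (ω / 4) := by
    rw [div_lt_iff₀ (by positivity)] at hk; linarith
  have hreflE : ∀ x ∈ Function.fixedPoints τ, ∀ t, |t| ≤ ω → E x (-t) = τ (E x t) := by
    intro x hx t ht
    rw [abs_le] at ht
    rw [hEE x t ht.2, hEE x (-t) (by linarith)]
    exact hrefl₀ x hx t ⟨by linarith, by linarith⟩
  set F : M → ℝ → M := fun x t => if 0 ≤ t then E x t else τ (E x (-t)) with hF
  have hFpos : ∀ x t, 0 ≤ t → F x t = E x t := fun x t ht => if_pos ht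
  have hFneg : ∀ x ∈ Function.fixedPoints τ, ∀ t ≤ 0, F x t = τ (E x (-t)) := by
    intro x hx t ht
    rcases ht.eq_or_lt with rfl | h
    · rw [hFpos x 0 le_rfl, neg_zero, hE.zero x hx]; exact hx.symm
    · exact if_neg (not_le.2 h)
  have hFsmall : ∀ x ∈ Function.fixedPoints τ, ∀ t, |t| ≤ ω → F x t = E x t := by
    intro x hx t ht
    rcases le_total 0 t with h | h
    · exact hFpos x t h
    · rw [hFneg x hx t h, hreflE x hx t ht, hτ.involutive]
  refine ⟨F, κ, hκ, ω, hω0, ⟨fun x hx => ?_, ?_⟩, fun x hx t ht => ?_, fun x hx t ht => ?_⟩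
  · rw [hFpos x 0 le_rfl, hE.zero x hx]
  · intro x hx x' hx' hxx' t ht t' ht' htt'
    have hneg : ∀ c, fermi c (-t) (-t') = fermi c t t' := fun c => by
      simp [fermi]
    have hab := abs_le.1 htt'
    have hmix : t ∈ Icc (-ω) ω → t' ∈ Icc (-ω) ω →
        Real.cosh (dist (F x t) (F x' t')) = fermi (Real.cosh (dist x x')) t t' := by
      intro h h'
      rw [hFsmall x hx t (abs_le.2 h), hFsmall x' hx' t' (abs_le.2 h')]
      exact hE.cosh_dist x hx x' hx' hxx' t ⟨by linarith [h.1], by linarith [ht.2]⟩ t'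
        ⟨by linarith [h'.1], by linarith [ht'.2]⟩ htt'
    rcases le_total 0 t with h | h <;> rcases le_total 0 t' with h' | h'
    · rw [hFpos x t h, hFpos x' t' h']
      exact hE.cosh_dist x hx x' hx' hxx' t ⟨by linarith, by linarith [ht.2]⟩ t'
        ⟨by linarith, by linarith [ht'.2]⟩ htt'
    · exact hmix ⟨by linarith, by linarith⟩ ⟨by linarith, by linarith⟩
    · exact hmix ⟨by linarith, by linarith⟩ ⟨by linarith, by linarith⟩
    · rw [hFneg x hx t h, hFneg x' hx' t' h', hτ.isometry.dist_eq, ← hneg]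
      exact hE.cosh_dist x hx x' hx' hxx' _ ⟨by linarith, by linarith [ht.1]⟩ _
        ⟨by linarith, by linarith [ht'.1]⟩ (by rwa [neg_sub_neg, abs_sub_comm])
  · rcases le_total 0 t with h | h
    · rw [hFneg x hx (-t) (by linarith), neg_neg, hFpos x t h]
    · rw [hFpos x (-t) (by linarith), hFneg x hx t h, hτ.involutive]
  · rw [hFpos x t ht.1.le, hEE x t ht.2]
    exact hside₀ x hx t ⟨ht.1, by linarith [ht.2]⟩

end Fermi

/-! ### Closed geodesics made of two arcs -/

section ClosedGeodesics

variable {M : Type*} [MetricSpace M]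

/-- Two geodesic arcs of length `2 t`, both parametrized by `[-t, t]`, that meet without corners at
both ends form a closed geodesic. The closed geodesic runs through the first arc over the intervals
centered at the even multiples of `2 t`, and backwards through the second arc over the intervals
centered at the odd ones. -/
lemma exists_isClosedGeodesic_of_arcs {α β : ℝ → M} {t δ : ℝ} (ht : 0 < t) (hδ : 0 < δ)
    (hα : ∀ u ∈ Icc (-t) t, ∀ u' ∈ Icc (-t) t, |u - u'| < δ → dist (α u) (α u') = |u - u'|)
    (hβ : ∀ u ∈ Icc (-t) t, ∀ u' ∈ Icc (-t) t, |u - u'| < δ → dist (β u) (β u') = |u - u'|)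
    (htop : ∀ u ∈ Ioc (t - δ) t, ∀ u' ∈ Ioc (t - δ) t, dist (α u) (β u') = (t - u) + (t - u'))
    (hbot : ∀ u ∈ Ico (-t) (-t + δ), ∀ u' ∈ Ico (-t) (-t + δ),
      dist (α u) (β u') = (u + t) + (u' + t)) :
    ∃ γ : ℝ → M, IsClosedGeodesic γ (4 * t) := by
  set k : ℝ → ℤ := fun u => ⌊(u + t) / (2 * t)⌋ with hk
  set a : ℤ → ℝ → M := fun k u =>
    if Even k then α (u - 2 * t * k) else β (2 * t * k - u) with ha
  have h2t : 0 < 2 * t := by positivity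
  have hk1 : ∀ u, 2 * t * k u - t ≤ u := fun u => by
    have := Int.floor_le ((u + t) / (2 * t))
    rw [le_div_iff₀ h2t] at this
    simp only [hk]; linarith
  have hk2 : ∀ u, u < 2 * t * k u + t := fun u => by
    have := Int.lt_floor_add_one ((u + t) / (2 * t))
    rw [div_lt_iff₀ h2t] at this
    simp only [hk]; linarith
  have hsame : ∀ (j : ℤ) (u u' : ℝ), u ∈ Icc (2 * t * j - t) (2 * t * j + t) →
      u' ∈ Icc (2 * t * j - t) (2 * t * j + t) → |u - u'| < δ → dist (a j u) (a j u') = |u - u'| := by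
    intro j u u' hu hu' huu'
    simp only [ha]
    split_ifs
    · rw [hα _ ⟨by linarith [hu.1], by linarith [hu.2]⟩ _
        ⟨by linarith [hu'.1], by linarith [hu'.2]⟩ (by rwa [sub_sub_sub_cancel_right]),
        sub_sub_sub_cancel_right]
    · rw [hβ _ ⟨by linarith [hu.2], by linarith [hu.1]⟩ _
        ⟨by linarith [hu'.2], by linarith [hu'.1]⟩
        (by rwa [sub_sub_sub_cancel_left, abs_sub_comm]), sub_sub_sub_cancel_left, abs_sub_comm]
  have hnext : ∀ (j : ℤ) (u u' : ℝ), u ∈ Icc (2 * t * j - t) (2 * t * j + t) →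
      u' ∈ Icc (2 * t * j + t) (2 * t * j + 3 * t) → u' - u < δ →
      dist (a j u) (a (j + 1) u') = u' - u := by
    intro j u u' hu hu' huu'
    simp only [ha]
    by_cases hj : Even j
    · rw [if_pos hj, if_neg (by rwa [Int.even_add_one, not_not]), htop]
      · push_cast; ring
      · exact ⟨by linarith [hu'.1], by linarith [hu.2]⟩
      · push_cast; exact ⟨by linarith [hu.2], by linarith [hu'.1]⟩
    · rw [if_neg hj, if_pos (by rwa [Int.even_add_one]), dist_comm, hbot]
      · push_cast; ring
      · push_cast; exact ⟨by linarith [hu'.1], by linarith [hu.2]⟩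
      · exact ⟨by linarith [hu.2], by linarith [hu'.1]⟩
  refine ⟨fun u => a (k u) u, by positivity, fun u => ?_, fun s => ⟨min δ t / 2, ?_, ?_⟩⟩
  · have h1 : k (u + 4 * t) = k u + 2 := by
      simp only [hk]
      rw [show (u + 4 * t + t) / (2 * t) = (u + t) / (2 * t) + (2 : ℤ) by
        push_cast; field_simp; ring, Int.floor_add_intCast]
    have h2 : Even (k u + 2) ↔ Even (k u) := by simp
    simp only [h1, ha, h2]
    push_cast
    congr 2 <;> ring
  · have := lt_min hδ ht; positivity
  · have key : ∀ u u' : ℝ, u ≤ u' → u' - u < δ → u' - u < t →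
        dist (a (k u) u) (a (k u') u') = u' - u := by
      intro u u' huu' h1 h2
      have hmono : k u ≤ k u' := Int.floor_mono (by gcongr)
      have hlt : k u' < k u + 2 := by
        have h3 := hk1 u'
        have h4 := hk2 u
        have : (k u' : ℝ) < k u + 2 := by
          by_contra hcon
          push Not at hcon
          nlinarith
        exact_mod_cast this
      have hu : u ∈ Icc (2 * t * k u - t) (2 * t * k u + t) := ⟨hk1 u, (hk2 u).le⟩
      have hu' : u' ∈ Icc (2 * t * k u' - t) (2 * t * k u' + t) := ⟨hk1 u', (hk2 u').le⟩
      rcases hmono.eq_or_lt with h | h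
      · rw [← h] at hu' ⊢
        rw [hsame _ u u' hu hu' (by rw [abs_sub_comm, abs_of_nonneg] <;> linarith), abs_sub_comm,
          abs_of_nonneg (by linarith)]
      · have h5 : k u' = k u + 1 := by omega
        rw [h5] at hu' ⊢
        push_cast at hu'
        exact hnext _ u u' hu ⟨by linarith [hu'.1], by linarith [hu'.2]⟩ h1
    intro u hu u' hu'
    have hδ' := min_le_left δ t
    have ht' := min_le_right δ t
    rcases le_total u u' with h | h
    · rw [key u u' h (by linarith [hu.1, hu'.2]) (by linarith [hu.1, hu'.2]), abs_sub_comm,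
        abs_of_nonneg (by linarith)]
    · rw [dist_comm, key u' u h (by linarith [hu'.1, hu.2]) (by linarith [hu'.1, hu.2]),
        abs_of_nonneg (by linarith)]

end ClosedGeodesics

/-! ### Injectivity of Fermi coordinates -/

section Injectivity

variable {n : ℕ} {M : Type*} [MetricSpace M] {τ : M → M} {ρ : ℝ}

lemma IsHypChart.exists_midpoint {φ : M → ℝ × EuclideanSpace ℝ (Fin n)} {x : M}
    (h : IsHypChart φ x ρ) {y z : M} (hy : y ∈ Metric.ball x ρ) (hz : z ∈ Metric.ball x ρ) :
    ∃ w, dist w y = dist y z / 2 ∧ dist w z = dist y z / 2 := by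
  have hρ : 0 < ρ := Metric.pos_of_mem_ball hy
  set p := φ y with hp
  set q := φ z with hq
  have hpH := h.mem y hy
  have hqH := h.mem z hz
  have hc := h.cosh_dist y hy z hz
  set C := Real.cosh (dist y z / 2) with hC
  have hC1 : 1 ≤ C := Real.one_le_cosh _
  have hcC : lorentz p q = 2 * C ^ 2 - 1 := by
    have h1 := Real.cosh_two_mul (dist y z / 2)
    have h2 := Real.cosh_sq (dist y z / 2)
    rw [mul_div_cancel₀ _ (two_ne_zero), hc] at h1
    linarith
  have hsq : √(2 + 2 * lorentz p q) = 2 * C := by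
    rw [hcC, show 2 + 2 * (2 * C ^ 2 - 1) = (2 * C) ^ 2 by ring, Real.sqrt_sq (by positivity)]
  have hm := midpoint_mem_hyperboloid hpH hqH
  rw [hsq] at hm
  obtain ⟨w, hw, hφw⟩ := h.surj _ hm (by
    have h1 := (h.mem_ball_iff hy hρ.le).1 hy
    have h2 := (h.mem_ball_iff hz hρ.le).1 hz
    simp only [Prod.smul_fst, Prod.fst_add, smul_eq_mul]
    rw [inv_mul_lt_iff₀ (by positivity)]
    have := Real.cosh_pos ρ
    nlinarith)
  refine ⟨w, ?_, ?_⟩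
  · have h1 : Real.cosh (dist w y) = C := by
      rw [h.cosh_dist w hw y hy, hφw, lorentz_smul_left, lorentz_add_left, hpH.2, lorentz_comm q p,
        hcC]
      field_simp; ring
    rw [dist_eq_abs_of_cosh_eq h1, abs_of_nonneg (by positivity)]
  · have h1 : Real.cosh (dist w z) = C := by
      rw [h.cosh_dist w hw z hz, hφw, lorentz_smul_left, lorentz_add_left, hqH.2, hcC]
      field_simp; ring
    rw [dist_eq_abs_of_cosh_eq h1, abs_of_nonneg (by positivity)]

variable {φ : M → M → ℝ × EuclideanSpace ℝ (Fin n)} {U : Set M} {E : M → ℝ → M} {κ ω T : ℝ}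

namespace IsFermiFlow

lemma continuousOn (hE : IsFermiFlow τ U E κ ω T) (hκ : 0 < κ) (hω : 0 < ω) :
    ContinuousOn (fun p : M × ℝ => E p.1 p.2) (Function.fixedPoints τ ×ˢ Ioo (-T) T) := by
  rintro ⟨x, t⟩ ⟨hx, ht⟩
  rw [ContinuousWithinAt, tendsto_iff_dist_tendsto_zero]
  have hlim : Tendsto (fun p : M × ℝ => √(2 * (fermi (Real.cosh (dist p.1 x)) p.2 t - 1)))
      (𝓝[Function.fixedPoints τ ×ˢ Ioo (-T) T] (x, t)) (𝓝 0) := by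
    have hc : Continuous fun p : M × ℝ => √(2 * (fermi (Real.cosh (dist p.1 x)) p.2 t - 1)) := by
      unfold fermi; fun_prop
    have := hc.tendsto (x, t)
    simp only [dist_self, Real.cosh_zero, fermi_one, sub_self, mul_zero, Real.sqrt_zero] at this
    exact this.mono_left nhdsWithin_le_nhds
  refine squeeze_zero' (Eventually.of_forall fun _ => dist_nonneg) ?_ hlim
  have h1 : ∀ᶠ p : M × ℝ in 𝓝 (x, t), dist p.1 x < κ := by
    have : Continuous fun p : M × ℝ => dist p.1 x := by fun_prop
    exact this.continuousAt.eventually_lt continuousAt_const (by simpa using hκ)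
  have h2 : ∀ᶠ p : M × ℝ in 𝓝 (x, t), |p.2 - t| < ω := by
    have : Continuous fun p : M × ℝ => |p.2 - t| := by fun_prop
    exact this.continuousAt.eventually_lt continuousAt_const (by simpa using hω)
  filter_upwards [self_mem_nhdsWithin, nhdsWithin_le_nhds h1, nhdsWithin_le_nhds h2]
    with p hp hp1 hp2
  apply Real.le_sqrt_of_sq_le
  rw [← hE.cosh_dist p.1 hp.1 x hx hp1 p.2 hp.2 t ht hp2.le]
  exact sq_le_two_mul_cosh_sub_one _

/-- Fermi coordinates are injective at small scales. -/
lemma eq_of_eq (hE : IsFermiFlow τ U E κ ω T) {x y : M} (hx : x ∈ Function.fixedPoints τ)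
    (hy : y ∈ Function.fixedPoints τ) (hxy : dist x y < κ) {s t : ℝ} (hs : s ∈ Ioo (-T) T)
    (ht : t ∈ Ioo (-T) T) (hst : |s - t| ≤ ω) (h : E x s = E y t) : x = y ∧ s = t := by
  have h1 := hE.cosh_dist x hx y hy hxy s hs t ht hst
  rw [h, dist_self, Real.cosh_zero] at h1
  have h2 := cosh_le_fermi (Real.one_le_cosh (dist x y)) s t
  have h3 := le_fermi (Real.one_le_cosh (dist x y)) s t
  rw [← h1, ← Real.cosh_zero, Real.cosh_le_cosh, abs_zero] at h2 h3
  constructor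
  · have := abs_nonpos_iff.1 h3
    exact dist_eq_zero.1 this
  · exact sub_eq_zero.1 (abs_nonpos_iff.1 h2)

/-- Fermi coordinates are locally onto, quantitatively: in charts they amount to a distance
preserving map between hyperbolic balls of the same dimension. -/
lemma exists_eq_of_dist_lt (hE : IsFermiFlow τ U E κ ω T) (hτ : IsReflection n τ)
    (hU : IsSide τ U) (hφ : ∀ x, IsHypChart (φ x) x ρ) {x₀ : M}
    (hx₀ : x₀ ∈ Function.fixedPoints τ) {t₀ s : ℝ} (hs : 0 < s) (hsκ : 2 * s ≤ κ)
    (hsω : 2 * s ≤ ω) (hsρ : s ≤ ρ) (hl : -T ≤ t₀ - s) (hr : t₀ + s ≤ T) {w : M}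
    (hw : dist w (E x₀ t₀) < s) :
    ∃ x ∈ Function.fixedPoints τ, ∃ t, dist x x₀ < s ∧ |t - t₀| < s ∧ E x t = w := by
  have hρ : 0 < ρ := hs.trans_le hsρ
  obtain ⟨v, hv, -, hfix, -⟩ := hU.exists_normal hτ hx₀ (hφ x₀) hρ
  have hO := one_zero_mem_hyperboloid (E := EuclideanSpace ℝ (Fin n))
  set p₀ : ℝ × EuclideanSpace ℝ (Fin n) :=
    Real.cosh t₀ • (1, 0) + Real.sinh t₀ • (0, v) with hp₀
  have hp₀H : p₀ ∈ hyperboloid (EuclideanSpace ℝ (Fin n)) := by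
    apply cosh_smul_add_sinh_smul_mem hO
    · simp [lorentz_self, hv]
    · rw [lorentz_comm, lorentz_one_zero_right]
  have hcosh_s : ∀ a : ℝ, Real.cosh a < Real.cosh s ↔ |a| < s := fun a => by
    rw [Real.cosh_lt_cosh, abs_of_pos hs]
  have ht₀ : t₀ ∈ Ioo (-T) T := ⟨by linarith, by linarith⟩
  have hIoo : ∀ t, |t - t₀| < s → t ∈ Ioo (-T) T := fun t ht => by
    rw [abs_lt] at ht
    exact ⟨by linarith, by linarith⟩
  have htime : ∀ u : EuclideanSpace ℝ (Fin n),
      lorentz (swapBase p₀ (hyperboloidLift u)) p₀ = (hyperboloidLift u).1 := fun u => by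
    nth_rewrite 2 [← swapBase_base hp₀H]
    rw [lorentz_swapBase hp₀H, lorentz_one_zero_right]
  have hlt : ∀ u ∈ Metric.ball (0 : EuclideanSpace ℝ (Fin n)) (Real.sinh s),
      (hyperboloidLift u).1 < Real.cosh s := fun u hu => by
    rw [mem_ball_zero_iff] at hu
    rw [← sq_lt_sq₀ (hyperboloidLift_mem u).1.le (Real.cosh_pos s).le,
      time_sq_of_mem (hyperboloidLift_mem u), Real.cosh_sq]
    have : ‖u‖ ^ 2 < Real.sinh s ^ 2 := by gcongr
    simp only [hyperboloidLift]
    linarith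
  have hexists : ∀ u ∈ Metric.ball (0 : EuclideanSpace ℝ (Fin n)) (Real.sinh s), ∃ (x : M) (t : ℝ),
      x ∈ Function.fixedPoints τ ∧ dist x x₀ < s ∧ |t - t₀| < s ∧
      swapBase p₀ (hyperboloidLift u) = Real.cosh t • φ x₀ x + Real.sinh t • (0, v) := by
    intro u hu
    obtain ⟨q, hq, t, hqv, hqt⟩ :=
      exists_fermi_decomposition (swapBase_mem hp₀H (hyperboloidLift_mem u)) hv
    have h1 : fermi q.1 t t₀ < Real.cosh s := by
      have := htime u
      rw [hqt, hp₀, lorentz_fermi hv hqv (by simp), lorentz_one_zero_right] at this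
      rw [this]; exact hlt u hu
    have hq1 := one_le_time hq
    have h2 : |t - t₀| < s := (hcosh_s _).1 ((cosh_le_fermi hq1 t t₀).trans_lt h1)
    have h3 : q.1 < Real.cosh s := (le_fermi hq1 t t₀).trans_lt h1
    obtain ⟨x, hx, rfl⟩ := ((hφ x₀).mono hs hsρ).surj q hq h3
    exact ⟨x, t, (hfix x (Metric.ball_subset_ball hsρ hx)).2 hqv, hx, h2, hqt⟩
  have : Nonempty M := ⟨x₀⟩
  choose! X t hX hXd ht hXt using hexists
  have hb : ∀ u ∈ Metric.ball (0 : EuclideanSpace ℝ (Fin n)) (Real.sinh s),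
      X u ∈ Metric.ball x₀ ρ := fun u hu => (hXd u hu).trans_le hsρ
  have hXv : ∀ u ∈ Metric.ball (0 : EuclideanSpace ℝ (Fin n)) (Real.sinh s),
      inner ℝ (φ x₀ (X u)).2 v = 0 := fun u hu => (hfix _ (hb u hu)).1 (hX u hu)
  have hdist₀ : ∀ u ∈ Metric.ball (0 : EuclideanSpace ℝ (Fin n)) (Real.sinh s),
      Real.cosh (dist (E (X u) (t u)) (E x₀ t₀)) = (hyperboloidLift u).1 := by
    intro u hu
    rw [hE.cosh_dist _ (hX u hu) _ hx₀ (by linarith [hXd u hu]) _ (hIoo _ (ht u hu)) _ ht₀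
      (by linarith [ht u hu]), ← (hφ x₀).time_eq (hb u hu), ← lorentz_one_zero_right,
      ← lorentz_fermi hv (hXv u hu) (by simp), ← hXt u hu, ← hp₀, htime]
  have hdist : ∀ u ∈ Metric.ball (0 : EuclideanSpace ℝ (Fin n)) (Real.sinh s),
      ∀ u' ∈ Metric.ball (0 : EuclideanSpace ℝ (Fin n)) (Real.sinh s),
      Real.cosh (dist (E (X u) (t u)) (E (X u') (t u'))) =
        lorentz (hyperboloidLift u) (hyperboloidLift u') := by
    intro u hu u' hu'
    have h1 : dist (X u) (X u') < κ := by
      have := dist_triangle_right (X u) (X u') x₀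
      linarith [hXd u hu, hXd u' hu']
    have h2 : |t u - t u'| ≤ ω := by
      have := abs_sub_le (t u) t₀ (t u')
      rw [abs_sub_comm t₀] at this
      linarith [ht u hu, ht u' hu']
    rw [hE.cosh_dist _ (hX u hu) _ (hX u' hu') h1 _ (hIoo _ (ht u hu)) _ (hIoo _ (ht u' hu')) h2,
      (hφ x₀).cosh_dist _ (hb u hu) _ (hb u' hu'), ← lorentz_fermi hv (hXv u hu) (hXv u' hu'),
      ← hXt u hu, ← hXt u' hu', lorentz_swapBase hp₀H]
  set z := E x₀ t₀ with hz
  have hbz : ∀ u ∈ Metric.ball (0 : EuclideanSpace ℝ (Fin n)) (Real.sinh s),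
      E (X u) (t u) ∈ Metric.ball z ρ := fun u hu => by
    have h1 := hlt u hu
    rw [← hdist₀ u hu, hcosh_s, abs_of_nonneg dist_nonneg] at h1
    exact h1.trans_le hsρ
  obtain ⟨A, hA⟩ := exists_linearIsometry_of_inner (Real.sinh_pos_iff.2 hs)
    (fun u => (φ z (E (X u) (t u))).2) (fun u hu u' hu' => by
      have h1 := hdist u hu u' hu'
      rw [(hφ z).cosh_dist _ (hbz u hu) _ (hbz u' hu')] at h1
      unfold lorentz at h1
      rw [(hφ z).time_eq (hbz u hu), (hφ z).time_eq (hbz u' hu'), hdist₀ u hu, hdist₀ u' hu'] at h1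
      simp only [hyperboloidLift] at h1
      linarith)
  have hwρ : w ∈ Metric.ball z ρ := hw.trans_le hsρ
  obtain ⟨u, hu⟩ := LinearMap.surjective_of_injective (f := A.toLinearMap) A.injective (φ z w).2
  have hu' : A u = (φ z w).2 := hu
  have hub : u ∈ Metric.ball (0 : EuclideanSpace ℝ (Fin n)) (Real.sinh s) := by
    rw [mem_ball_zero_iff, ← A.norm_map, hu', (hφ z).norm_snd_lt_iff hwρ hs.le,
      (hφ z).time_eq hwρ, hcosh_s, abs_of_nonneg dist_nonneg]
    exact hw
  refine ⟨X u, hX u hub, t u, hXd u hub, ht u hub, (hφ z).injOn (hbz u hub) hwρ ?_⟩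
  rw [eq_hyperboloidLift ((hφ z).mem _ (hbz u hub)), eq_hyperboloidLift ((hφ z).mem _ hwρ)]
  congr 1
  rw [← hu', ← hA u hub]

/-- As long as the normal geodesics do not collide, they stay on their side. -/
lemma mem_side (hE : IsFermiFlow τ U E κ ω T) (hτ : IsReflection n τ) (hU : IsSide τ U)
    (hκ : 0 < κ) (hω : 0 < ω) {r : ℝ} (hrT : r ≤ T)
    (hinj : ∀ x ∈ Function.fixedPoints τ, ∀ y ∈ Function.fixedPoints τ, ∀ s ∈ Ico 0 r,
      ∀ t ∈ Ico 0 r, E x s = E y t → x = y ∧ s = t)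
    {x : M} (hx : x ∈ Function.fixedPoints τ) {t : ℝ} (ht : t ∈ Ioo 0 r) : E x t ∈ U := by
  have hr : 0 < r := ht.1.trans ht.2
  have hcont : ContinuousOn (E x) (Ioo 0 r) := by
    have h1 : ContinuousOn (fun s : ℝ => (x, s)) (Ioo 0 r) := by fun_prop
    exact (hE.continuousOn hκ hω).comp h1 fun s hs => ⟨hx, by linarith [hs.1], by linarith [hs.2]⟩
  have hsub := hU.subset_of_isPreconnected hτ.isometry.continuous
    (isPreconnected_Ioo.image (E x) hcont) ?_ ?_
  · exact hsub (mem_image_of_mem _ ht)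
  · rintro _ ⟨s, hs, rfl⟩ hfix
    have := (hinj x hx (E x s) hfix s ⟨hs.1.le, hs.2⟩ 0 ⟨le_rfl, hr⟩ (hE.zero _ hfix).symm).2
    linarith [hs.1]
  · have h1 : min ω (r / 2) ∈ Ioo 0 r :=
      ⟨lt_min hω (by linarith), (min_le_right _ _).trans_lt (by linarith)⟩
    exact ⟨E x (min ω (r / 2)), mem_image_of_mem _ h1, hE.side x hx _ ⟨h1.1, min_le_left _ _⟩⟩

/-- Fermi coordinates are injective up to a quarter of the length of the shortest closed geodesic.
At the first collision two normal geodesics meet head-on: otherwise the midpoints of the short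
geodesics between them would be earlier collisions. Together with their mirror images they form a
closed geodesic. -/
lemma injective_of_le_length [CompactSpace M] (hE : IsFermiFlow τ U E κ ω T)
    (hτ : IsReflection n τ) (hU : IsSide τ U) (hρ : 0 < ρ) (hφ : ∀ x, IsHypChart (φ x) x ρ)
    (hκ : 0 < κ) (hω : 0 < ω) {r : ℝ} (hrT : r < T)
    (hsys : ∀ (γ : ℝ → M) (ℓ : ℝ), IsClosedGeodesic γ ℓ → 4 * r ≤ ℓ) :
    ∀ x ∈ Function.fixedPoints τ, ∀ y ∈ Function.fixedPoints τ, ∀ s ∈ Ico 0 r,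
      ∀ t ∈ Ico 0 r, E x s = E y t → x = y ∧ s = t := by
  by_contra hcon
  push Not at hcon
  -- Two distinct pairs with the same image are a definite distance apart. So the collisions form a
  -- compact set `K`, which contains a first collision.
  obtain ⟨x₁, hx₁, y₁, hy₁, s₁, hs₁, t₁, ht₁, heq₁, hne₁⟩ := hcon
  set S := Function.fixedPoints τ with hS
  have hSc : IsCompact S := (isClosed_fixedPoints hτ.isometry.continuous).isCompact
  have hI : ∀ t ∈ Icc 0 r, t ∈ Ioo (-T) T := fun t ht =>
    ⟨by linarith [ht.1, ht.2], by linarith [ht.2]⟩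
  set C : Set (M × ℝ) := S ×ˢ Icc 0 r with hC
  have hCc : IsCompact C := hSc.prod isCompact_Icc
  have hEC : ContinuousOn (fun p : M × ℝ => E p.1 p.2) C :=
    (hE.continuousOn hκ hω).mono fun p hp => ⟨hp.1, hI _ hp.2⟩
  set K : Set ((M × ℝ) × (M × ℝ)) := ((C ×ˢ C) ∩
    (fun q => (E q.1.1 q.1.2, E q.2.1 q.2.2)) ⁻¹' diagonal M) ∩
    {q | κ ≤ dist q.1.1 q.2.1 ∨ ω ≤ |q.1.2 - q.2.2|} with hK
  have hKc : IsCompact K := by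
    have hcl : IsClosed ((C ×ˢ C) ∩
        (fun q : (M × ℝ) × (M × ℝ) => (E q.1.1 q.1.2, E q.2.1 q.2.2)) ⁻¹' diagonal M) := by
      refine ContinuousOn.preimage_isClosed_of_isClosed ?_ (hCc.prod hCc).isClosed
        isClosed_diagonal
      exact (hEC.comp continuousOn_fst fun q hq => hq.1).prodMk
        (hEC.comp continuousOn_snd fun q hq => hq.2)
    have hcl' : IsClosed {q : (M × ℝ) × (M × ℝ) | κ ≤ dist q.1.1 q.2.1 ∨ ω ≤ |q.1.2 - q.2.2|} :=
      IsClosed.union (s₁ := {q : (M × ℝ) × (M × ℝ) | κ ≤ dist q.1.1 q.2.1})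
        (s₂ := {q | ω ≤ |q.1.2 - q.2.2|}) (isClosed_le continuous_const (by fun_prop))
        (isClosed_le continuous_const (by fun_prop))
    exact ((hCc.prod hCc).of_isClosed_subset hcl inter_subset_left).inter_right hcl'
  have hKmem : ∀ x ∈ S, ∀ y ∈ S, ∀ s ∈ Icc 0 r, ∀ t ∈ Icc 0 r, E x s = E y t →
      ¬ (x = y ∧ s = t) → ((x, s), (y, t)) ∈ K := by
    intro x hx y hy s hs t ht heq hne
    refine ⟨⟨⟨⟨hx, hs⟩, ⟨hy, ht⟩⟩, heq⟩, ?_⟩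
    by_contra h
    simp only [mem_ofPred_eq, not_or, not_le] at h
    exact hne (hE.eq_of_eq hx hy h.1 (hI s hs) (hI t ht) h.2.le heq)
  have hK₁ := hKmem x₁ hx₁ y₁ hy₁ s₁ ⟨hs₁.1, hs₁.2.le⟩ t₁ ⟨ht₁.1, ht₁.2.le⟩ heq₁
    (fun h => hne₁ h.1 h.2)
  obtain ⟨q, hqK, hqmin⟩ := hKc.exists_isMinOn ⟨_, hK₁⟩
    (f := fun q => max q.1.2 q.2.2) (by fun_prop)
  obtain ⟨x, hx, y, hy, s, hs, t, ht, hst, heq, hfar, htr, hmin⟩ : ∃ x ∈ S, ∃ y ∈ S,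
      ∃ s ∈ Icc 0 r, ∃ t ∈ Icc 0 r, s ≤ t ∧ E x s = E y t ∧ (κ ≤ dist x y ∨ ω ≤ |s - t|) ∧ t < r ∧
      ∀ x ∈ S, ∀ y ∈ S, ∀ s ∈ Ico 0 t, ∀ t' ∈ Ico 0 t, E x s = E y t' → x = y ∧ s = t' := by
    obtain ⟨⟨x, s⟩, ⟨y, t⟩⟩ := q
    obtain ⟨⟨⟨⟨hx, hs⟩, ⟨hy, ht⟩⟩, heq⟩, hfar⟩ := hqK
    have hmax : max s t < r := by
      have := isMinOn_iff.1 hqmin _ hK₁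
      exact this.trans_lt (max_lt hs₁.2 ht₁.2)
    have hmin : ∀ x ∈ S, ∀ y ∈ S, ∀ s' ∈ Ico 0 (max s t), ∀ t' ∈ Ico 0 (max s t),
        E x s' = E y t' → x = y ∧ s' = t' := by
      intro x' hx' y' hy' s' hs' t' ht' heq'
      by_contra hne
      have := isMinOn_iff.1 hqmin _ (hKmem x' hx' y' hy' s' ⟨hs'.1, by linarith [hs'.2]⟩ t'
        ⟨ht'.1, by linarith [ht'.2]⟩ heq' hne)
      exact absurd this (not_le.2 (max_lt hs'.2 ht'.2))
    rcases le_total s t with h | h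
    · rw [max_eq_right h] at hmin hmax
      exact ⟨x, hx, y, hy, s, hs, t, ht, h, heq, hfar, hmax, hmin⟩
    · rw [max_eq_left h] at hmin hmax
      refine ⟨y, hy, x, hx, t, ht, s, hs, h, heq.symm, ?_, hmax, hmin⟩
      rwa [dist_comm, abs_sub_comm]
  have ht0 : 0 < t := by
    rcases ht.1.eq_or_lt with h | h
    · exfalso
      have hs0 : s = 0 := le_antisymm (h ▸ hst) hs.1
      rw [hs0, ← h, hE.zero x hx, hE.zero y hy] at heq
      rw [heq, hs0, ← h] at hfar
      simp only [dist_self, sub_self, abs_zero] at hfar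
      rcases hfar with h | h <;> linarith
    · exact h
  have hside : ∀ z ∈ S, ∀ a ∈ Ioo 0 t, E z a ∈ U := fun z hz a ha =>
    hE.mem_side hτ hU hκ hω (by linarith) hmin hz ha
  have htT : t < T := by linarith
  rcases hst.lt_or_eq with hlt | rfl
  · -- a collision with a lower point is preceded by other collisions, as coordinates are open
    obtain ⟨ε, hε, hε1, hε2, hε3, hε4, hε5, hε6⟩ : ∃ ε > 0, 2 * ε ≤ κ ∧ 2 * ε ≤ ω ∧ ε ≤ ρ ∧
        2 * ε ≤ t - s ∧ ε ≤ T - t ∧ ε ≤ t := by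
      refine ⟨min (κ / 2) (min (ω / 2) (min ρ (min ((t - s) / 2) (min (T - t) t)))), ?_, ?_⟩
      · simp only [gt_iff_lt, lt_min_iff]
        refine ⟨?_, ?_, ?_, ?_, ?_, ?_⟩ <;> linarith
      · set a := min (κ / 2) (min (ω / 2) (min ρ (min ((t - s) / 2) (min (T - t) t)))) with ha
        have h := le_refl a
        conv_rhs at h => rw [ha]
        simp only [le_min_iff] at h
        obtain ⟨h1, h2, h3, h4, h5, h6⟩ := h
        refine ⟨?_, ?_, ?_, ?_, ?_, ?_⟩ <;> linarith
    have hd : dist (E y (t - ε / 2)) (E x s) < ε := by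
      rw [heq, hE.dist_eq hκ hy ⟨by linarith, by linarith⟩ ⟨by linarith, by linarith⟩
        (by rw [abs_le]; constructor <;> linarith), abs_lt]
      constructor <;> linarith
    obtain ⟨x', hx', s', -, hs', heq'⟩ := hE.exists_eq_of_dist_lt hτ hU hφ hx hε hε1 hε2 hε3
      (by linarith [hs.1]) (by linarith) hd
    rw [abs_lt] at hs'
    have hyU := hside y hy (t - ε / 2) ⟨by linarith, by linarith⟩
    have hs'0 : 0 ≤ s' := by
      by_contra hneg
      push Not at hneg
      have h1 := hE.side x' hx' (-s') ⟨by linarith, by linarith [hs.1]⟩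
      rw [hE.refl x' hx' s' ⟨by linarith [hs.1], by linarith⟩, heq'] at h1
      exact hU.not_mem _ hyU h1
    have := (hmin x' hx' y hy s' ⟨hs'0, by linarith⟩ (t - ε / 2) ⟨by linarith, by linarith⟩ heq').2
    linarith
  · -- both points have the height of the first collision
    have hxy : κ ≤ dist x y := by
      rcases hfar with h | h
      · exact h
      · simp only [sub_self, abs_zero] at h; linarith
    obtain ⟨ε, hε, hε1, hε2, hε3, hε5, hε6⟩ : ∃ ε > 0, 2 * ε ≤ κ ∧ 2 * ε ≤ ω ∧ ε ≤ ρ ∧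
        ε ≤ T - s ∧ ε ≤ s := by
      refine ⟨min (κ / 2) (min (ω / 2) (min ρ (min (T - s) s))), ?_, ?_⟩
      · simp only [gt_iff_lt, lt_min_iff]
        refine ⟨?_, ?_, ?_, ?_, ?_⟩ <;> linarith
      · set a := min (κ / 2) (min (ω / 2) (min ρ (min (T - s) s))) with ha
        have h := le_refl a
        conv_rhs at h => rw [ha]
        simp only [le_min_iff] at h
        obtain ⟨h1, h2, h3, h5, h6⟩ := h
        refine ⟨?_, ?_, ?_, ?_, ?_⟩ <;> linarith
    have hsT : s ∈ Ioo (-T) T := ⟨by linarith, by linarith⟩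
    have hη : ∀ η ∈ Ico 0 (ε / 2), s - η ∈ Ioo (-T) T := fun η h =>
      ⟨by linarith [h.2], by linarith [h.1]⟩
    have harc : ∀ z ∈ S, ∀ η ∈ Ico 0 (ε / 2), dist (E z (s - η)) (E z s) = η := by
      intro z hz η h
      rw [hE.dist_eq hκ hz (hη η h) hsT (by rw [abs_le]; constructor <;> linarith [h.1, h.2]),
        sub_sub_cancel_left, abs_neg, abs_of_nonneg h.1]
    -- near the collision the two geodesics form a single geodesic: if they made a corner, the midpoint
    -- of a shortcut would lie below the height of the first collision, over two distinct feet
    have hhead : ∀ η ∈ Ico 0 (ε / 2), dist (E x (s - η)) (E y (s - η)) = 2 * η := by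
      intro η h
      have h1 := harc x hx η h
      have h2 := harc y hy η h
      rw [← heq] at h2
      refine le_antisymm ((dist_triangle_right _ _ (E x s)).trans (by linarith)) ?_
      by_contra hshort
      push Not at hshort
      obtain ⟨w, hw1, hw2⟩ := (hφ (E x s)).exists_midpoint (y := E x (s - η)) (z := E y (s - η))
        (by rw [Metric.mem_ball]; linarith [h.2]) (by rw [Metric.mem_ball]; linarith [h.2])
      have hwd : dist w (E x s) < ε := by
        have := dist_triangle w (E x (s - η)) (E x s)
        linarith [h.2]
      have hheight : ∀ z ∈ S, E x s = E z s → dist w (E z (s - η)) < η →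
          ∃ z' ∈ S, dist z' z < ε ∧ ∃ a ∈ Ico 0 s, E z' a = w := by
        intro z hz hxz hwz
        obtain ⟨z', hz', a, hz'z, ha, haw⟩ := hE.exists_eq_of_dist_lt hτ hU hφ hz hε hε1 hε2 hε3
          (by linarith) (by linarith) (hxz ▸ hwd)
        rw [abs_lt] at ha
        have haT : a ∈ Ioo (-T) T := ⟨by linarith, by linarith⟩
        have h3 := hE.cosh_dist z' hz' z hz (by linarith) a haT (s - η) (hη η h)
          (by rw [abs_le]; constructor <;> linarith [h.1, h.2])
        have h4 := cosh_le_fermi (Real.one_le_cosh (dist z' z)) a (s - η)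
        rw [← h3, haw, Real.cosh_le_cosh, abs_of_nonneg (dist_nonneg (x := w))] at h4
        have h5 := abs_lt.1 (h4.trans_lt hwz)
        exact ⟨z', hz', hz'z, a, ⟨by linarith [h.2], by linarith⟩, haw⟩
      obtain ⟨x', hx', hx'x, a, ha, hxa⟩ := hheight x hx rfl (by linarith)
      obtain ⟨y', hy', hy'y, b, hb, hyb⟩ := hheight y hy heq (by linarith)
      have hx'y' := (hmin x' hx' y' hy' a ha b hb (hxa.trans hyb.symm)).1
      have := dist_triangle_left x y x'
      rw [← hx'y'] at hy'y
      linarith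
    have hjoin : ∀ η ∈ Ico 0 (ε / 2), ∀ η' ∈ Ico 0 (ε / 2),
        dist (E x (s - η)) (E y (s - η')) = η + η' := by
      intro η h η' h'
      have h1 := harc x hx η h
      have h2 := harc y hy η' h'
      rw [← heq] at h2
      refine le_antisymm ((dist_triangle_right _ _ (E x s)).trans (by linarith)) ?_
      rcases le_total η η' with hle | hle
      · have h3 := hE.dist_eq hκ hx (hη η' h') (hη η h)
          (by rw [abs_le]; constructor <;> linarith [h.1, h.2, h'.1, h'.2])
        rw [sub_sub_sub_cancel_left, abs_sub_comm, abs_of_nonneg (by linarith)] at h3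
        have h4 := hhead η' h'
        have h5 := dist_triangle (E x (s - η')) (E x (s - η)) (E y (s - η'))
        linarith
      · have h3 := hE.dist_eq hκ hy (hη η' h') (hη η h)
          (by rw [abs_le]; constructor <;> linarith [h.1, h.2, h'.1, h'.2])
        rw [sub_sub_sub_cancel_left, abs_of_nonneg (by linarith)] at h3
        have h4 := hhead η h
        have h5 := dist_triangle (E x (s - η)) (E y (s - η')) (E y (s - η))
        linarith
    have hIcc : ∀ u ∈ Icc (-s) s, u ∈ Ioo (-T) T := fun u hu =>
      ⟨by linarith [hu.1], by linarith [hu.2]⟩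
    obtain ⟨γ, hγ⟩ := exists_isClosedGeodesic_of_arcs (α := E x) (β := E y) (δ := ε / 2) ht0
      (by positivity)
      (fun u hu u' hu' h => hE.dist_eq hκ hx (hIcc u hu) (hIcc u' hu') (by linarith))
      (fun u hu u' hu' h => hE.dist_eq hκ hy (hIcc u hu) (hIcc u' hu') (by linarith))
      (fun u hu u' hu' => by
        rw [← hjoin (s - u) ⟨by linarith [hu.2], by linarith [hu.1]⟩ (s - u')
          ⟨by linarith [hu'.2], by linarith [hu'.1]⟩, sub_sub_cancel, sub_sub_cancel])
      (fun u hu u' hu' => by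
        have h1 : E x (-u) = τ (E x u) := hE.refl x hx u ⟨by linarith [hu.1], by linarith [hu.2]⟩
        have h2 : E y (-u') = τ (E y u') :=
          hE.refl y hy u' ⟨by linarith [hu'.1], by linarith [hu'.2]⟩
        rw [← hτ.isometry.dist_eq, ← h1, ← h2,
          ← hjoin (u + s) ⟨by linarith [hu.1], by linarith [hu.2]⟩ (u' + s)
          ⟨by linarith [hu'.1], by linarith [hu'.2]⟩]
        congr 2 <;> ring)
    linarith [hsys γ _ hγ]

end IsFermiFlow

end Injectivity

/-! ### The area of the fixed point set and the volume of small cells -/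

section Measure

lemma sinh_sub_sinh_le {a b : ℝ} (ha : 0 ≤ a) (hab : a ≤ b) :
    Real.sinh b - Real.sinh a ≤ Real.cosh b * (b - a) := by
  refine Convex.image_sub_le_mul_sub_of_deriv_le (convex_Icc a b) (by fun_prop)
    (by fun_prop) ?_ a ⟨le_rfl, hab⟩ b ⟨hab, le_rfl⟩ hab
  intro x hx
  rw [interior_Icc] at hx
  rw [Real.deriv_sinh, Real.cosh_le_cosh, abs_of_pos (ha.trans_lt hx.1),
    abs_of_nonneg (ha.trans hab)]
  exact hx.2.le

lemma two_mul_cosh_sub_one_le {d : ℝ} (hd : 0 ≤ d) :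
    2 * (Real.cosh d - 1) ≤ d ^ 2 * ((1 + Real.cosh d) / 2) := by
  have h1 := Real.cosh_two_mul (d / 2)
  have h2 := Real.cosh_sq (d / 2)
  rw [mul_div_cancel₀ _ (two_ne_zero)] at h1
  have h3 := sinh_sub_sinh_le le_rfl (by positivity : 0 ≤ d / 2)
  rw [Real.sinh_zero, sub_zero, sub_zero] at h3
  have h4 : 0 ≤ Real.sinh (d / 2) := Real.sinh_nonneg_iff.2 (by positivity)
  have h5 : Real.sinh (d / 2) ^ 2 ≤ (Real.cosh (d / 2) * (d / 2)) ^ 2 := by gcongr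
  nlinarith

lemma LipschitzOnWith.euclideanHausdorffMeasure_image_le {X Y : Type*} [MetricSpace X]
    [MeasurableSpace X] [BorelSpace X] [MetricSpace Y] [MeasurableSpace Y] [BorelSpace Y]
    {K : ℝ≥0} {f : X → Y} {s : Set X} (h : LipschitzOnWith K f s) (d : ℕ) :
    Measure.euclideanHausdorffMeasure d (f '' s) ≤
      (K : ℝ≥0∞) ^ d * Measure.euclideanHausdorffMeasure d s := by
  have h1 := h.hausdorffMeasure_image_le (d := (d : ℝ)) (by positivity)
  rw [ENNReal.rpow_natCast] at h1
  simp only [Measure.euclideanHausdorffMeasure_def, Measure.smul_apply, ENNReal.smul_def,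
    smul_eq_mul]
  rw [mul_left_comm]
  gcongr

/-- Comparison of the Hausdorff measures of two parametrized sets. -/
lemma euclideanHausdorffMeasure_image_le_of_dist_le {ι X Y : Type*} [MetricSpace X]
    [MeasurableSpace X] [BorelSpace X] [MetricSpace Y] [MeasurableSpace Y] [BorelSpace Y]
    {K : ℝ≥0} {f : ι → X} {g : ι → Y} {S : Set ι}
    (h : ∀ i ∈ S, ∀ j ∈ S, dist (g i) (g j) ≤ K * dist (f i) (f j)) (d : ℕ) :
    Measure.euclideanHausdorffMeasure d (g '' S) ≤
      (K : ℝ≥0∞) ^ d * Measure.euclideanHausdorffMeasure d (f '' S) := by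
  rcases S.eq_empty_or_nonempty with rfl | ⟨i₀, hi₀⟩
  · simp
  have : Nonempty ι := ⟨i₀⟩
  have hr : ∀ y ∈ f '' S, Function.invFunOn f S y ∈ S ∧ f (Function.invFunOn f S y) = y :=
    fun y hy => Function.invFunOn_pos hy
  have hlip : LipschitzOnWith K (g ∘ Function.invFunOn f S) (f '' S) := by
    refine LipschitzOnWith.of_dist_le_mul fun y hy z hz => ?_
    have := h _ (hr y hy).1 _ (hr z hz).1
    rwa [(hr y hy).2, (hr z hz).2] at this
  refine le_trans (measure_mono ?_) (hlip.euclideanHausdorffMeasure_image_le d)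
  rintro _ ⟨i, hi, rfl⟩
  refine ⟨f i, mem_image_of_mem f hi, ?_⟩
  have h1 := hr (f i) (mem_image_of_mem f hi)
  have h2 := h _ h1.1 i hi
  rw [h1.2, dist_self, mul_zero] at h2
  exact dist_le_zero.1 h2

open scoped Pointwise in
/-- The volume of a cylinder over a scaled copy of `A`. -/
lemma volume_cylinder {m : ℕ} (A : Set (EuclideanSpace ℝ (Fin m))) (a b : ℝ) {c : ℝ} (hc : 0 ≤ c) :
    volume ((fun p : EuclideanSpace ℝ (Fin m) × ℝ =>
      (WithLp.toLp 2 (Fin.cons p.2 (c • p.1).ofLp : Fin (m + 1) → ℝ))) '' (A ×ˢ Ioo a b)) =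
      ENNReal.ofReal (b - a) * (ENNReal.ofReal c ^ m * volume A) := by
  have h1 : MeasurePreserving ((MeasurableEquiv.toLp 2 (Fin (m + 1) → ℝ)).symm.trans
      (MeasurableEquiv.piFinSuccAbove (fun _ : Fin (m + 1) => ℝ) 0)) :=
    (EuclideanSpace.volume_preserving_symm_measurableEquiv_toLp _).trans
      (volume_preserving_piFinSuccAbove (fun _ : Fin (m + 1) => ℝ) 0)
  have h2 : ((fun p : EuclideanSpace ℝ (Fin m) × ℝ =>
      (WithLp.toLp 2 (Fin.cons p.2 (c • p.1).ofLp : Fin (m + 1) → ℝ))) '' (A ×ˢ Ioo a b)) =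
      ((MeasurableEquiv.toLp 2 (Fin (m + 1) → ℝ)).symm.trans
        (MeasurableEquiv.piFinSuccAbove (fun _ : Fin (m + 1) => ℝ) 0)) ⁻¹'
        (Ioo a b ×ˢ ((MeasurableEquiv.toLp 2 (Fin m → ℝ)) ⁻¹' (c • A))) := by
    ext w
    simp only [mem_image, mem_preimage, mem_prod, Prod.exists, mem_smul_set]
    constructor
    · rintro ⟨u, t, ⟨hu, ht⟩, rfl⟩
      refine ⟨by simpa [MeasurableEquiv.piFinSuccAbove] using ht, u, hu, ?_⟩
      ext j
      simp [MeasurableEquiv.piFinSuccAbove]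
    · rintro ⟨ht, u, hu, huw⟩
      refine ⟨u, w 0, ⟨hu, by simpa [MeasurableEquiv.piFinSuccAbove] using ht⟩, ?_⟩
      ext j
      refine Fin.cases ?_ (fun j => ?_) j
      · simp
      · have := congrArg (fun z : EuclideanSpace ℝ (Fin m) => z j) huw
        simpa [MeasurableEquiv.piFinSuccAbove, Fin.tail] using this
  have h3 : volume ((MeasurableEquiv.toLp 2 (Fin m → ℝ)) ⁻¹' (c • A)) = volume (c • A) :=
    (EuclideanSpace.volume_preserving_symm_measurableEquiv_toLp (Fin m)).symm.measure_preimage_equiv _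
  rw [h2, h1.measure_preimage_equiv]
  erw [Measure.prod_prod]
  rw [Real.volume_Ioo]
  congr 1
  refine h3.trans ?_
  rw [Measure.addHaar_smul, finrank_euclideanSpace_fin, abs_of_nonneg (by positivity),
    ENNReal.ofReal_pow hc]

variable {m : ℕ} {M : Type*} [MetricSpace M] {τ : M → M} {ρ : ℝ} {U : Set M}
  {φ : M → M → ℝ × EuclideanSpace ℝ (Fin (m + 1))}

/-- Euclidean coordinates on the fixed point set of a reflection near one of its points, which
distort distances little near the point. -/
lemma exists_euclidean_coordinates (hτ : IsReflection (m + 1) τ) (hU : IsSide τ U)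
    (hρ : 0 < ρ) {x : M} (hx : x ∈ Function.fixedPoints τ)
    {φ : M → ℝ × EuclideanSpace ℝ (Fin (m + 1))} (hφ : IsHypChart φ x ρ) :
    ∃ β : M → EuclideanSpace ℝ (Fin m), ∀ y ∈ Function.fixedPoints τ ∩ Metric.ball x ρ,
      ∀ z ∈ Function.fixedPoints τ ∩ Metric.ball x ρ,
        2 * (Real.cosh (dist y z) - 1) ≤ ‖β y - β z‖ ^ 2 ∧
        ∀ s, dist y x ≤ s → dist z x ≤ s →
          ‖β y - β z‖ ^ 2 ≤ Real.cosh s ^ 2 * (2 * (Real.cosh (dist y z) - 1)) := by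
  obtain ⟨v, hv, -, hfix, -⟩ := hU.exists_normal hτ hx hφ hρ
  -- an orthonormal basis whose first vector is the normal vector
  have hb : Orthonormal ℝ (({0} : Set (Fin (m + 1))).domRestrict fun _ => v) := by
    rw [orthonormal_subsingleton_iff]
    intro i
    simpa using hv
  obtain ⟨b, hb⟩ := hb.exists_orthonormalBasis_extension_of_card_eq (by simp)
  have hb0 : b 0 = v := hb 0 rfl
  set β : M → EuclideanSpace ℝ (Fin m) := fun y =>
    WithLp.toLp 2 (fun j => b.repr (φ y).2 j.succ) with hβ
  have hnorm : ∀ y ∈ Function.fixedPoints τ ∩ Metric.ball x ρ,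
      ∀ z ∈ Function.fixedPoints τ ∩ Metric.ball x ρ,
      ‖β y - β z‖ ^ 2 = ‖(φ y).2 - (φ z).2‖ ^ 2 := by
    intro y hy z hz
    have h0 : ∀ w ∈ Function.fixedPoints τ ∩ Metric.ball x ρ, b.repr (φ w).2 0 = 0 := by
      intro w hw
      rw [b.repr_apply_apply, hb0, real_inner_comm]
      exact (hfix w hw.2).1 hw.1
    rw [← b.repr.norm_map ((φ y).2 - (φ z).2), EuclideanSpace.real_norm_sq_eq,
      EuclideanSpace.real_norm_sq_eq, Fin.sum_univ_succ]
    simp [hβ, h0 y hy, h0 z hz]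
  refine ⟨β, fun y hy z hz => ⟨?_, fun s hys hzs => ?_⟩⟩
  · rw [hnorm y hy z hz]
    exact hφ.dist_sq_le hy.2 hz.2
  · rw [hnorm y hy z hz, hφ.cosh_dist y hy.2 z hz.2]
    have hs : ∀ w ∈ Metric.ball x ρ, dist w x ≤ s → (φ w).1 ≤ Real.cosh s := by
      intro w hw hws
      rw [hφ.time_eq hw, Real.cosh_le_cosh, abs_of_nonneg dist_nonneg]
      exact hws.trans (le_abs_self s)
    exact norm_sub_sq_le (hφ.mem y hy.2) (hφ.mem z hz.2) (hs y hy.2 hys) (hs z hz.2 hzs)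

variable [MeasurableSpace M] [BorelSpace M]

/-- The fixed point set is covered by countably many domains of Euclidean coordinates, whose inverses
are contractions. -/
lemma isRectifiable_fixedPoints [CompactSpace M] (hτ : IsReflection (m + 1) τ)
    (hU : IsSide τ U) (hρ : 0 < ρ) (hφ : ∀ x, IsHypChart (φ x) x ρ) :
    IsRectifiable m (Function.fixedPoints τ) := by
  have : Nonempty (Function.fixedPoints τ) := hτ.nonempty.to_subtype
  have : Nonempty M := ⟨hτ.nonempty.some⟩
  set x : ℕ → Function.fixedPoints τ := TopologicalSpace.denseSeq _ with hx
  have hβ := fun k => exists_euclidean_coordinates hτ hU hρ (x k).2 (hφ (x k))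
  choose β hβ using hβ
  set B : ℕ → Set M := fun k => Function.fixedPoints τ ∩ Metric.ball (x k : M) ρ with hB
  have hdist : ∀ k, ∀ y ∈ B k, ∀ z ∈ B k, dist y z ≤ ‖β k y - β k z‖ := fun k y hy z hz =>
    le_of_sq_le_sq ((sq_le_two_mul_cosh_sub_one _).trans (hβ k y hy z hz).1) (norm_nonneg _)
  have hinv : ∀ k, ∀ y ∈ B k, Function.invFunOn (β k) (B k) (β k y) = y := by
    intro k y hy
    have h1 : Function.invFunOn (β k) (B k) (β k y) ∈ B k ∧
        β k (Function.invFunOn (β k) (B k) (β k y)) = β k y :=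
      Function.invFunOn_pos ⟨y, hy, rfl⟩
    have h2 := hdist k _ h1.1 y hy
    rw [h1.2, sub_self, norm_zero] at h2
    exact dist_le_zero.1 h2
  refine ⟨fun k => β k '' B k, fun k => Function.invFunOn (β k) (B k), fun k => ⟨1, ?_⟩, ?_⟩
  · refine LipschitzOnWith.of_dist_le_mul ?_
    rintro _ ⟨y, hy, rfl⟩ _ ⟨z, hz, rfl⟩
    beta_reduce
    rw [hinv k y hy, hinv k z hz, NNReal.coe_one, one_mul, dist_eq_norm]
    exact hdist k y hy z hz
  · rw [sdiff_eq_empty.2, measure_empty]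
    intro y hy
    obtain ⟨k, hk⟩ := (TopologicalSpace.denseRange_denseSeq (Function.fixedPoints τ)).exists_dist_lt
      ⟨y, hy⟩ hρ
    have hyk : y ∈ B k := ⟨hy, hk⟩
    exact mem_iUnion.2 ⟨k, β k y, mem_image_of_mem _ hyk, hinv k y hyk⟩

/-- A bound for the factor by which distances can shrink when a Euclidean cylinder of size `η` is
mapped to the manifold by Fermi coordinates at heights at most `r`. It tends to `1` with `η → 0`. -/
noncomputable def cellDistortion (r η : ℝ) : ℝ :=
  Real.cosh η * √((1 + (Real.cosh η + Real.cosh r ^ 2 * (Real.cosh (2 * η) - 1))) / 2)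

variable {E : M → ℝ → M} {κ ω T : ℝ}

/-- A lower bound for the volume of the part of the collar over a small piece `S` of the fixed point
set, between the heights `a` and `b`: it is compared with the Euclidean cylinder of height `b - a`
over a copy of `S` scaled by `cosh a`. -/
lemma IsFermiFlow.area_le_volume_cell (hE : IsFermiFlow τ U E κ ω T)
    (hτ : IsReflection (m + 1) τ) (hU : IsSide τ U) (hρ : 0 < ρ)
    (hφ : ∀ x, IsHypChart (φ x) x ρ) {r η : ℝ} (hrT : r < T) (hηκ : 2 * η < κ) (hηω : η ≤ ω)
    (hηρ : η ≤ ρ) {x : M} (hx : x ∈ Function.fixedPoints τ) {S : Set M}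
    (hS : S ⊆ Function.fixedPoints τ ∩ Metric.ball x η) {a b : ℝ} (ha : 0 ≤ a) (hab : a ≤ b)
    (hba : b - a ≤ η) (hbr : b ≤ r) :
    ENNReal.ofReal (b - a) * (ENNReal.ofReal (Real.cosh a) ^ m *
      Measure.euclideanHausdorffMeasure m S) ≤
      ENNReal.ofReal (cellDistortion r η) ^ (m + 1) *
        Measure.euclideanHausdorffMeasure (m + 1)
          ((fun p : M × ℝ => E p.1 p.2) '' (S ×ˢ Ioo a b)) := by
  obtain ⟨β, hβ⟩ := exists_euclidean_coordinates hτ hU hρ hx (hφ x)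
  have hSρ : S ⊆ Function.fixedPoints τ ∩ Metric.ball x ρ :=
    hS.trans (inter_subset_inter_right _ (Metric.ball_subset_ball hηρ))
  have hc0 := Real.cosh_pos a
  have h1 : Measure.euclideanHausdorffMeasure m S ≤ volume (β '' S) := by
    have := euclideanHausdorffMeasure_image_le_of_dist_le (K := 1) (f := β) (g := id) (S := S)
      (fun y hy z hz => by
        rw [NNReal.coe_one, one_mul, dist_eq_norm]
        exact le_of_sq_le_sq ((sq_le_two_mul_cosh_sub_one _).trans
          (hβ y (hSρ hy) z (hSρ hz)).1) (norm_nonneg _)) m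
    rwa [image_id, ENNReal.coe_one, one_pow, one_mul,
      EuclideanSpace.euclideanHausdorffMeasure_eq_volume] at this
  -- the cylinder over the scaled copy of `S`
  set g : M × ℝ → EuclideanSpace ℝ (Fin (m + 1)) := fun p =>
    WithLp.toLp 2 (Fin.cons p.2 (Real.cosh a • β p.1).ofLp : Fin (m + 1) → ℝ) with hg
  have h2 : volume (g '' (S ×ˢ Ioo a b)) =
      ENNReal.ofReal (b - a) * (ENNReal.ofReal (Real.cosh a) ^ m * volume (β '' S)) := by
    rw [← volume_cylinder (β '' S) a b hc0.le]
    congr 1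
    ext w
    constructor
    · rintro ⟨⟨y, t⟩, ⟨hy, ht⟩, rfl⟩
      exact ⟨(β y, t), ⟨mem_image_of_mem β hy, ht⟩, rfl⟩
    · rintro ⟨⟨-, t⟩, ⟨⟨y, hy, rfl⟩, ht⟩, rfl⟩
      exact ⟨(y, t), ⟨hy, ht⟩, rfl⟩
  have hgdist : ∀ p q : M × ℝ, dist (g p) (g q) ^ 2 =
      (p.2 - q.2) ^ 2 + Real.cosh a ^ 2 * ‖β p.1 - β q.1‖ ^ 2 := by
    intro p q
    rw [dist_eq_norm, EuclideanSpace.real_norm_sq_eq, Fin.sum_univ_succ,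
      EuclideanSpace.real_norm_sq_eq, Finset.mul_sum]
    simp only [hg, PiLp.sub_apply, Fin.cons_zero, Fin.cons_succ, PiLp.smul_apply, smul_eq_mul]
    congr 1
    refine Finset.sum_congr rfl fun j _ => by ring
  have hlip : ∀ p ∈ S ×ˢ Ioo a b, ∀ q ∈ S ×ˢ Ioo a b,
      dist (g p) (g q) ≤ (cellDistortion r η).toNNReal * dist (E p.1 p.2) (E q.1 q.2) := by
    rintro ⟨y, t⟩ ⟨hy, ht⟩ ⟨z, t'⟩ ⟨hz, ht'⟩
    simp only at hy hz ht ht' ⊢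
    set D := dist (E y t) (E z t') with hD
    set C := Real.cosh (dist y z) with hC
    have hC1 : 1 ≤ C := Real.one_le_cosh _
    have hyx := Metric.mem_ball.1 (hS hy).2
    have hzx := Metric.mem_ball.1 (hS hz).2
    have hyz : dist y z < 2 * η := by
      have := dist_triangle_right y z x; linarith
    have hη : 0 < η := by linarith [dist_nonneg (x := y) (y := x)]
    have htt' : |t - t'| ≤ η := by
      rw [abs_le]; constructor <;> linarith [ht.1, ht.2, ht'.1, ht'.2]
    have hcosh := hE.cosh_dist y (hS hy).1 z (hS hz).1 (by linarith) t
      ⟨by linarith [ht.1, ht.2], by linarith [ht.2]⟩ t'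
      ⟨by linarith [ht'.1, ht'.2], by linarith [ht'.2]⟩ (by linarith)
    have hmono : ∀ s, a < s → Real.cosh a ≤ Real.cosh s := fun s hs => by
      rw [Real.cosh_le_cosh, abs_of_nonneg ha, abs_of_nonneg (ha.trans hs.le)]; exact hs.le
    have hprod : Real.cosh a ^ 2 * (C - 1) ≤ Real.cosh t * Real.cosh t' * (C - 1) := by
      have h3 := hmono t ht.1
      have h4 := hmono t' ht'.1
      have h5 : 0 ≤ C - 1 := by linarith
      rw [sq]; gcongr
    have hup : Real.cosh D ≤ Real.cosh η + Real.cosh r ^ 2 * (Real.cosh (2 * η) - 1) := by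
      rw [hcosh]
      refine (fermi_le (ω := η) (T := r) hC1 (abs_le.2 ⟨by linarith [ht.1, ht.2], by linarith [ht.2]⟩)
        (abs_le.2 ⟨by linarith [ht'.1, ht'.2], by linarith [ht'.2]⟩) htt').trans ?_
      have : C ≤ Real.cosh (2 * η) := by
        rw [Real.cosh_le_cosh, abs_of_nonneg dist_nonneg, abs_of_pos (by linarith)]; exact hyz.le
      gcongr
    have hX : 0 ≤ (1 + (Real.cosh η + Real.cosh r ^ 2 * (Real.cosh (2 * η) - 1))) / 2 := by
      have := Real.cosh_pos D; linarith
    have hL : 0 ≤ cellDistortion r η := mul_nonneg (Real.cosh_pos η).le (Real.sqrt_nonneg _)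
    rw [Real.coe_toNNReal _ hL]
    apply le_of_sq_le_sq _ (mul_nonneg hL dist_nonneg)
    have hηc := Real.one_le_cosh η
    have e1 : (t - t') ^ 2 ≤ Real.cosh η ^ 2 * (2 * (Real.cosh (t - t') - 1)) := by
      have h3 := sq_le_two_mul_cosh_sub_one (t - t')
      have h4 := Real.one_le_cosh (t - t')
      exact h3.trans (le_mul_of_one_le_left (by linarith) (one_le_pow₀ hηc))
    have e2 := (hβ y (hSρ hy) z (hSρ hz)).2 η hyx.le hzx.le
    have e3 : Real.cosh a ^ 2 * ‖β y - β z‖ ^ 2 ≤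
        Real.cosh η ^ 2 * (2 * (Real.cosh t * Real.cosh t' * (C - 1))) := by
      calc _ ≤ Real.cosh a ^ 2 * (Real.cosh η ^ 2 * (2 * (C - 1))) := by gcongr
        _ = Real.cosh η ^ 2 * (2 * (Real.cosh a ^ 2 * (C - 1))) := by ring
        _ ≤ _ := by gcongr
    have e4 := two_mul_cosh_sub_one_le (dist_nonneg : 0 ≤ D)
    rw [hgdist, mul_pow, cellDistortion, mul_pow, Real.sq_sqrt hX]
    calc (t - t') ^ 2 + Real.cosh a ^ 2 * ‖β y - β z‖ ^ 2
        ≤ Real.cosh η ^ 2 * (2 * (Real.cosh D - 1)) := by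
          rw [hcosh, fermi_eq]; linarith
      _ ≤ Real.cosh η ^ 2 * (D ^ 2 * ((1 + Real.cosh D) / 2)) := by gcongr
      _ ≤ Real.cosh η ^ 2 * (D ^ 2 *
          ((1 + (Real.cosh η + Real.cosh r ^ 2 * (Real.cosh (2 * η) - 1))) / 2)) := by gcongr
      _ = _ := by ring
  have h3 := euclideanHausdorffMeasure_image_le_of_dist_le
    (f := fun p : M × ℝ => E p.1 p.2) hlip (m + 1)
  rw [EuclideanSpace.euclideanHausdorffMeasure_eq_volume, h2] at h3
  refine le_trans ?_ h3
  gcongr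

end Measure

/-! ### The volume of the collar -/

section Collar

lemma exp_neg_mul_sinh_sub_le {a b η : ℝ} (ha : 0 ≤ a) (hab : a ≤ b) (hba : b - a ≤ η) :
    Real.exp (-η) * (Real.sinh b - Real.sinh a) ≤ (b - a) * Real.cosh a := by
  have h1 := sinh_sub_sinh_le ha hab
  have h2 : Real.cosh b ≤ Real.exp η * Real.cosh a := by
    have h3 : Real.exp b ≤ Real.exp η * Real.exp a := by
      rw [← Real.exp_add, Real.exp_le_exp]; linarith
    have h4 : Real.exp (-b) ≤ Real.exp η * Real.exp (-a) := by
      rw [← Real.exp_add, Real.exp_le_exp]; linarith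
    rw [Real.cosh_eq, Real.cosh_eq]
    linarith
  calc Real.exp (-η) * (Real.sinh b - Real.sinh a)
      ≤ Real.exp (-η) * ((Real.exp η * Real.cosh a) * (b - a)) := by
        gcongr
        exact h1.trans (mul_le_mul_of_nonneg_right h2 (by linarith))
    _ = (Real.exp (-η) * Real.exp η) * ((b - a) * Real.cosh a) := by ring
    _ = (b - a) * Real.cosh a := by rw [← Real.exp_add]; simp

variable {m : ℕ} {M : Type*} [MetricSpace M] [MeasurableSpace M] [BorelSpace M] [CompactSpace M]
  {τ : M → M} {ρ : ℝ} {U : Set M} {φ : M → M → ℝ × EuclideanSpace ℝ (Fin (m + 1))}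
  {E : M → ℝ → M} {κ ω T r : ℝ}

namespace IsFermiFlow

lemma measurableSet_image (hE : IsFermiFlow τ U E κ ω T) (hκ : 0 < κ) (hω : 0 < ω) (hrT : r < T)
    (hinj : ∀ x ∈ Function.fixedPoints τ, ∀ y ∈ Function.fixedPoints τ, ∀ s ∈ Ico 0 r,
      ∀ t ∈ Ico 0 r, E x s = E y t → x = y ∧ s = t)
    {S : Set M} (hS : MeasurableSet S) (hSτ : S ⊆ Function.fixedPoints τ) {a b : ℝ} (ha : 0 ≤ a)
    (hbr : b ≤ r) : MeasurableSet ((fun p : M × ℝ => E p.1 p.2) '' (S ×ˢ Ioo a b)) := by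
  refine (hS.prod measurableSet_Ioo).image_of_continuousOn_injOn
    ((hE.continuousOn hκ hω).mono ?_) ?_
  · exact prod_mono hSτ fun t ht => ⟨by linarith [ht.1, ht.2], by linarith [ht.2]⟩
  · rintro ⟨x, s⟩ ⟨hx, hs⟩ ⟨y, t⟩ ⟨hy, ht⟩ h
    have := hinj x (hSτ hx) y (hSτ hy) s ⟨ha.trans hs.1.le, hs.2.trans_le hbr⟩ t
      ⟨ha.trans ht.1.le, ht.2.trans_le hbr⟩ h
    exact Prod.ext this.1 this.2

/-- The volume of a thin slab of the collar: the fixed point set is cut into small pieces. -/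
lemma area_le_volume_slab (hE : IsFermiFlow τ U E κ ω T)
    (hτ : IsReflection (m + 1) τ) (hU : IsSide τ U) (hρ : 0 < ρ)
    (hφ : ∀ x, IsHypChart (φ x) x ρ) (hκ : 0 < κ) (hω : 0 < ω) (hrT : r < T)
    (hinj : ∀ x ∈ Function.fixedPoints τ, ∀ y ∈ Function.fixedPoints τ, ∀ s ∈ Ico 0 r,
      ∀ t ∈ Ico 0 r, E x s = E y t → x = y ∧ s = t)
    {η : ℝ} (hη : 0 < η) (hηκ : 2 * η < κ) (hηω : η ≤ ω) (hηρ : η ≤ ρ)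
    {a b : ℝ} (ha : 0 ≤ a) (hab : a ≤ b) (hba : b - a ≤ η) (hbr : b ≤ r) :
    ENNReal.ofReal (b - a) * (ENNReal.ofReal (Real.cosh a) ^ m *
      Measure.euclideanHausdorffMeasure m (Function.fixedPoints τ)) ≤
      ENNReal.ofReal (cellDistortion r η) ^ (m + 1) *
        Measure.euclideanHausdorffMeasure (m + 1)
          ((fun p : M × ℝ => E p.1 p.2) '' (Function.fixedPoints τ ×ˢ Ioo a b)) := by
  have : Nonempty (Function.fixedPoints τ) := hτ.nonempty.to_subtype
  set x : ℕ → Function.fixedPoints τ := TopologicalSpace.denseSeq _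
  set B : ℕ → Set M := fun i => Function.fixedPoints τ ∩ Metric.ball (x i : M) η
  have hBm : ∀ i, MeasurableSet (B i) := fun i =>
    (isClosed_fixedPoints hτ.isometry.continuous).measurableSet.inter measurableSet_ball
  have hSm : ∀ i, MeasurableSet (disjointed B i) := fun i => MeasurableSet.disjointed hBm i
  have hSB : ∀ i, disjointed B i ⊆ B i := disjointed_subset B
  have hSτ : ∀ i, disjointed B i ⊆ Function.fixedPoints τ := fun i =>
    (hSB i).trans inter_subset_left
  have hcover : Function.fixedPoints τ = ⋃ i, disjointed B i := by
    rw [iUnion_disjointed]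
    refine Subset.antisymm (fun y hy => ?_) (iUnion_subset fun i => inter_subset_left)
    obtain ⟨k, hk⟩ := (TopologicalSpace.denseRange_denseSeq (Function.fixedPoints τ)).exists_dist_lt
      ⟨y, hy⟩ hη
    exact mem_iUnion.2 ⟨k, hy, hk⟩
  have hdisj : Pairwise (Function.onFun Disjoint fun i =>
      (fun p : M × ℝ => E p.1 p.2) '' (disjointed B i ×ˢ Ioo a b)) := by
    intro i j hij
    refine disjoint_left.2 ?_
    rintro _ ⟨⟨y, s⟩, ⟨hy, hs⟩, rfl⟩ ⟨⟨z, t⟩, ⟨hz, ht⟩, h⟩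
    have := hinj z (hSτ j hz) y (hSτ i hy) t ⟨ha.trans ht.1.le, ht.2.trans_le hbr⟩ s
      ⟨ha.trans hs.1.le, hs.2.trans_le hbr⟩ h
    exact disjoint_left.1 (disjoint_disjointed B hij) hy (this.1 ▸ hz)
  have himage : (fun p : M × ℝ => E p.1 p.2) '' (Function.fixedPoints τ ×ˢ Ioo a b) =
      ⋃ i, (fun p : M × ℝ => E p.1 p.2) '' (disjointed B i ×ˢ Ioo a b) := by
    rw [← image_iUnion, ← iUnion_prod_const, ← hcover]
  have harea : Measure.euclideanHausdorffMeasure m (Function.fixedPoints τ) =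
      ∑' i, Measure.euclideanHausdorffMeasure m (disjointed B i) := by
    conv_lhs => rw [hcover]
    exact measure_iUnion (disjoint_disjointed B) hSm
  rw [himage, measure_iUnion hdisj fun i =>
    hE.measurableSet_image hκ hω hrT hinj (hSm i) (hSτ i) ha hbr, harea]
  simp only [← ENNReal.tsum_mul_left]
  exact ENNReal.tsum_le_tsum fun i => hE.area_le_volume_cell hτ hU hρ hφ hrT hηκ hηω hηρ
    (x i).2 (hSB i) ha hab hba hbr

/-- The volume of a side is at least that of the collar, which is estimated by cutting it into thin
slabs. The factors `exp (-η)` and `cellDistortion r η` tend to `1` with `η → 0`. -/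
lemma area_le_distortion_mul_volume_side (hE : IsFermiFlow τ U E κ ω T) (hm : m ≠ 0)
    (hτ : IsReflection (m + 1) τ) (hU : IsSide τ U) (hρ : 0 < ρ)
    (hφ : ∀ x, IsHypChart (φ x) x ρ) (hκ : 0 < κ) (hω : 0 < ω) (hr : 0 < r) (hrT : r < T)
    (hinj : ∀ x ∈ Function.fixedPoints τ, ∀ y ∈ Function.fixedPoints τ, ∀ s ∈ Ico 0 r,
      ∀ t ∈ Ico 0 r, E x s = E y t → x = y ∧ s = t)
    {η : ℝ} (hη : 0 < η) (hηκ : 2 * η < κ) (hηω : η ≤ ω) (hηρ : η ≤ ρ) :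
    ENNReal.ofReal (Real.exp (-η) * Real.sinh r) *
      Measure.euclideanHausdorffMeasure m (Function.fixedPoints τ) ≤
      ENNReal.ofReal (cellDistortion r η) ^ (m + 1) *
        Measure.euclideanHausdorffMeasure (m + 1) U := by
  obtain ⟨N, hN⟩ := exists_nat_gt (r / η)
  have hN0 : (0 : ℝ) < N := (div_pos hr hη).trans hN
  set d : ℝ := r / N with hd
  have hd0 : 0 < d := div_pos hr hN0
  have hdη : d ≤ η := by
    rw [hd, div_le_iff₀ hN0]
    rw [div_lt_iff₀ hη] at hN
    linarith
  have hNd : N * d = r := by rw [hd]; field_simp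
  have hle : ∀ k ∈ Finset.range N, ((k + 1 : ℕ) : ℝ) * d ≤ r := by
    intro k hk
    rw [← hNd]
    have : ((k + 1 : ℕ) : ℝ) ≤ N := by exact_mod_cast Finset.mem_range.1 hk
    gcongr
  set W : ℕ → Set M := fun k => (fun p : M × ℝ => E p.1 p.2) ''
    (Function.fixedPoints τ ×ˢ Ioo ((k : ℝ) * d) (((k + 1 : ℕ) : ℝ) * d)) with hW
  have hWm : ∀ k ∈ Finset.range N, MeasurableSet (W k) := fun k hk =>
    hE.measurableSet_image hκ hω hrT hinj
      (isClosed_fixedPoints hτ.isometry.continuous).measurableSet subset_rfl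
      (by positivity) (hle k hk)
  have hWd : (Finset.range N : Set ℕ).PairwiseDisjoint W := by
    intro i hi j hj hij
    refine disjoint_left.2 ?_
    rintro _ ⟨⟨y, s⟩, ⟨hy, hs⟩, rfl⟩ ⟨⟨z, t⟩, ⟨hz, ht⟩, h⟩
    have h0 : ∀ k : ℕ, 0 ≤ (k : ℝ) * d := fun k => by positivity
    have hst := (hinj z hz y hy t ⟨(h0 j).trans ht.1.le, ht.2.trans_le (hle j hj)⟩ s
      ⟨(h0 i).trans hs.1.le, hs.2.trans_le (hle i hi)⟩ h).2
    simp only at hs ht hst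
    subst hst
    have h1 : i < j + 1 := by
      exact_mod_cast lt_of_mul_lt_mul_right (hs.1.trans ht.2) hd0.le
    have h2 : j < i + 1 := by
      exact_mod_cast lt_of_mul_lt_mul_right (ht.1.trans hs.2) hd0.le
    omega
  have hWU : (⋃ k ∈ Finset.range N, W k) ⊆ U := by
    refine iUnion₂_subset fun k hk => ?_
    rintro _ ⟨⟨y, s⟩, ⟨hy, hs⟩, rfl⟩
    have h0 : 0 ≤ (k : ℝ) * d := by positivity
    exact hE.mem_side hτ hU hκ hω hrT.le hinj hy ⟨h0.trans_lt hs.1, hs.2.trans_le (hle k hk)⟩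
  have hsinh : Real.exp (-η) * Real.sinh r = ∑ k ∈ Finset.range N,
      Real.exp (-η) * (Real.sinh (((k + 1 : ℕ) : ℝ) * d) - Real.sinh ((k : ℝ) * d)) := by
    rw [← Finset.mul_sum, Finset.sum_range_sub (fun k : ℕ => Real.sinh ((k : ℝ) * d)), hNd]
    simp
  have hstep : ∀ k : ℕ, (k : ℝ) * d ≤ ((k + 1 : ℕ) : ℝ) * d := fun k => by
    gcongr; exact Nat.le_succ k
  rw [hsinh, ENNReal.ofReal_sum_of_nonneg fun k _ => mul_nonneg (Real.exp_pos _).le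
    (sub_nonneg.2 (Real.sinh_le_sinh.2 (hstep k))), Finset.sum_mul]
  calc _ ≤ ∑ k ∈ Finset.range N, ENNReal.ofReal (cellDistortion r η) ^ (m + 1) *
        Measure.euclideanHausdorffMeasure (m + 1) (W k) := by
        refine Finset.sum_le_sum fun k hk => ?_
        have h0 : 0 ≤ (k : ℝ) * d := by positivity
        have hba : ((k + 1 : ℕ) : ℝ) * d - k * d ≤ η := by push_cast; linarith
        refine le_trans ?_ (hE.area_le_volume_slab hτ hU hρ hφ hκ hω hrT hinj hη hηκ hηω hηρ
          h0 (hstep k) hba (hle k hk))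
        rw [← mul_assoc, ← ENNReal.ofReal_pow (Real.cosh_pos _).le,
          ← ENNReal.ofReal_mul (sub_nonneg.2 (hstep k))]
        refine mul_le_mul_left (ENNReal.ofReal_le_ofReal ?_) _
        refine (exp_neg_mul_sinh_sub_le h0 (hstep k) hba).trans ?_
        have := sub_nonneg.2 (hstep k)
        gcongr
        exact le_self_pow₀ (Real.one_le_cosh _) hm
    _ = ENNReal.ofReal (cellDistortion r η) ^ (m + 1) *
        Measure.euclideanHausdorffMeasure (m + 1) (⋃ k ∈ Finset.range N, W k) := by
        rw [← Finset.mul_sum, measure_biUnion_finset hWd hWm]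
    _ ≤ _ := by gcongr

/-- The volume of a side is at least `sinh r` times the area of the fixed point set, provided that
the collar of height `r` is embedded. The volume of the collar is the integral of `cosh t ^ m` over
`[0, r]` times the area, and `cosh t ^ m ≥ cosh t` for `m ≠ 0`. -/
lemma sinh_mul_area_le_volume_side (hE : IsFermiFlow τ U E κ ω T) (hm : m ≠ 0)
    (hτ : IsReflection (m + 1) τ) (hU : IsSide τ U) (hρ : 0 < ρ)
    (hφ : ∀ x, IsHypChart (φ x) x ρ) (hκ : 0 < κ) (hω : 0 < ω) (hr : 0 < r) (hrT : r < T)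
    (hinj : ∀ x ∈ Function.fixedPoints τ, ∀ y ∈ Function.fixedPoints τ, ∀ s ∈ Ico 0 r,
      ∀ t ∈ Ico 0 r, E x s = E y t → x = y ∧ s = t) :
    ENNReal.ofReal (Real.sinh r) *
      Measure.euclideanHausdorffMeasure m (Function.fixedPoints τ) ≤
        Measure.euclideanHausdorffMeasure (m + 1) U := by
  have hsr := Real.sinh_pos_iff.2 hr
  have hev : ∀ᶠ η in 𝓝[>] (0 : ℝ), ENNReal.ofReal (Real.exp (-η) * Real.sinh r) *
      Measure.euclideanHausdorffMeasure m (Function.fixedPoints τ) ≤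
      ENNReal.ofReal (cellDistortion r η) ^ (m + 1) *
        Measure.euclideanHausdorffMeasure (m + 1) U := by
    have hmin : 0 < min (κ / 3) (min ω ρ) := lt_min (by linarith) (lt_min hω hρ)
    filter_upwards [Ioo_mem_nhdsGT hmin] with η hη
    have h1 := lt_min_iff.1 hη.2
    have h2 := lt_min_iff.1 h1.2
    exact hE.area_le_distortion_mul_volume_side hm hτ hU hρ hφ hκ hω hr hrT hinj hη.1
      (by linarith) h2.1.le h2.2.le
  have hl : Tendsto (fun η : ℝ => ENNReal.ofReal (Real.exp (-η) * Real.sinh r)) (𝓝[>] 0)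
      (𝓝 (ENNReal.ofReal (Real.sinh r))) := by
    have h : ContinuousAt (fun η : ℝ => Real.exp (-η) * Real.sinh r) 0 := by fun_prop
    have := (ENNReal.tendsto_ofReal h.tendsto).mono_left (nhdsWithin_le_nhds (s := Ioi 0))
    simpa using this
  have hc : Tendsto (fun η : ℝ => ENNReal.ofReal (cellDistortion r η) ^ (m + 1)) (𝓝[>] 0)
      (𝓝 1) := by
    have h : ContinuousAt (fun η : ℝ => cellDistortion r η) 0 := by
      unfold cellDistortion; fun_prop
    have := ((ENNReal.continuous_pow (m + 1)).continuousAt.tendsto.comp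
      (ENNReal.tendsto_ofReal h.tendsto)).mono_left
      (nhdsWithin_le_nhds (s := Ioi 0))
    simpa [cellDistortion, Function.comp_def] using this
  refine le_of_tendsto_of_tendsto (ENNReal.Tendsto.mul_const hl (Or.inl ?_)) ?_ hev
  · simpa using hsr
  · simpa using ENNReal.Tendsto.mul_const (b := Measure.euclideanHausdorffMeasure (m + 1) U) hc
      (Or.inl one_ne_zero)

end IsFermiFlow

end Collar

/-! ### The Cheeger constant -/

/-- A side and its mirror image are disjoint and have the same volume. -/
lemma IsSide.volume_le_half {m : ℕ} {M : Type*} [MetricSpace M] [MeasurableSpace M]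
    [BorelSpace M] {τ : M → M} {U : Set M} (hτ : IsReflection (m + 1) τ) (hU : IsSide τ U) :
    Measure.euclideanHausdorffMeasure (m + 1) U ≤
      Measure.euclideanHausdorffMeasure (m + 1) (univ : Set M) / 2 := by
  have h1 : Measure.euclideanHausdorffMeasure (m + 1) (τ ⁻¹' U) =
      Measure.euclideanHausdorffMeasure (m + 1) U := by
    rw [← hτ.involutive.image_eq_preimage_symm]
    exact hτ.isometry.euclideanHausdorffMeasure_image U
  have hd : Disjoint U (τ ⁻¹' U) := disjoint_left.2 fun y hy hy' => hU.not_mem y hy hy'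
  rw [ENNReal.le_div_iff_mul_le (by simp) (by simp), mul_two]
  nth_rw 2 [← h1]
  rw [← measure_union hd (hU.isOpen.preimage hτ.isometry.continuous).measurableSet]
  exact measure_mono (subset_univ _)

/-- A side of a separating fixed point set shows that the Cheeger constant is at most `ε`: its collar
of height `arcsch ε` has volume at least `sinh (arcsch ε) = 1 / ε` times the area of its boundary. -/
lemma cheegerConstant_le_of_not_isConnected {n : ℕ} {M : Type*} [MetricSpace M]
    [MeasurableSpace M] [BorelSpace M] {τ : M → M} {ε : ℝ} (hn : 2 ≤ n)
    (hM : IsClosedHyperbolicManifold n M) (hτ : IsReflection n τ) (hε : 0 < ε)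
    (hsys : ENNReal.ofReal (4 * arcsch ε) ≤ systole M)
    (hsep : ¬ IsConnected (Function.fixedPoints τ)ᶜ) :
    cheegerConstant n M ≤ ENNReal.ofReal ε := by
  obtain ⟨m, rfl⟩ : ∃ m, n = m + 1 := ⟨n - 1, by omega⟩
  have := hM.compact
  have := hM.connected
  obtain ⟨ρ, hρ, φ, hφ⟩ := exists_uniform_isHypChart hM.locallyHyperbolic
  obtain ⟨U, hU⟩ := hτ.exists_isSide hρ hφ hsep
  have hr : 0 < arcsch ε := Real.arsinh_pos_iff.2 (by positivity)
  obtain ⟨E, κ, hκ, ω, hω, hE⟩ := exists_isFermiFlow hτ hU hρ hφ (arcsch ε + 1)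
  have hgeo : ∀ (γ : ℝ → M) (ℓ : ℝ), IsClosedGeodesic γ ℓ → 4 * arcsch ε ≤ ℓ := by
    intro γ ℓ hγ
    rw [← ENNReal.ofReal_le_ofReal_iff hγ.1.le]
    exact hsys.trans (iInf₂_le ℓ ⟨γ, hγ⟩)
  have hinj := hE.injective_of_le_length hτ hU hρ hφ hκ hω (lt_add_one _) hgeo
  have hvol := hE.sinh_mul_area_le_volume_side (by omega) hτ hU hρ hφ hκ hω hr (lt_add_one _) hinj
  have hfr := hU.frontier_eq hτ
  refine (iInf₂_le U ⟨hU.isOpen, hU.isConnected, ?_, hU.volume_le_half hτ⟩).trans ?_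
  rotate_left
  · rw [hfr]
    exact isRectifiable_fixedPoints hτ hU hρ hφ
  · rw [hfr]
    refine ENNReal.div_le_of_le_mul ?_
    have hmul : ENNReal.ofReal ε * ENNReal.ofReal (Real.sinh (arcsch ε)) = 1 := by
      rw [← ENNReal.ofReal_mul hε.le, arcsch, Real.sinh_arsinh, mul_one_div_cancel hε.ne',
        ENNReal.ofReal_one]
    calc area (m + 1) (Function.fixedPoints τ)
        = ENNReal.ofReal ε * (ENNReal.ofReal (Real.sinh (arcsch ε)) *
            Measure.euclideanHausdorffMeasure m (Function.fixedPoints τ)) := by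
          rw [← mul_assoc, hmul, one_mul]; rfl
      _ ≤ ENNReal.ofReal ε * vol (m + 1) U := by gcongr; exact hvol

theorem theorem1 :
    (∀ (n : ℕ → ℕ) (M : ℕ → Type*) [∀ i, MetricSpace (M i)] [∀ i, MeasurableSpace (M i)]
        [∀ i, BorelSpace (M i)] (τ : ∀ i, M i → M i),
      (∀ i, 2 ≤ n i) →
      (∀ i, IsClosedHyperbolicManifold (n i) (M i)) →
      IsExpanderSequence n M →
      Tendsto (fun i => systole (M i)) atTop (𝓝 ⊤) →
      (∀ i, IsReflection (n i) (τ i)) →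
      ∀ᶠ i in atTop, IsConnected (Function.fixedPoints (τ i))ᶜ) ∧
    (∀ (n : ℕ) (M : Type*) [MetricSpace M] [MeasurableSpace M] [BorelSpace M] (τ : M → M) (ε : ℝ),
      2 ≤ n →
      IsClosedHyperbolicManifold n M →
      IsReflection n τ →
      0 < ε →
      ENNReal.ofReal ε < cheegerConstant n M →
      ENNReal.ofReal (4 * arcsch ε) ≤ systole M →
      IsConnected (Function.fixedPoints τ)ᶜ) := by
  refine ⟨?_, ?_⟩
  · intro n M _ _ _ τ hn hM hexp hsys hτ
    obtain ⟨-, ε, hε, hcheeger⟩ := hexp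
    filter_upwards [hsys.eventually_const_le
      (ENNReal.ofReal_lt_top (r := 4 * arcsch ε))] with i hi
    by_contra hsep
    exact (hcheeger i).not_ge
      (cheegerConstant_le_of_not_isConnected (hn i) (hM i) (hτ i) hε hi hsep)
  · intro n M _ _ _ τ ε hn hM hτ hε hcheeger hsys
    by_contra hsep
    exact hcheeger.not_ge (cheegerConstant_le_of_not_isConnected hn hM hτ hε hsys hsep)
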